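/- Conventions. A metric measure space $(X,d,\mu)$ is a metric space with a (Borel regular) Borel measure for which every ball $B(x,r)=\{y: d(x,y)<r\}$, $r>0$, has finite and positive measure. It is Ahlfors $n$-regular if there are constants $0<C_1\le 1\le C_2$ such that $C_1\lambda^{n}\mu(B(x,r))\le\mu(B(x,\lambda r))\le C_2\lambda^{n}\mu(B(x,r))$ for all $x\in X$, $0<r<2\operatorname{diam}X$ and $1\le\lambda<2\operatorname{diam}X/r$. "Measurable" means $\mu$-measurable (equal $\mu$-almost everywhere to a Borel function). For $s\in(0,\infty)$ and a measurable $u:X\to\mathbb R$, let $\mathbb D^s(u)$ be the set of all sequences $\vec g=\{g_k\}_{k\in\mathbb Z}$ of measurable functions $g_k:X\to[0,\infty)$ for which there is $E\subset X$ with $\mu(E)=0$ such that $$|u(x)-u(y)|\le d(x,y)^s\,[g_k(x)+g_k(y)]\quad\text{for all }k\in\mathbb Z,\ x,y\in X\setminus E\text{ with }2^{-k-1}\le d(x,y)<2^{-k}.$$ For $p\in(0,\infty)$ and $q\in(0,\infty]$, $\dot M^s_{p,q}(X)$ is the space of all measurable $u:X\to\mathbb R$ with $$\|u\|_{\dot M^s_{p,q}(X)}=\inf_{\vec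 g\in\mathbb D^s(u)}\Big\|\,\|\{g_k\}_{k\in\mathbb Z}\|_{\ell^q}\Big\|_{L^p(X)}<\infty .$$ A homeomorphism $f:X\to Y$ is quasisymmetric if there is a homeomorphism $\eta:[0,\infty)\to[0,\infty)$ with $\frac{d_Y(f(x),f(a))}{d_Y(f(x),f(b))}\le\eta\Big(\frac{d_X(x,a)}{d_X(x,b)}\Big)$ for all $a,b,x\in X$ with $x\ne b$. It is absolutely continuous if $\mu_X(E)=0$ implies $\mu_Y(f(E))=0$. Its volume derivative is $J_f(x)=\lim_{r\to0}\mu_Y(f(B(x,r)))/\mu_X(B(x,r))$ (the upper limit is taken at points where the limit does not exist). For $r\in(1,\infty]$, $\mathcal B_r(X)$ is the class of $w:X\to[0,\infty]$ for which there is a finite constant $C$ such that, for every ball $B\subset X$, $\Big(\frac1{\mu(B)}\int_B w^r\,d\mu\Big)^{1/r}\le\frac{C}{\mu(B)}\int_B w\,d\mu$, where the left-hand side is $\operatorname{ess\,sup}_B w$ if $r=\infty$. Corollary 5.2. Let $n_1,n_2\in(0,\infty)$, and let $X$ and $Y$ be Ahlfors $n_1$-regular and Ahlfors $n_2$-regular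 metric measure spaces, respectively. Let $f$ be a quasisymmetric mapping from $X$ onto $Y$ such that $f$ and $f^{-1}$ are absolutely continuous and $J_f\in\mathcal B_r(X)$ for some $r\in(1,\infty]$. Let $s_1\in(0,n_1)$ and $s_2\in(0,n_2)$ satisfy $n_1/s_1=n_2/s_2$, and let $q\in(0,\infty]$. Then $f$ and $f^{-1}$ induce bounded composition operators between $\dot M^{s_1}_{n_1/s_1,q}(X)$ and $\dot M^{s_2}_{n_2/s_2,q}(Y)$: there is a finite constant $C$ such that (a) for every $u\in\dot M^{s_2}_{n_2/s_2,q}(Y)$, $u\circ f\in\dot M^{s_1}_{n_1/s_1,q}(X)$ and $\|u\circ f\|_{\dot M^{s_1}_{n_1/s_1,q}(X)}\le C\,\|u\|_{\dot M^{s_2}_{n_2/s_2,q}(Y)}$; (b) for every $v\in\dot M^{s_1}_{n_1/s_1,q}(X)$, $v\circ f^{-1}\in\dot M^{s_2}_{n_2/s_2,q}(Y)$ and $\|v\circ f^{-1}\|_{\dot M^{s_2}_{n_2/s_2,q}(Y)}\le C\,\|v\|_{\dot M^{s_1}_{n_1/s_1,q}(X)}$. -/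

import Mathlib

open MeasureTheory Set Filter Topology Metric
open scoped NNReal ENNReal

noncomputable section

namespace HajlaszTL

section OneSpace

variable {X : Type*} [MetricSpace X] [MeasurableSpace X]

/-- All balls (of positive radius) have finite and positive measure. Together with `BorelSpace X`
this says that `(X, d, μ)` is a metric measure space; a Mathlib measure on a Borel space is
automatically Borel regular (every set lies in a Borel set of the same measure). -/
def BallsFinitePos (μ : Measure X) : Prop :=
  ∀ (x : X) (r : ℝ), 0 < r → 0 < μ (ball x r) ∧ μ (ball x r) < ∞

/-- Ahlfors `n`-regularity: there are constants `0 < C₁ ≤ 1 ≤ C₂` with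
`C₁ t ^ n μ(B(x, r)) ≤ μ(B(x, t r)) ≤ C₂ t ^ n μ(B(x, r))` for all `x`, all `0 < r < 2 diam X`
and all `1 ≤ t < 2 diam X / r`. The diameter is extended-valued (infinite if `X` is unbounded). -/
def AhlforsRegular (n : ℝ) (μ : Measure X) : Prop :=
  ∃ C₁ C₂ : ℝ, 0 < C₁ ∧ C₁ ≤ 1 ∧ 1 ≤ C₂ ∧
    ∀ (x : X) (r t : ℝ), 0 < r → ENNReal.ofReal r < 2 * ediam (univ : Set X) →
      1 ≤ t → ENNReal.ofReal (t * r) < 2 * ediam (univ : Set X) →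
        ENNReal.ofReal (C₁ * t ^ n) * μ (ball x r) ≤ μ (ball x (t * r)) ∧
        μ (ball x (t * r)) ≤ ENNReal.ofReal (C₂ * t ^ n) * μ (ball x r)

/-- The class of weights satisfying the reverse Hölder inequality of order `r ∈ (1, ∞]`:
with one finite constant `C`, for all balls `B`,
`(⨍_B w ^ r) ^ (1 / r) ≤ C ⨍_B w`, the left side being `esssup_B w` when `r = ∞`. -/
def ReverseHolder (r : ℝ≥0∞) (μ : Measure X) (w : X → ℝ≥0∞) : Prop :=
  ∃ C : ℝ≥0, ∀ (x : X) (ρ : ℝ), 0 < ρ →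
    (if r = ∞ then essSup w (μ.restrict (ball x ρ))
      else (⨍⁻ y in ball x ρ, w y ^ r.toReal ∂μ) ^ (1 / r.toReal))
      ≤ C * ⨍⁻ y in ball x ρ, w y ∂μ

/-- `g = (g k)` is a fractional `s`-Hajłasz gradient of `u`: the `g k` are nonnegative
`μ`-measurable functions, and off one `μ`-null set `E`,
`|u x - u y| ≤ d(x, y) ^ s (g k x + g k y)` whenever `2 ^ (-k-1) ≤ d(x, y) < 2 ^ (-k)`. -/
def IsFracHajlaszGradient (s : ℝ) (μ : Measure X) (u : X → ℝ) (g : ℤ → X → ℝ≥0) : Prop :=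
  (∀ k, AEMeasurable (g k) μ) ∧
  ∃ E : Set X, μ E = 0 ∧ ∀ (k : ℤ) (x y : X), x ∉ E → y ∉ E →
    (2 : ℝ) ^ (-k - 1) ≤ dist x y → dist x y < (2 : ℝ) ^ (-k) →
      |u x - u y| ≤ dist x y ^ s * ((g k x : ℝ) + (g k y : ℝ))

/-- The `ℓ^q` (quasi-)norm of a nonnegative sequence indexed by `ℤ`, for `q ∈ (0, ∞]`. -/
def ellNorm (q : ℝ≥0∞) (a : ℤ → ℝ≥0) : ℝ≥0∞ :=
  if q = ∞ then ⨆ k, (a k : ℝ≥0∞) else (∑' k, (a k : ℝ≥0∞) ^ q.toReal) ^ (1 / q.toReal)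

/-- The `L^p(X, ℓ^q)` (quasi-)norm, for `p ∈ (0, ∞)` and `q ∈ (0, ∞]`. -/
def mixedNorm (p : ℝ) (q : ℝ≥0∞) (μ : Measure X) (g : ℤ → X → ℝ≥0) : ℝ≥0∞ :=
  (∫⁻ x, ellNorm q (fun k => g k x) ^ p ∂μ) ^ (1 / p)

/-- The homogeneous Hajłasz-Triebel-Lizorkin (quasi-)seminorm, for `s, p ∈ (0, ∞)` and
`q ∈ (0, ∞]`. -/
def hajlaszTLNorm (s p : ℝ) (q : ℝ≥0∞) (μ : Measure X) (u : X → ℝ) : ℝ≥0∞ :=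
  ⨅ (g : ℤ → X → ℝ≥0) (_ : IsFracHajlaszGradient s μ u g), mixedNorm p q μ g

/-- The homogeneous Hajłasz-Triebel-Lizorkin space: `μ`-measurable functions of finite
seminorm. -/
def MSpace (s p : ℝ) (q : ℝ≥0∞) (μ : Measure X) : Set (X → ℝ) :=
  {u | AEMeasurable u μ ∧ hajlaszTLNorm s p q μ u < ∞}

end OneSpace

section TwoSpaces

variable {X Y : Type*} [MetricSpace X] [MetricSpace Y]

/-- A homeomorphism `f` is quasisymmetric if, for some homeomorphism `η` of `[0, ∞)`,
`d(f x, f a) / d(f x, f b) ≤ η (d(x, a) / d(x, b))` for all `a, b, x` with `x ≠ b`. -/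
def Quasisymmetric (f : X ≃ₜ Y) : Prop :=
  ∃ η : ℝ≥0 ≃ₜ ℝ≥0, ∀ a b x : X, x ≠ b →
    nndist (f x) (f a) / nndist (f x) (f b) ≤ η (nndist x a / nndist x b)

variable [MeasurableSpace X] [MeasurableSpace Y]

/-- Absolute continuity of a map between measure spaces: null sets have null images. -/
def AbsContMap (μ : Measure X) (ν : Measure Y) (f : X → Y) : Prop :=
  ∀ E : Set X, μ E = 0 → ν (f '' E) = 0

/-- The volume derivative `J_f(x) = lim_{r → 0} ν(f(B(x, r))) / μ(B(x, r))`. It is written as an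
upper limit, so that it equals the limit at every point where the limit exists. -/
def volDeriv (μ : Measure X) (ν : Measure Y) (f : X → Y) (x : X) : ℝ≥0∞ :=
  limsup (fun r : ℝ => ν (f '' ball x r) / μ (ball x r)) (𝓝[>] 0)

end TwoSpaces

end HajlaszTL

end

noncomputable section

namespace HajlaszTL

/-!
The volume derivative of `f` is comparable to the density `J` of the pulled-back measure
`E ↦ ν(f(E))`, so `J` satisfies a reverse Hölder inequality and is an `A_∞` weight: a small part of
a ball `B` carries at most half of the integral of `J` over `B`. Hence `J ≥ c ν(f(B)) / μ(B)` on a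
good part of `B`, of measure comparable to `μ(B)`. The map `f⁻¹`, with density `1 / J ∘ f⁻¹`, also
has good parts, so one argument serves both directions.

Let `s₁ p = n₁` and `s₂ p = n₂`, let `B` have radius `ρ`, and let `z` lie in its good part. For `w`
at distance about `ρ` from `z`, quasisymmetry and regularity give
`d(f z, f w) ^ n₂ ≲ ν(f(B)) ≲ ρ ^ n₁ J(z)`, that is, `d(f z, f w) ^ s₂ ≲ ρ ^ s₁ J(z) ^ (1 / p)`. A
gradient `G` of `u` therefore controls the oscillation of `u ∘ f` between good points through
`J ^ (1 / p) G_i ∘ f`, where `2 ^ (-i)` is about `d(f z, f w)`; quasisymmetry bounds the number of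
pairs `(i, j)` of scales that meet in this way, and the change of variables absorbs `J`. Chaining
through good points of shrinking balls, which are chosen by Chebyshev's inequality, yields a
gradient of `u ∘ f` made of averages of `σ`-th powers, where `σ ≤ min(p, q)` is chosen so that the
vector-valued maximal inequality bounds it in `L^p(ℓ^q)`.
-/

/-! ### Averages over dyadic balls and their maximal function -/

section Averages

variable {X : Type*} [MetricSpace X] [MeasurableSpace X]

/-- The average of `φ` over the ball of radius `2 ^ (-j)`. It is normalized by the `n`-th power of
the radius instead of the measure of the ball, which makes the operator self-adjoint. -/
def dyadicAvg (n : ℝ) (μ : Measure X) (j : ℤ) (φ : X → ℝ≥0∞) (x : X) : ℝ≥0∞ :=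
  ENNReal.ofReal (((2 : ℝ) ^ (-j)) ^ (-n)) * ∫⁻ y in ball x ((2 : ℝ) ^ (-j)), φ y ∂μ

/-- The maximal function of the averages `dyadicAvg`. -/
def dyadicMax (n : ℝ) (μ : Measure X) (φ : X → ℝ≥0∞) (x : X) : ℝ≥0∞ :=
  ⨆ j, dyadicAvg n μ j φ x

/-- The upper bound `μ(B(x, ρ)) ≤ K ρ ^ n` for all balls. -/
def UpperRegular (n : ℝ) (K : ℝ≥0) (μ : Measure X) : Prop :=
  ∀ (x : X) (ρ : ℝ), 0 < ρ → μ (ball x ρ) ≤ K * ENNReal.ofReal (ρ ^ n)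

variable {n : ℝ} {K : ℝ≥0} {μ : Measure X} {φ ψ : X → ℝ≥0∞}

lemma ofReal_rpow_neg_mul_self (n : ℝ) {ρ : ℝ} (hρ : 0 < ρ) :
    ENNReal.ofReal (ρ ^ (-n)) * ENNReal.ofReal (ρ ^ n) = 1 := by
  rw [← ENNReal.ofReal_mul (by positivity), ← Real.rpow_add hρ, neg_add_cancel, Real.rpow_zero,
    ENNReal.ofReal_one]

lemma setLIntegral_ball_eq_mul_dyadicAvg (φ : X → ℝ≥0∞) (j : ℤ) (x : X) :
    ∫⁻ y in ball x (2 ^ (-j)), φ y ∂μ =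
      ENNReal.ofReal ((2 ^ (-j)) ^ n) * dyadicAvg n μ j φ x := by
  rw [dyadicAvg, ← mul_assoc, mul_comm (ENNReal.ofReal _),
    ofReal_rpow_neg_mul_self n (by positivity), one_mul]

lemma dyadicAvg_mono (h : φ ≤ ψ) (j : ℤ) : dyadicAvg n μ j φ ≤ dyadicAvg n μ j ψ :=
  fun _ => mul_le_mul_right (lintegral_mono h) _

lemma dyadicAvg_le_dyadicMax (j : ℤ) (φ : X → ℝ≥0∞) (x : X) :
    dyadicAvg n μ j φ x ≤ dyadicMax n μ φ x :=
  le_iSup (fun j => dyadicAvg n μ j φ x) j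

lemma dyadicAvg_congr_ae (h : φ =ᵐ[μ] ψ) (j : ℤ) (x : X) :
    dyadicAvg n μ j φ x = dyadicAvg n μ j ψ x := by
  rw [dyadicAvg, lintegral_congr_ae (ae_restrict_of_ae h), dyadicAvg]

lemma dyadicAvg_const_le (hK : UpperRegular n K μ) (c : ℝ≥0∞) (j : ℤ) (x : X) :
    dyadicAvg n μ j (fun _ => c) x ≤ K * c := by
  have hρ : (0 : ℝ) < 2 ^ (-j) := by positivity
  calc dyadicAvg n μ j (fun _ => c) x
      = ENNReal.ofReal ((2 ^ (-j)) ^ (-n)) * (c * μ (ball x (2 ^ (-j)))) := by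
        rw [dyadicAvg, setLIntegral_const]
    _ ≤ ENNReal.ofReal ((2 ^ (-j)) ^ (-n)) * (c * (K * ENNReal.ofReal ((2 ^ (-j)) ^ n))) := by
        gcongr
        exact hK x _ hρ
    _ = ENNReal.ofReal ((2 ^ (-j)) ^ (-n)) * ENNReal.ofReal ((2 ^ (-j)) ^ n) * (K * c) := by ring
    _ = K * c := by rw [ofReal_rpow_neg_mul_self n hρ, one_mul]

lemma dyadicAvg_rpow_mul_rpow_le {a b : ℝ} (ha : 0 ≤ a) (hb : 0 ≤ b) (hab : a + b = 1)
    (hφ : Measurable φ) (hψ : Measurable ψ) (j : ℤ) (x : X) :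
    dyadicAvg n μ j (fun y => φ y ^ a * ψ y ^ b) x ≤
      dyadicAvg n μ j φ x ^ a * dyadicAvg n μ j ψ x ^ b := by
  simp only [dyadicAvg]
  set c := ENNReal.ofReal (((2 : ℝ) ^ (-j)) ^ (-n))
  have hc : c = c ^ a * c ^ b := by
    rw [← ENNReal.rpow_add_of_nonneg _ _ ha hb, hab, ENNReal.rpow_one]
  rw [ENNReal.mul_rpow_of_nonneg _ _ ha, ENNReal.mul_rpow_of_nonneg _ _ hb, mul_mul_mul_comm, ← hc]
  gcongr
  exact ENNReal.lintegral_mul_norm_pow_le hφ.aemeasurable hψ.aemeasurable ha hb hab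

lemma dyadicAvg_add (hφ : Measurable φ) (j : ℤ) (x : X) :
    dyadicAvg n μ j (fun y => φ y + ψ y) x = dyadicAvg n μ j φ x + dyadicAvg n μ j ψ x := by
  rw [dyadicAvg, lintegral_add_left hφ, mul_add, dyadicAvg, dyadicAvg]

lemma mul_measure_ball_four_mul_le (hK : UpperRegular n K μ) {t : ℝ≥0∞} {x : X} {j : ℤ}
    (h : t ≤ dyadicAvg n μ j φ x) :
    t * μ (ball x (4 * 2 ^ (-j))) ≤
      K * ENNReal.ofReal (4 ^ n) * ∫⁻ y in ball x (2 ^ (-j)), φ y ∂μ := by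
  have hρ : (0 : ℝ) < 2 ^ (-j) := by positivity
  calc t * μ (ball x (4 * 2 ^ (-j)))
      ≤ dyadicAvg n μ j φ x * (K * ENNReal.ofReal ((4 * 2 ^ (-j)) ^ n)) := by
        gcongr
        exact hK x _ (by positivity)
    _ = K * ENNReal.ofReal (4 ^ n) *
          (ENNReal.ofReal ((2 ^ (-j)) ^ n) * dyadicAvg n μ j φ x) := by
        rw [Real.mul_rpow (by norm_num) hρ.le, ENNReal.ofReal_mul (by positivity)]
        ring
    _ = _ := by rw [setLIntegral_ball_eq_mul_dyadicAvg]

variable [BorelSpace X] [SecondCountableTopology X]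

lemma mul_measure_le_of_forall_le_dyadicAvg (hK : UpperRegular n K μ) {t : ℝ≥0∞} {E : Set X}
    {j : X → ℤ} {N : ℤ} (hjN : ∀ x ∈ E, N ≤ j x) (hE : ∀ x ∈ E, t ≤ dyadicAvg n μ (j x) φ x) :
    t * μ E ≤ K * ENNReal.ofReal (4 ^ n) * ∫⁻ x, φ x ∂μ := by
  obtain ⟨u, huE, hdisj, hcov⟩ := Vitali.exists_disjoint_subfamily_covering_enlargement_ball E
    (fun x => x) (fun x => (2 : ℝ) ^ (-j x)) ((2 : ℝ) ^ (-N))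
    (fun x hx => zpow_le_zpow_right₀ one_le_two (neg_le_neg (hjN x hx))) 4 (by norm_num)
  have hpos : ∀ x, (0 : ℝ) < 2 ^ (-j x) := fun x => by positivity
  have hu : u.Countable := hdisj.countable_of_isOpen (fun _ _ => isOpen_ball)
    (fun x _ => nonempty_ball.2 (hpos x))
  have hsub : E ⊆ ⋃ b ∈ u, ball b (4 * 2 ^ (-j b)) := fun x hx =>
    let ⟨b, hb, hxb⟩ := hcov x hx
    mem_biUnion hb (hxb (mem_ball_self (hpos x)))
  calc t * μ E ≤ t * ∑' b : u, μ (ball (b : X) (4 * 2 ^ (-j b))) := by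
        gcongr
        exact (measure_mono hsub).trans (measure_biUnion_le μ hu _)
    _ = ∑' b : u, t * μ (ball (b : X) (4 * 2 ^ (-j b))) := by rw [ENNReal.tsum_mul_left]
    _ ≤ ∑' b : u, K * ENNReal.ofReal (4 ^ n) * ∫⁻ y in ball (b : X) (2 ^ (-j b)), φ y ∂μ :=
        ENNReal.tsum_le_tsum fun b => mul_measure_ball_four_mul_le hK (hE b (huE b.2))
    _ = K * ENNReal.ofReal (4 ^ n) * ∫⁻ y in ⋃ b ∈ u, ball b (2 ^ (-j b)), φ y ∂μ := by
        rw [ENNReal.tsum_mul_left, lintegral_biUnion hu (fun _ _ => measurableSet_ball) hdisj]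
    _ ≤ K * ENNReal.ofReal (4 ^ n) * ∫⁻ x, φ x ∂μ := by
        gcongr
        exact Measure.restrict_le_self

theorem mul_measure_lt_dyadicMax_le (hK : UpperRegular n K μ) (t : ℝ≥0∞) :
    t * μ {x | t < dyadicMax n μ φ x} ≤ K * ENNReal.ofReal (4 ^ n) * ∫⁻ x, φ x ∂μ := by
  -- Vitali's covering lemma needs bounded radii, so the scales are exhausted by `-N ≤ j`.
  set E : ℕ → Set X := fun N => {x | ∃ j : ℤ, -(N : ℤ) ≤ j ∧ t < dyadicAvg n μ j φ x}
  have hE : {x | t < dyadicMax n μ φ x} = ⋃ N, E N := by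
    ext x
    simp only [dyadicMax, lt_iSup_iff, mem_ofPred_eq, mem_iUnion, E]
    exact ⟨fun ⟨j, hj⟩ => ⟨j.natAbs, j, by omega, hj⟩, fun ⟨_, j, _, hj⟩ => ⟨j, hj⟩⟩
  have hmono : Monotone E := fun N M hNM x ⟨j, hj, h⟩ => ⟨j, by omega, h⟩
  rw [hE, hmono.measure_iUnion, ENNReal.mul_iSup]
  refine iSup_le fun N => ?_
  have hscale : ∀ x, ∃ j : ℤ, x ∈ E N → -(N : ℤ) ≤ j ∧ t < dyadicAvg n μ j φ x := fun x => by
    by_cases hx : x ∈ E N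
    · exact hx.imp fun _ hj _ => hj
    · exact ⟨0, fun h => absurd h hx⟩
  choose j hj using hscale
  exact mul_measure_le_of_forall_le_dyadicAvg hK (fun x hx => (hj x hx).1)
    fun x hx => (hj x hx).2.le

lemma measurable_indicator_ball (hφ : Measurable φ) (r : ℝ) :
    Measurable fun p : X × X => (ball p.1 r).indicator φ p.2 :=
  (hφ.comp measurable_snd).indicator (s := {p : X × X | dist p.2 p.1 < r})
    (measurableSet_lt (measurable_snd.dist measurable_fst) measurable_const)

variable [SigmaFinite μ]

lemma measurable_dyadicAvg (hφ : Measurable φ) (j : ℤ) : Measurable (dyadicAvg n μ j φ) := by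
  unfold dyadicAvg
  simp_rw [← lintegral_indicator measurableSet_ball]
  exact (measurable_indicator_ball hφ _).lintegral_prod_right'.const_mul _

lemma measurable_dyadicMax (hφ : Measurable φ) : Measurable (dyadicMax n μ φ) :=
  Measurable.iSup fun j => measurable_dyadicAvg hφ j

lemma lintegral_setLIntegral_ball_mul (hφ : Measurable φ) (hψ : Measurable ψ) (r : ℝ) :
    ∫⁻ x, (∫⁻ y in ball x r, φ y ∂μ) * ψ x ∂μ = ∫⁻ x, φ x * ∫⁻ y in ball x r, ψ y ∂μ ∂μ := by
  simp_rw [← lintegral_indicator measurableSet_ball]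
  calc ∫⁻ x, (∫⁻ y, (ball x r).indicator φ y ∂μ) * ψ x ∂μ
      = ∫⁻ x, ∫⁻ y, (ball x r).indicator φ y * ψ x ∂μ ∂μ :=
        lintegral_congr fun x => (lintegral_mul_const _ (hφ.indicator measurableSet_ball)).symm
    _ = ∫⁻ y, ∫⁻ x, (ball x r).indicator φ y * ψ x ∂μ ∂μ := lintegral_lintegral_swap
        ((measurable_indicator_ball hφ r).mul (hψ.comp measurable_fst)).aemeasurable
    _ = ∫⁻ y, ∫⁻ x, φ y * (ball y r).indicator ψ x ∂μ ∂μ := by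
        refine lintegral_congr fun y => lintegral_congr fun x => ?_
        simp only [indicator, mem_ball, dist_comm x y, ite_mul, zero_mul, mul_ite, mul_zero]
    _ = ∫⁻ y, φ y * ∫⁻ x, (ball y r).indicator ψ x ∂μ ∂μ :=
        lintegral_congr fun y => lintegral_const_mul _ (hψ.indicator measurableSet_ball)

lemma lintegral_dyadicAvg_mul (hφ : Measurable φ) (hψ : Measurable ψ) (j : ℤ) :
    ∫⁻ x, dyadicAvg n μ j φ x * ψ x ∂μ = ∫⁻ x, φ x * dyadicAvg n μ j ψ x ∂μ := by
  simp only [dyadicAvg, mul_assoc, mul_left_comm (φ _)]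
  rw [lintegral_const_mul' _ _ ENNReal.ofReal_ne_top,
    lintegral_const_mul' _ _ ENNReal.ofReal_ne_top, lintegral_setLIntegral_ball_mul hφ hψ]

lemma lintegral_dyadicAvg_le (hK : UpperRegular n K μ) (hφ : Measurable φ) (j : ℤ) :
    ∫⁻ x, dyadicAvg n μ j φ x ∂μ ≤ K * ∫⁻ x, φ x ∂μ := by
  calc ∫⁻ x, dyadicAvg n μ j φ x ∂μ = ∫⁻ x, φ x * dyadicAvg n μ j (fun _ => 1) x ∂μ := by
        simpa only [mul_one] using
          lintegral_dyadicAvg_mul (n := n) (μ := μ) hφ (measurable_const (a := (1 : ℝ≥0∞))) j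
    _ ≤ ∫⁻ x, φ x * K ∂μ := by
        gcongr with x
        simpa only [mul_one] using dyadicAvg_const_le hK 1 j x
    _ = K * ∫⁻ x, φ x ∂μ := by rw [lintegral_mul_const _ hφ, mul_comm]

end Averages

/-! ### The strong maximal inequality -/

section DyadicLayers

lemma rpow_sub_one_mul_self {P : ℝ} (hP : 1 ≤ P) (a : ℝ≥0∞) : a ^ (P - 1) * a = a ^ P := by
  nth_rewrite 2 [← ENNReal.rpow_one a]
  rw [← ENNReal.rpow_add_of_nonneg _ _ (sub_nonneg.2 hP) zero_le_one, sub_add_cancel]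

lemma two_rpow_add (a b : ℝ) : (2 : ℝ≥0∞) ^ (a + b) = 2 ^ a * 2 ^ b :=
  ENNReal.rpow_add _ _ two_ne_zero ENNReal.ofNat_ne_top

lemma two_rpow_ne_zero (a : ℝ) : (2 : ℝ≥0∞) ^ a ≠ 0 := by
  simp [ENNReal.rpow_eq_zero_iff]

lemma two_rpow_ne_top (a : ℝ) : (2 : ℝ≥0∞) ^ a ≠ ∞ := by
  simp [ENNReal.rpow_eq_top_iff]

/-- The sum of the geometric series of ratio `2 ^ (-s)`. -/
def geomSum (s : ℝ) : ℝ≥0∞ := ∑' l : ℕ, 2 ^ (-(l * s))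

lemma geomSum_ne_top {s : ℝ} (hs : 0 < s) : geomSum s ≠ ∞ := by
  have hpow : ∀ l : ℕ, (2 : ℝ≥0∞) ^ (-(l * s)) = (2 ^ (-s)) ^ l := fun l => by
    rw [← ENNReal.rpow_natCast, ← ENNReal.rpow_mul, neg_mul, mul_comm]
  have hlt : (2 : ℝ≥0∞) ^ (-s) < 1 :=
    ENNReal.rpow_lt_one_of_one_lt_of_neg ENNReal.one_lt_two (neg_lt_zero.2 hs)
  rw [geomSum, tsum_congr hpow, ENNReal.tsum_geometric]
  exact ENNReal.inv_ne_top.2 (tsub_pos_of_lt hlt).ne'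

lemma geomSum_ne_zero (s : ℝ) : geomSum s ≠ 0 := fun h =>
  two_rpow_ne_zero _ (ENNReal.tsum_eq_zero.1 h 0)

lemma exists_two_rpow_lt_le {b : ℝ≥0∞} (h0 : b ≠ 0) (ht : b ≠ ∞) :
    ∃ i : ℤ, (2 : ℝ≥0∞) ^ (i : ℝ) < b ∧ b ≤ 2 ^ ((i : ℝ) + 1) := by
  obtain ⟨i, hi⟩ := ENNReal.exists_mem_Ioc_zpow h0 ht ENNReal.one_lt_two ENNReal.ofNat_ne_top
  refine ⟨i, ?_⟩
  rwa [← Int.cast_one (R := ℝ), ← Int.cast_add, ENNReal.rpow_intCast, ENNReal.rpow_intCast]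

lemma tsum_ite_two_rpow_lt_le {s : ℝ} (hs : 0 < s) (b : ℝ≥0∞) :
    ∑' i : ℤ, (if (2 : ℝ≥0∞) ^ (i : ℝ) < b then (2 : ℝ≥0∞) ^ (i * s) else 0) ≤
      geomSum s * b ^ s := by
  rcases eq_or_ne b 0 with rfl | h0
  · simp
  rcases eq_or_ne b ∞ with rfl | ht
  · simp [ENNReal.top_rpow_of_pos hs, ENNReal.mul_top (geomSum_ne_zero s)]
  obtain ⟨k, hkb, hbk⟩ := exists_two_rpow_lt_le h0 ht
  have hle : ∀ i : ℤ, (2 : ℝ≥0∞) ^ (i : ℝ) < b → i ≤ k := fun i hi => by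
    by_contra! hc
    exact (hi.trans_le hbk).not_ge
      (ENNReal.rpow_le_rpow_of_exponent_le one_le_two (by exact_mod_cast hc))
  have hinj : Function.Injective fun l : ℕ => k - (l : ℤ) := fun a b h => by simpa using h
  have hsupp : Function.support (fun i : ℤ => if (2 : ℝ≥0∞) ^ (i : ℝ) < b then
      (2 : ℝ≥0∞) ^ (i * s) else 0) ⊆ range fun l : ℕ => k - (l : ℤ) := fun i hi => by
    have hik := hle i (by_contra fun hc => hi (if_neg hc))
    exact ⟨(k - i).toNat, show k - ((k - i).toNat : ℤ) = i by omega⟩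
  calc ∑' i : ℤ, (if (2 : ℝ≥0∞) ^ (i : ℝ) < b then (2 : ℝ≥0∞) ^ (i * s) else 0)
      ≤ ∑' l : ℕ, (2 : ℝ≥0∞) ^ ((k - (l : ℤ) : ℤ) * s) := by
        rw [← hinj.tsum_eq hsupp]
        refine ENNReal.tsum_le_tsum fun l => ?_
        split_ifs
        exacts [le_rfl, zero_le]
    _ = geomSum s * (2 ^ (k : ℝ)) ^ s := by
        rw [geomSum, ← ENNReal.tsum_mul_right]
        refine tsum_congr fun l => ?_
        rw [← ENNReal.rpow_mul, ← two_rpow_add]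
        push_cast
        ring_nf
    _ ≤ geomSum s * b ^ s := by gcongr

lemma rpow_le_tsum_ite_two_rpow_lt {P : ℝ} (hP : 0 < P) (a : ℝ≥0∞) :
    a ^ P ≤ ∑' i : ℤ, (if (2 : ℝ≥0∞) ^ (i : ℝ) < a then (2 : ℝ≥0∞) ^ ((i + 1) * P) else 0) := by
  rcases eq_or_ne a 0 with rfl | h0
  · simp [hP]
  rcases eq_or_ne a ∞ with rfl | ht
  · calc (∞ : ℝ≥0∞) ^ P ≤ ∑' _ : ℕ, 1 := by
          rw [ENNReal.tsum_const_eq_top_of_ne_zero one_ne_zero]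
          exact le_top
      _ ≤ ∑' l : ℕ, (2 : ℝ≥0∞) ^ (((l : ℤ) + 1 : ℝ) * P) := ENNReal.tsum_le_tsum fun l =>
          ENNReal.one_le_rpow one_le_two (by push_cast; positivity)
      _ ≤ ∑' i : ℤ, (2 : ℝ≥0∞) ^ ((i + 1) * P) :=
          ENNReal.tsum_comp_le_tsum_of_injective Nat.cast_injective _
      _ = _ := by simp only [(two_rpow_ne_top _).lt_top, if_true]
  · obtain ⟨k, hka, hak⟩ := exists_two_rpow_lt_le h0 ht
    refine le_trans ?_ (ENNReal.le_tsum k)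
    rw [if_pos hka, ENNReal.rpow_mul]
    gcongr

variable {X : Type*} [MeasurableSpace X] {μ : Measure X}

lemma lintegral_rpow_le_tsum_measure_lt {P : ℝ} (hP : 0 < P) {f : X → ℝ≥0∞} (hf : Measurable f) :
    ∫⁻ x, f x ^ P ∂μ ≤
      ∑' i : ℤ, (2 : ℝ≥0∞) ^ ((i + 1) * P) * μ {x | (2 : ℝ≥0∞) ^ (i : ℝ) < f x} := by
  have hmeas : ∀ i : ℤ, MeasurableSet {x | (2 : ℝ≥0∞) ^ (i : ℝ) < f x} := fun i =>
    measurableSet_lt measurable_const hf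
  simp_rw [← setLIntegral_const, ← lintegral_indicator (hmeas _)]
  rw [← lintegral_tsum fun i => (measurable_const.indicator (hmeas i)).aemeasurable]
  refine lintegral_mono fun x => ?_
  simp only [indicator_apply, mem_ofPred_eq]
  exact rpow_le_tsum_ite_two_rpow_lt hP (f x)

lemma tsum_two_rpow_mul_setLIntegral_lt_le {s : ℝ} (hs : 0 < s) {φ b : X → ℝ≥0∞}
    (hφ : Measurable φ) (hb : Measurable b) :
    ∑' i : ℤ, (2 : ℝ≥0∞) ^ (i * s) * ∫⁻ x in {x | (2 : ℝ≥0∞) ^ (i : ℝ) < b x}, φ x ∂μ ≤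
      geomSum s * ∫⁻ x, b x ^ s * φ x ∂μ := by
  have hmeas : ∀ i : ℤ, MeasurableSet {x | (2 : ℝ≥0∞) ^ (i : ℝ) < b x} := fun i =>
    measurableSet_lt measurable_const hb
  simp_rw [← lintegral_const_mul _ hφ, ← lintegral_indicator (hmeas _)]
  rw [← lintegral_tsum fun i => ((hφ.const_mul _).indicator (hmeas i)).aemeasurable,
    ← lintegral_const_mul (geomSum s) (by fun_prop)]
  refine lintegral_mono fun x => ?_
  simp only [indicator_apply, mem_ofPred_eq, ← ite_zero_mul, ENNReal.tsum_mul_right, ← mul_assoc]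
  gcongr
  exact tsum_ite_two_rpow_lt_le hs (b x)

end DyadicLayers

section Maximal

variable {X : Type*} [MetricSpace X] [MeasurableSpace X] {n : ℝ} {K : ℝ≥0} {μ : Measure X}
  {φ : X → ℝ≥0∞}

lemma dyadicMax_le_dyadicMax_indicator_add (hK : UpperRegular n K μ) (hφ : Measurable φ)
    {t : ℝ≥0∞} (h0 : t ≠ 0) (ht : t ≠ ∞) (x : X) :
    dyadicMax n μ φ x ≤ dyadicMax n μ ({y | t < 2 * K * φ y}.indicator φ) x + t / 2 := by
  set E : Set X := {y | t < 2 * K * φ y}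
  have hE : MeasurableSet E := measurableSet_lt measurable_const (hφ.const_mul _)
  have hle : φ ≤ fun y => E.indicator φ y + t / (2 * K) := fun y => by
    by_cases hy : y ∈ E
    · simp only [indicator_of_mem hy, le_self_add]
    · simp only [indicator_of_notMem hy, zero_add]
      rw [ENNReal.le_div_iff_mul_le (.inr h0) (.inr ht), mul_comm]
      exact not_lt.1 hy
  have hconst : K * (t / (2 * K)) ≤ t / 2 := by
    rw [ENNReal.le_div_iff_mul_le (.inl two_ne_zero) (.inl ENNReal.ofNat_ne_top), mul_right_comm,
      mul_comm _ (2 : ℝ≥0∞)]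
    exact ENNReal.mul_div_le
  refine iSup_le fun j => ?_
  calc dyadicAvg n μ j φ x ≤ dyadicAvg n μ j (fun y => E.indicator φ y + t / (2 * K)) x :=
        dyadicAvg_mono hle j x
    _ = dyadicAvg n μ j (E.indicator φ) x + dyadicAvg n μ j (fun _ => t / (2 * K)) x :=
        dyadicAvg_add (hφ.indicator hE) j x
    _ ≤ dyadicMax n μ (E.indicator φ) x + t / 2 :=
        add_le_add (dyadicAvg_le_dyadicMax j _ x) ((dyadicAvg_const_le hK _ j x).trans hconst)

variable [BorelSpace X] [SecondCountableTopology X]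

lemma measure_lt_dyadicMax_le (hK : UpperRegular n K μ) (hφ : Measurable φ) {t : ℝ≥0∞}
    (h0 : t ≠ 0) (ht : t ≠ ∞) :
    μ {x | t < dyadicMax n μ φ x} ≤ 2 * (K * ENNReal.ofReal (4 ^ n)) * t⁻¹ *
      ∫⁻ x in {x | t < 2 * K * φ x}, φ x ∂μ := by
  set E : Set X := {y | t < 2 * K * φ y}
  have hE : MeasurableSet E := measurableSet_lt measurable_const (hφ.const_mul _)
  have hsub : {x | t < dyadicMax n μ φ x} ⊆ {x | t / 2 < dyadicMax n μ (E.indicator φ) x} := by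
    intro x (hx : t < dyadicMax n μ φ x)
    refine mem_ofPred_eq ▸ lt_of_not_ge fun hc => hx.not_ge ?_
    calc dyadicMax n μ φ x ≤ dyadicMax n μ (E.indicator φ) x + t / 2 :=
          dyadicMax_le_dyadicMax_indicator_add hK hφ h0 ht x
      _ ≤ t / 2 + t / 2 := by gcongr
      _ = t := ENNReal.add_halves t
  have ht2 : t / 2 ≠ 0 := by simpa using h0
  have ht2' : t / 2 ≠ ∞ := by finiteness
  calc μ {x | t < dyadicMax n μ φ x} ≤ μ {x | t / 2 < dyadicMax n μ (E.indicator φ) x} :=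
        measure_mono hsub
    _ ≤ K * ENNReal.ofReal (4 ^ n) * (∫⁻ x, E.indicator φ x ∂μ) / (t / 2) := by
        rw [ENNReal.le_div_iff_mul_le (.inl ht2) (.inl ht2'), mul_comm]
        exact mul_measure_lt_dyadicMax_le hK _
    _ = 2 * (K * ENNReal.ofReal (4 ^ n)) * t⁻¹ * ∫⁻ x in E, φ x ∂μ := by
        rw [lintegral_indicator hE, ENNReal.div_eq_inv_mul, ENNReal.inv_div (by simp) (by simp),
          ENNReal.div_eq_inv_mul]
        ring

theorem exists_lintegral_dyadicMax_rpow_le [SigmaFinite μ] (hK : UpperRegular n K μ) {P : ℝ}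
    (hP : 1 < P) :
    ∃ C : ℝ≥0∞, C ≠ ∞ ∧ ∀ φ : X → ℝ≥0∞, Measurable φ →
      ∫⁻ x, dyadicMax n μ φ x ^ P ∂μ ≤ C * ∫⁻ x, φ x ^ P ∂μ := by
  have hP1 : 0 < P - 1 := sub_pos.2 hP
  set D : ℝ≥0∞ := 2 * (K * ENNReal.ofReal (4 ^ n)) * 2 ^ P
  refine ⟨D * (geomSum (P - 1) * (2 * K) ^ (P - 1)), ?_, fun φ hφ => ?_⟩
  · have := geomSum_ne_top hP1
    finiteness
  have hpow : ∀ i : ℤ, (2 : ℝ≥0∞) ^ ((i + 1) * P) * ((2 : ℝ≥0∞) ^ (i : ℝ))⁻¹ =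
      2 ^ P * 2 ^ (i * (P - 1)) := fun i => by
    rw [← ENNReal.rpow_neg, ← two_rpow_add, ← two_rpow_add]
    ring_nf
  calc ∫⁻ x, dyadicMax n μ φ x ^ P ∂μ
      ≤ ∑' i : ℤ, (2 : ℝ≥0∞) ^ ((i + 1) * P) *
          μ {x | (2 : ℝ≥0∞) ^ (i : ℝ) < dyadicMax n μ φ x} :=
        lintegral_rpow_le_tsum_measure_lt (one_pos.trans hP) (measurable_dyadicMax hφ)
    _ ≤ ∑' i : ℤ, (2 : ℝ≥0∞) ^ ((i + 1) * P) * (2 * (K * ENNReal.ofReal (4 ^ n)) *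
          ((2 : ℝ≥0∞) ^ (i : ℝ))⁻¹ * ∫⁻ x in {x | (2 : ℝ≥0∞) ^ (i : ℝ) < 2 * K * φ x}, φ x ∂μ) := by
        gcongr with i
        exact measure_lt_dyadicMax_le hK hφ (two_rpow_ne_zero i) (two_rpow_ne_top i)
    _ = D * ∑' i : ℤ, (2 : ℝ≥0∞) ^ (i * (P - 1)) *
          ∫⁻ x in {x | (2 : ℝ≥0∞) ^ (i : ℝ) < 2 * K * φ x}, φ x ∂μ := by
        rw [← ENNReal.tsum_mul_left]
        refine tsum_congr fun i => ?_
        rw [mul_assoc (2 * _), mul_left_comm, ← mul_assoc (2 ^ _) (2 ^ _)⁻¹, hpow]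
        ring
    _ ≤ D * (geomSum (P - 1) * ∫⁻ x, (2 * K * φ x) ^ (P - 1) * φ x ∂μ) := by
        gcongr
        exact tsum_two_rpow_mul_setLIntegral_lt_le hP1 hφ (hφ.const_mul _)
    _ = D * (geomSum (P - 1) * (2 * K) ^ (P - 1)) * ∫⁻ x, φ x ^ P ∂μ := by
        simp only [ENNReal.mul_rpow_of_nonneg _ _ hP1.le, mul_assoc, rpow_sub_one_mul_self hP.le]
        simp only [← mul_assoc]
        rw [lintegral_const_mul _ (hφ.pow_const _)]
        ring

end Maximal

/-! ### The vector-valued maximal inequality -/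

section Duality

variable {X : Type*} [MeasurableSpace X] {μ : Measure X}

lemma lintegral_le_of_forall_le_of_lintegral_ne_top [SigmaFinite μ] {f : X → ℝ≥0∞} {C : ℝ≥0∞}
    (h : ∀ g : X → ℝ≥0∞, Measurable g → g ≤ f → ∫⁻ x, g x ∂μ ≠ ∞ → ∫⁻ x, g x ∂μ ≤ C) :
    ∫⁻ x, f x ∂μ ≤ C := by
  rw [lintegral_eq_nnreal]
  refine iSup₂_le fun φ hφ => ?_
  rw [← SimpleFunc.lintegral_eq_lintegral]
  refine le_of_forall_lt fun L hL => ?_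
  obtain ⟨g, hgφ, hgfin, hLg⟩ := SimpleFunc.exists_lt_lintegral_simpleFunc_of_lt_lintegral
    (f := φ) hL
  refine hLg.trans_le (h _ g.measurable.coe_nnreal_ennreal (fun x => ?_) hgfin.ne)
  exact (ENNReal.coe_le_coe.2 (hgφ x)).trans (hφ x)

lemma le_rpow_mul_of_le_rpow_mul_rpow {P : ℝ} (hP : 1 < P) {I A C : ℝ≥0∞} (hI : I ≠ ∞)
    (h : I ≤ A ^ (1 / P) * (C * I) ^ (1 - 1 / P)) : I ≤ C ^ (P - 1) * A := by
  have hP0 : 0 < P := one_pos.trans hP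
  rcases eq_or_ne I 0 with rfl | h0
  · exact zero_le
  have hpow : I ^ (P - 1) * I ≤ I ^ (P - 1) * (C ^ (P - 1) * A) := by
    calc I ^ (P - 1) * I = I ^ P := rpow_sub_one_mul_self hP.le I
      _ ≤ (A ^ (1 / P) * (C * I) ^ (1 - 1 / P)) ^ P := by gcongr
      _ = A * (C * I) ^ (P - 1) := by
        rw [ENNReal.mul_rpow_of_nonneg _ _ hP0.le, ← ENNReal.rpow_mul, ← ENNReal.rpow_mul,
          one_div_mul_cancel hP0.ne', ENNReal.rpow_one, sub_mul, one_mul,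
          one_div_mul_cancel hP0.ne']
      _ = I ^ (P - 1) * (C ^ (P - 1) * A) := by
        rw [ENNReal.mul_rpow_of_nonneg _ _ (sub_pos.2 hP).le]
        ring
  have hfin : I ^ (P - 1) ≠ ∞ := ENNReal.rpow_ne_top_of_nonneg (sub_pos.2 hP).le hI
  exact (ENNReal.mul_le_mul_iff_right (by simp [ENNReal.rpow_eq_zero_iff, h0, hI]) hfin).1 hpow

end Duality

section VectorValued

/-- The `ℓ^q` (quasi-)norm of an extended nonnegative sequence, cf. `ellNorm`. -/
def ellENorm (q : ℝ≥0∞) (a : ℤ → ℝ≥0∞) : ℝ≥0∞ :=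
  if q = ∞ then ⨆ k, a k else (∑' k, a k ^ q.toReal) ^ (1 / q.toReal)

lemma rpow_mul_rpow_neg_le (F : ℝ≥0∞) {a b : ℝ} (hb : 0 ≤ b) (hab : b < a) :
    F ^ a * F ^ (-b) ≤ F ^ (a - b) := by
  rcases eq_or_ne F 0 with rfl | h0
  · rw [ENNReal.zero_rpow_of_pos (hb.trans_lt hab), zero_mul]
    exact zero_le
  rcases eq_or_ne F ∞ with rfl | ht
  · rw [ENNReal.top_rpow_of_pos (sub_pos.2 hab)]
    exact le_top
  rw [← ENNReal.rpow_add _ _ h0 ht, sub_eq_add_neg]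

variable {X : Type*} [MetricSpace X] [MeasurableSpace X] {n : ℝ} {K : ℝ≥0} {μ : Measure X}

lemma dyadicAvg_rpow_le_mul_rpow {Q β : ℝ} (hQ : 1 < Q) {φ F : X → ℝ≥0∞} (hφ : Measurable φ)
    (hF : Measurable F) (hφF : φ ≤ F) (hfin : ∀ᵐ y ∂μ, F y ≠ ∞) (j : ℤ) (x : X) :
    dyadicAvg n μ j φ x ^ Q ≤ dyadicAvg n μ j (fun y => φ y ^ Q * F y ^ (-β)) x *
      dyadicAvg n μ j (fun y => F y ^ (β / (Q - 1))) x ^ (Q - 1) := by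
  have hQ0 : 0 < Q := one_pos.trans hQ
  have hQ1 : 0 < Q - 1 := sub_pos.2 hQ
  have hQ' : 1 - 1 / Q = (Q - 1) / Q := by field_simp
  have hfactor : φ =ᵐ[μ] fun y =>
      (φ y ^ Q * F y ^ (-β)) ^ (1 / Q) * (F y ^ (β / (Q - 1))) ^ (1 - 1 / Q) := by
    filter_upwards [hfin] with y hy
    rcases eq_or_ne (F y) 0 with h0 | h0
    · have : φ y = 0 := le_antisymm (h0 ▸ hφF y) zero_le
      simp [this, ENNReal.zero_rpow_of_pos, hQ0]
    have hexp : -β * (1 / Q) + β / (Q - 1) * (1 - 1 / Q) = 0 := by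
      rw [hQ']
      field_simp
      ring
    rw [ENNReal.mul_rpow_of_nonneg _ _ (one_div_pos.2 hQ0).le, mul_assoc, ← ENNReal.rpow_mul,
      ← ENNReal.rpow_mul, ← ENNReal.rpow_mul, ← ENNReal.rpow_add _ _ h0 hy, hexp,
      mul_one_div_cancel hQ0.ne', ENNReal.rpow_one, ENNReal.rpow_zero, mul_one]
  calc dyadicAvg n μ j φ x ^ Q
      ≤ (dyadicAvg n μ j (fun y => φ y ^ Q * F y ^ (-β)) x ^ (1 / Q) *
          dyadicAvg n μ j (fun y => F y ^ (β / (Q - 1))) x ^ (1 - 1 / Q)) ^ Q := by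
        rw [dyadicAvg_congr_ae hfactor]
        gcongr
        exact dyadicAvg_rpow_mul_rpow_le (one_div_pos.2 hQ0).le (hQ' ▸ (div_pos hQ1 hQ0).le)
          (add_sub_cancel _ _) (by fun_prop) (by fun_prop) j x
    _ = _ := by
        rw [ENNReal.mul_rpow_of_nonneg _ _ hQ0.le, ← ENNReal.rpow_mul, ← ENNReal.rpow_mul, hQ',
          one_div_mul_cancel hQ0.ne', div_mul_cancel₀ _ hQ0.ne', ENNReal.rpow_one]

lemma tsum_dyadicAvg_rpow_le {Q β : ℝ} (hQ : 1 < Q) {φ : ℤ → X → ℝ≥0∞}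
    (hφ : ∀ j, Measurable (φ j)) {F : X → ℝ≥0∞} (hF : Measurable F) (hφF : ∀ j, φ j ≤ F)
    (hfin : ∀ᵐ y ∂μ, F y ≠ ∞) (x : X) :
    ∑' j, dyadicAvg n μ j (φ j) x ^ Q ≤
      (∑' j, dyadicAvg n μ j (fun y => φ j y ^ Q * F y ^ (-β)) x) *
        dyadicMax n μ (fun y => F y ^ (β / (Q - 1))) x ^ (Q - 1) := by
  rw [← ENNReal.tsum_mul_right]
  refine ENNReal.tsum_le_tsum fun j => ?_
  refine (dyadicAvg_rpow_le_mul_rpow (β := β) hQ (hφ j) hF (hφF j) hfin j x).trans ?_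
  gcongr
  exact dyadicAvg_le_dyadicMax j _ x

variable [BorelSpace X] [SecondCountableTopology X] [SigmaFinite μ]

lemma lintegral_tsum_dyadicAvg_le (hK : UpperRegular n K μ) {φ : ℤ → X → ℝ≥0∞}
    (hφ : ∀ j, Measurable (φ j)) :
    ∫⁻ x, ∑' j, dyadicAvg n μ j (φ j) x ∂μ ≤ K * ∫⁻ x, ∑' j, φ j x ∂μ := by
  rw [lintegral_tsum fun j => (measurable_dyadicAvg (hφ j) j).aemeasurable,
    lintegral_tsum fun j => (hφ j).aemeasurable, ← ENNReal.tsum_mul_left]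
  exact ENNReal.tsum_le_tsum fun j => lintegral_dyadicAvg_le hK (hφ j) j

lemma lintegral_tsum_dyadicAvg_mul_le {φ : ℤ → X → ℝ≥0∞} (hφ : ∀ j, Measurable (φ j))
    {ψ : X → ℝ≥0∞} (hψ : Measurable ψ) :
    ∫⁻ x, (∑' j, dyadicAvg n μ j (φ j) x) * ψ x ∂μ ≤
      ∫⁻ x, (∑' j, φ j x) * dyadicMax n μ ψ x ∂μ := by
  have hAvg : ∀ j, Measurable (dyadicAvg n μ j (φ j)) := fun j => measurable_dyadicAvg (hφ j) j
  have hMax : Measurable (dyadicMax n μ ψ) := measurable_dyadicMax hψ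
  simp_rw [← ENNReal.tsum_mul_right]
  rw [lintegral_tsum fun j => by fun_prop, lintegral_tsum fun j => by fun_prop]
  refine ENNReal.tsum_le_tsum fun j => ?_
  rw [lintegral_dyadicAvg_mul (hφ j) hψ]
  gcongr with x
  exact dyadicAvg_le_dyadicMax j ψ x

theorem exists_lintegral_tsum_dyadicAvg_rpow_le (hK : UpperRegular n K μ) {P : ℝ} (hP : 1 < P) :
    ∃ C : ℝ≥0∞, C ≠ ∞ ∧ ∀ φ : ℤ → X → ℝ≥0∞, (∀ j, Measurable (φ j)) →
      ∫⁻ x, (∑' j, dyadicAvg n μ j (φ j) x) ^ P ∂μ ≤ C * ∫⁻ x, (∑' j, φ j x) ^ P ∂μ := by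
  have hP0 : 0 < P := one_pos.trans hP
  have hconj : P.HolderConjugate P.conjExponent := .conjExponent hP
  obtain ⟨C, hC, hmax⟩ := exists_lintegral_dyadicMax_rpow_le (μ := μ) hK hconj.symm.lt
  refine ⟨C ^ (P - 1), ENNReal.rpow_ne_top_of_nonneg (sub_pos.2 hP).le hC, fun φ hφ => ?_⟩
  -- `g` below `S ^ P` factors as `g ^ (1 / P) * ψ ≤ S * ψ`, where `ψ ^ P' = g` for the conjugate
  -- exponent `P'`, so that `∫ g` is bounded by duality.
  refine lintegral_le_of_forall_le_of_lintegral_ne_top fun g hg hgS hgfin => ?_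
  refine le_rpow_mul_of_le_rpow_mul_rpow hP hgfin ?_
  have hexp : 1 - 1 / P = 1 / P.conjExponent := by simpa using hconj.one_sub_inv
  set ψ : X → ℝ≥0∞ := fun x => g x ^ (1 / P.conjExponent)
  have hψ : Measurable ψ := hg.pow_const _
  have hψg : ∀ x, ψ x ^ P.conjExponent = g x := fun x => by
    rw [← ENNReal.rpow_mul, one_div_mul_cancel hconj.symm.ne_zero, ENNReal.rpow_one]
  have hg_le : ∀ x, g x ≤ (∑' j, dyadicAvg n μ j (φ j) x) * ψ x := fun x => by
    calc g x = g x ^ (1 / P) * ψ x := by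
          rw [← ENNReal.rpow_add_of_nonneg _ _ (by positivity)
            hconj.symm.one_div_nonneg, ← hexp, add_sub_cancel, ENNReal.rpow_one]
      _ ≤ _ := by
          gcongr
          rw [one_div, ENNReal.rpow_inv_le_iff hP0]
          exact hgS x
  calc ∫⁻ x, g x ∂μ ≤ ∫⁻ x, (∑' j, dyadicAvg n μ j (φ j) x) * ψ x ∂μ := lintegral_mono hg_le
    _ ≤ ∫⁻ x, (∑' j, φ j x) * dyadicMax n μ ψ x ∂μ := lintegral_tsum_dyadicAvg_mul_le hφ hψ
    _ ≤ (∫⁻ x, (∑' j, φ j x) ^ P ∂μ) ^ (1 / P) *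
          (∫⁻ x, dyadicMax n μ ψ x ^ P.conjExponent ∂μ) ^ (1 / P.conjExponent) :=
        ENNReal.lintegral_mul_le_Lp_mul_Lq μ hconj (Measurable.tsum hφ).aemeasurable
          (measurable_dyadicMax hψ).aemeasurable
    _ ≤ (∫⁻ x, (∑' j, φ j x) ^ P ∂μ) ^ (1 / P) * (C * ∫⁻ x, g x ∂μ) ^ (1 - 1 / P) := by
        rw [hexp]
        gcongr
        · exact hconj.symm.one_div_nonneg
        · simpa only [hψg] using hmax ψ hψ

lemma lintegral_tsum_dyadicAvg_mul_rpow_neg_le (hK : UpperRegular n K μ) {P Q : ℝ} (hP : 0 < P)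
    (hPQ : P < Q) {φ : ℤ → X → ℝ≥0∞} (hφ : ∀ j, Measurable (φ j)) {F : X → ℝ≥0∞}
    (hF : Measurable F) (hφF : ∀ x, ∑' j, φ j x ^ Q = F x ^ Q) :
    ∫⁻ x, ∑' j, dyadicAvg n μ j (fun y => φ j y ^ Q * F y ^ (-(Q - P))) x ∂μ ≤
      K * ∫⁻ x, F x ^ P ∂μ := by
  refine (lintegral_tsum_dyadicAvg_le hK fun j => by fun_prop).trans ?_
  gcongr with x
  rw [ENNReal.tsum_mul_right, hφF]
  simpa only [sub_sub_cancel] using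
    rpow_mul_rpow_neg_le (F x) (sub_pos.2 hPQ).le (sub_lt_self Q hP)

lemma lintegral_tsum_dyadicAvg_rpow_rpow_le (hK : UpperRegular n K μ) {P Q : ℝ} (hP : 0 < P)
    (hQ : 1 < Q) (hPQ : P < Q) {φ : ℤ → X → ℝ≥0∞} (hφ : ∀ j, Measurable (φ j)) {F : X → ℝ≥0∞}
    (hF : Measurable F) (hFQ : ∀ x, ∑' j, φ j x ^ Q = F x ^ Q) (hfin : ∀ᵐ x ∂μ, F x ≠ ∞) :
    ∫⁻ x, (∑' j, dyadicAvg n μ j (φ j) x ^ Q) ^ (P / Q) ∂μ ≤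
      (K * ∫⁻ x, F x ^ P ∂μ) ^ (P / Q) *
        (∫⁻ x, dyadicMax n μ (fun y => F y ^ ((Q - P) / (Q - 1))) x ^
          ((Q - 1) * P / (Q - P)) ∂μ) ^ (1 - P / Q) := by
  have hQ0 : 0 < Q := hP.trans hPQ
  have hQP : 0 < Q - P := sub_pos.2 hPQ
  have ha : 0 ≤ P / Q := by positivity
  have hb : 0 ≤ 1 - P / Q := sub_nonneg.2 (div_le_one_of_le₀ hPQ.le hQ0.le)
  have hφF : ∀ j, φ j ≤ F := fun j x => by
    rw [← ENNReal.rpow_le_rpow_iff hQ0, ← hFQ]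
    exact ENNReal.le_tsum (f := fun j => φ j x ^ Q) j
  set U : X → ℝ≥0∞ := fun x => ∑' j, dyadicAvg n μ j (fun y => φ j y ^ Q * F y ^ (-(Q - P))) x
  set V : X → ℝ≥0∞ := dyadicMax n μ fun x => F x ^ ((Q - P) / (Q - 1))
  have hU : Measurable U := Measurable.tsum fun j => measurable_dyadicAvg (by fun_prop) j
  have hV : Measurable V := measurable_dyadicMax (by fun_prop)
  have hpow : ∀ x, (V x ^ (Q - 1)) ^ (P / Q) = (V x ^ ((Q - 1) * P / (Q - P))) ^ (1 - P / Q) :=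
    fun x => by
      rw [← ENNReal.rpow_mul, ← ENNReal.rpow_mul]
      congr 1
      field_simp
  calc ∫⁻ x, (∑' j, dyadicAvg n μ j (φ j) x ^ Q) ^ (P / Q) ∂μ
      ≤ ∫⁻ x, U x ^ (P / Q) * (V x ^ ((Q - 1) * P / (Q - P))) ^ (1 - P / Q) ∂μ := by
        gcongr with x
        rw [← hpow, ← ENNReal.mul_rpow_of_nonneg _ _ ha]
        gcongr
        exact tsum_dyadicAvg_rpow_le hQ hφ hF hφF hfin x
    _ ≤ (∫⁻ x, U x ∂μ) ^ (P / Q) * (∫⁻ x, V x ^ ((Q - 1) * P / (Q - P)) ∂μ) ^ (1 - P / Q) :=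
        ENNReal.lintegral_mul_norm_pow_le hU.aemeasurable (hV.pow_const _).aemeasurable
          ha hb (add_sub_cancel _ _)
    _ ≤ _ := by
        gcongr
        exact lintegral_tsum_dyadicAvg_mul_rpow_neg_le hK hP hPQ hφ hF hFQ

theorem exists_lintegral_tsum_dyadicAvg_rpow_rpow_le (hK : UpperRegular n K μ) {P Q : ℝ}
    (hP : 1 < P) (hPQ : P < Q) :
    ∃ C : ℝ≥0∞, C ≠ ∞ ∧ ∀ φ : ℤ → X → ℝ≥0∞, (∀ j, Measurable (φ j)) →
      ∫⁻ x, (∑' j, dyadicAvg n μ j (φ j) x ^ Q) ^ (P / Q) ∂μ ≤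
        C * ∫⁻ x, (∑' j, φ j x ^ Q) ^ (P / Q) ∂μ := by
  have hP0 : 0 < P := one_pos.trans hP
  have hQ0 : 0 < Q := hP0.trans hPQ
  have hQ1 : 0 < Q - 1 := sub_pos.2 (hP.trans hPQ)
  have hQP : 0 < Q - P := sub_pos.2 hPQ
  have hR : 1 < (Q - 1) * P / (Q - P) := by rw [lt_div_iff₀ hQP]; nlinarith
  obtain ⟨C, hC, hmax⟩ := exists_lintegral_dyadicMax_rpow_le (μ := μ) hK hR
  have ha : 0 ≤ P / Q := by positivity
  have hb : 0 ≤ 1 - P / Q := sub_nonneg.2 (div_le_one_of_le₀ hPQ.le hQ0.le)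
  refine ⟨K ^ (P / Q) * C ^ (1 - P / Q) + 1, by finiteness, fun φ hφ => ?_⟩
  set F : X → ℝ≥0∞ := fun x => (∑' j, φ j x ^ Q) ^ (1 / Q)
  have hF : Measurable F := (Measurable.tsum fun j => (hφ j).pow_const _).pow_const _
  have hFP : ∀ x, (∑' j, φ j x ^ Q) ^ (P / Q) = F x ^ P := fun x => by
    rw [← ENNReal.rpow_mul, one_div_mul_eq_div]
  have hFQ : ∀ x, ∑' j, φ j x ^ Q = F x ^ Q := fun x => by
    rw [← ENNReal.rpow_mul, one_div_mul_cancel hQ0.ne', ENNReal.rpow_one]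
  simp only [hFP]
  rcases eq_or_ne (∫⁻ x, F x ^ P ∂μ) ∞ with hI | hI
  · simp [hI]
  have hfin : ∀ᵐ x ∂μ, F x ≠ ∞ := by
    filter_upwards [ae_lt_top (hF.pow_const P) hI] with x hx h
    simp [h, ENNReal.top_rpow_of_pos hP0] at hx
  have hexp : (Q - P) / (Q - 1) * ((Q - 1) * P / (Q - P)) = P := by field_simp
  refine (lintegral_tsum_dyadicAvg_rpow_rpow_le hK hP0 (hP.trans hPQ) hPQ hφ hF hFQ hfin).trans ?_
  calc _ ≤ (K * ∫⁻ x, F x ^ P ∂μ) ^ (P / Q) * (C * ∫⁻ x, F x ^ P ∂μ) ^ (1 - P / Q) := by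
        gcongr
        simpa only [← ENNReal.rpow_mul, hexp] using
          hmax (fun x => F x ^ ((Q - P) / (Q - 1))) (by fun_prop)
    _ = K ^ (P / Q) * C ^ (1 - P / Q) * ∫⁻ x, F x ^ P ∂μ := by
        rw [ENNReal.mul_rpow_of_nonneg _ _ ha, ENNReal.mul_rpow_of_nonneg _ _ hb, mul_mul_mul_comm,
          ← ENNReal.rpow_add_of_nonneg _ _ ha hb, add_sub_cancel, ENNReal.rpow_one]
    _ ≤ _ := by
        gcongr
        exact le_self_add

lemma exists_lintegral_iSup_dyadicAvg_le (hK : UpperRegular n K μ) {p : ℝ} (hp : 0 < p) :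
    ∃ σ : ℝ, 0 < σ ∧ ∃ C : ℝ≥0∞, C ≠ ∞ ∧ ∀ φ : ℤ → X → ℝ≥0∞, (∀ j, Measurable (φ j)) →
      ∫⁻ x, (⨆ j, dyadicAvg n μ j (fun y => φ j y ^ σ) x ^ (1 / σ)) ^ p ∂μ ≤
        C * ∫⁻ x, (⨆ j, φ j x) ^ p ∂μ := by
  obtain ⟨C, hC, hmax⟩ := exists_lintegral_dyadicMax_rpow_le (μ := μ) hK one_lt_two
  refine ⟨p / 2, half_pos hp, C, hC, fun φ hφ => ?_⟩
  set M : X → ℝ≥0∞ := dyadicMax n μ fun y => (⨆ j, φ j y) ^ (p / 2)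
  have hle : ∀ j x, dyadicAvg n μ j (fun y => φ j y ^ (p / 2)) x ≤ M x := fun j x =>
    (dyadicAvg_mono (fun y => ENNReal.rpow_le_rpow (le_iSup (fun j => φ j y) j) (half_pos hp).le)
      j x).trans (dyadicAvg_le_dyadicMax j _ x)
  calc ∫⁻ x, (⨆ j, dyadicAvg n μ j (fun y => φ j y ^ (p / 2)) x ^ (1 / (p / 2))) ^ p ∂μ
      ≤ ∫⁻ x, (M x ^ (1 / (p / 2))) ^ p ∂μ := by
        gcongr with x
        exact iSup_le fun j => ENNReal.rpow_le_rpow (hle j x) (by positivity)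
    _ = ∫⁻ x, M x ^ (2 : ℝ) ∂μ := by
        have hexp : 1 / (p / 2) * p = 2 := by field_simp
        simp only [← ENNReal.rpow_mul, hexp]
    _ ≤ C * ∫⁻ x, ((⨆ j, φ j x) ^ (p / 2)) ^ (2 : ℝ) ∂μ :=
        hmax _ ((Measurable.iSup hφ).pow_const _)
    _ = C * ∫⁻ x, (⨆ j, φ j x) ^ p ∂μ := by
        simp only [← ENNReal.rpow_mul, div_mul_cancel₀ p two_ne_zero]

lemma exists_lintegral_tsum_rpow_dyadicAvg_le (hK : UpperRegular n K μ) {p Q : ℝ} (hp : 0 < p)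
    (hQ : 0 < Q) :
    ∃ σ : ℝ, 0 < σ ∧ ∃ C : ℝ≥0∞, C ≠ ∞ ∧ ∀ φ : ℤ → X → ℝ≥0∞, (∀ j, Measurable (φ j)) →
      ∫⁻ x, (∑' j, (dyadicAvg n μ j (fun y => φ j y ^ σ) x ^ (1 / σ)) ^ Q) ^ (p / Q) ∂μ ≤
        C * ∫⁻ x, (∑' j, φ j x ^ Q) ^ (p / Q) ∂μ := by
  have hcancel : ∀ a : ℝ≥0∞, (a ^ (1 / Q)) ^ Q = a := fun a => by
    rw [← ENNReal.rpow_mul, one_div_mul_cancel hQ.ne', ENNReal.rpow_one]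
  rcases lt_trichotomy p Q with hlt | heq | hlt
  · have hp2 : 0 < p / 2 := half_pos hp
    obtain ⟨C, hC, hbound⟩ := exists_lintegral_tsum_dyadicAvg_rpow_rpow_le (μ := μ) hK
      (P := 2) (Q := Q / (p / 2)) one_lt_two (by rw [lt_div_iff₀ hp2]; linarith)
    refine ⟨p / 2, hp2, C, hC, fun φ hφ => ?_⟩
    have hexp : 2 / (Q / (p / 2)) = p / Q := by field_simp
    have h := hbound (fun j y => φ j y ^ (p / 2)) fun j => (hφ j).pow_const _
    simpa only [← ENNReal.rpow_mul, hexp, one_div_mul_eq_div, mul_div_cancel₀ _ hp2.ne'] using h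
  · refine ⟨Q, hQ, K, ENNReal.coe_ne_top, fun φ hφ => ?_⟩
    simp only [hcancel, heq, div_self hQ.ne', ENNReal.rpow_one]
    exact lintegral_tsum_dyadicAvg_le hK fun j => (hφ j).pow_const _
  · obtain ⟨C, hC, hbound⟩ := exists_lintegral_tsum_dyadicAvg_rpow_le (μ := μ) hK
      ((one_lt_div hQ).2 hlt)
    refine ⟨Q, hQ, C, hC, fun φ hφ => ?_⟩
    simp only [hcancel]
    exact hbound _ fun j => (hφ j).pow_const _

theorem exists_lintegral_ellENorm_dyadicAvg_le (hK : UpperRegular n K μ) {p : ℝ} (hp : 0 < p)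
    {q : ℝ≥0∞} (hq : 0 < q) :
    ∃ σ : ℝ, 0 < σ ∧ ∃ C : ℝ≥0∞, C ≠ ∞ ∧ ∀ φ : ℤ → X → ℝ≥0∞, (∀ j, Measurable (φ j)) →
      ∫⁻ x, ellENorm q (fun j => dyadicAvg n μ j (fun y => φ j y ^ σ) x ^ (1 / σ)) ^ p ∂μ ≤
        C * ∫⁻ x, ellENorm q (fun j => φ j x) ^ p ∂μ := by
  rcases eq_or_ne q ∞ with rfl | hqt
  · simpa only [ellENorm, if_true] using exists_lintegral_iSup_dyadicAvg_le hK hp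
  · simpa only [ellENorm, if_neg hqt, ← ENNReal.rpow_mul _ (1 / q.toReal) p, one_div_mul_eq_div]
      using exists_lintegral_tsum_rpow_dyadicAvg_le hK hp (ENNReal.toReal_pos hq.ne' hqt)

end VectorValued

/-! ### Ahlfors regularity -/

section Regularity

variable {X : Type*} [MetricSpace X]

lemma ball_eq_univ (hX : ediam (univ : Set X) ≠ ∞) (x : X) {r : ℝ}
    (hr : diam (univ : Set X) < r) : ball x r = univ :=
  eq_univ_of_forall fun y => (dist_le_diam_of_mem (isBounded_iff_ediam_ne_top.2 hX)
    (mem_univ y) (mem_univ x)).trans_lt hr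

lemma two_mul_ediam_univ (hX : ediam (univ : Set X) ≠ ∞) :
    2 * ediam (univ : Set X) = ENNReal.ofReal (2 * diam (univ : Set X)) := by
  rw [ENNReal.ofReal_mul two_pos.le, ENNReal.ofReal_ofNat, diam, ENNReal.ofReal_toReal hX]

lemma exists_ball_eq_ball_of_two_mul_ediam_le [Nontrivial X] (x : X) {ρ : ℝ}
    (hρ : 2 * ediam (univ : Set X) ≤ ENNReal.ofReal ρ) :
    ∃ r : ℝ, 0 < r ∧ r ≤ ρ ∧ ENNReal.ofReal r < 2 * ediam (univ : Set X) ∧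
      ball x ρ = ball x r := by
  have hX : ediam (univ : Set X) ≠ ∞ := fun htop => by
    rw [htop, ENNReal.mul_top two_ne_zero] at hρ
    exact ENNReal.ofReal_ne_top (top_le_iff.1 hρ)
  have hD : 0 < diam (univ : Set X) :=
    diam_pos nontrivial_univ (isBounded_iff_ediam_ne_top.2 hX)
  have hDρ : 2 * diam (univ : Set X) ≤ ρ := by
    rw [two_mul_ediam_univ hX] at hρ
    exact ((ENNReal.ofReal_le_ofReal_iff').1 hρ).resolve_right (by linarith)
  refine ⟨3 / 2 * diam (univ : Set X), by positivity, by linarith, ?_, ?_⟩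
  · rw [two_mul_ediam_univ hX, ENNReal.ofReal_lt_ofReal_iff (by positivity)]
    linarith
  · rw [ball_eq_univ hX x (by linarith), ball_eq_univ hX x (by linarith)]

lemma ofReal_lt_two_mul_ediam {a b : X} {ρ : ℝ} (hρ : 0 < ρ) (hab : ρ ≤ dist a b) :
    ENNReal.ofReal ρ < 2 * ediam (univ : Set X) := by
  have hle : ENNReal.ofReal (2 * ρ) ≤ 2 * ediam (univ : Set X) := by
    rw [ENNReal.ofReal_mul two_pos.le, ENNReal.ofReal_ofNat]
    gcongr
    exact (ENNReal.ofReal_le_ofReal hab).trans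
      (edist_dist a b ▸ edist_le_ediam_of_mem (mem_univ a) (mem_univ b))
  exact ((ENNReal.ofReal_lt_ofReal_iff (by positivity)).2 (by linarith)).trans_le hle

lemma exists_comparable_balls [Nontrivial X] (x₀ : X) :
    ∃ r₀ : ℝ, 0 < r₀ ∧ ∀ (x : X) (ρ : ℝ), ENNReal.ofReal ρ < 2 * ediam (univ : Set X) →
      ∃ R R' : ℝ, ρ ≤ R ∧ r₀ ≤ R ∧ R ≤ R' ∧ R' ≤ 2 * R ∧
        ENNReal.ofReal R' < 2 * ediam (univ : Set X) ∧
        ball x R ⊆ ball x₀ R' ∧ ball x₀ R ⊆ ball x R' := by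
  rcases eq_or_ne (ediam (univ : Set X)) ∞ with htop | hfin
  · refine ⟨1, one_pos, fun x ρ _ => ?_⟩
    set R := max ρ (max 1 (dist x x₀))
    have hR1 : 1 ≤ R := (le_max_left _ _).trans (le_max_right _ _)
    have hRd : dist x x₀ ≤ R := (le_max_right _ _).trans (le_max_right _ _)
    refine ⟨R, 2 * R, le_max_left _ _, hR1, by linarith, le_rfl, ?_,
      ball_subset_ball' (by linarith), ball_subset_ball' (by rw [dist_comm]; linarith)⟩
    rw [htop, ENNReal.mul_top two_ne_zero]
    exact ENNReal.ofReal_lt_top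
  · set D := diam (univ : Set X)
    have hD : 0 < D := diam_pos nontrivial_univ (isBounded_iff_ediam_ne_top.2 hfin)
    rw [two_mul_ediam_univ hfin]
    refine ⟨3 / 2 * D, by positivity, fun x ρ hρ => ?_⟩
    rw [ENNReal.ofReal_lt_ofReal_iff (by positivity)] at hρ
    set R := max ρ (3 / 2 * D)
    have hDR : D < R := lt_max_of_lt_right (by linarith)
    refine ⟨R, R, le_max_left _ _, le_max_right _ _, le_rfl, by linarith, ?_, ?_, ?_⟩
    · rw [ENNReal.ofReal_lt_ofReal_iff (by positivity)]
      exact max_lt hρ (by linarith)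
    · rw [ball_eq_univ hfin x₀ hDR]
      exact subset_univ _
    · rw [ball_eq_univ hfin x hDR]
      exact subset_univ _

variable [MeasurableSpace X] {n : ℝ} {μ : Measure X}

/-- The density `μ(B(x, r)) / r ^ n` of `μ` at scale `r`. -/
def ballDensity (n : ℝ) (μ : Measure X) (x : X) (r : ℝ) : ℝ := μ.real (ball x r) / r ^ n

lemma ballDensity_le_of_subset (hn : 0 < n) (hμ : BallsFinitePos μ) {x y : X} {R R' : ℝ}
    (hR : 0 < R) (hRR' : R ≤ R') (hR' : R' ≤ 2 * R) (hsub : ball x R ⊆ ball y R') :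
    ballDensity n μ x R ≤ 2 ^ n * ballDensity n μ y R' := by
  have hR'0 : 0 < R' := hR.trans_le hRR'
  have hpow : R' ^ n ≤ 2 ^ n * R ^ n := by
    rw [← Real.mul_rpow two_pos.le hR.le]
    exact Real.rpow_le_rpow hR'0.le hR' hn.le
  calc ballDensity n μ x R ≤ μ.real (ball y R') / R ^ n := by
        unfold ballDensity
        gcongr
        exact (hμ y R' hR'0).2.ne
    _ ≤ 2 ^ n * ballDensity n μ y R' := by
        rw [ballDensity, ← mul_div_assoc, div_le_div_iff₀ (by positivity) (by positivity),
          mul_comm (2 ^ n), mul_assoc]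
        gcongr

lemma AhlforsRegular.exists_ballDensity_comparable (hμ : BallsFinitePos μ)
    (h : AhlforsRegular n μ) :
    ∃ C : ℝ, 0 < C ∧ ∀ (x : X) (r R : ℝ), 0 < r → r ≤ R →
      ENNReal.ofReal R < 2 * ediam (univ : Set X) →
        ballDensity n μ x r ≤ C * ballDensity n μ x R ∧
        ballDensity n μ x R ≤ C * ballDensity n μ x r := by
  obtain ⟨C₁, C₂, hC₁, -, hC₂, h⟩ := h
  refine ⟨max C₁⁻¹ C₂, by positivity, fun x r R hr hrR hR => ?_⟩
  have hR0 : 0 < R := hr.trans_le hrR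
  have hcancel : R / r * r = R := div_mul_cancel₀ R hr.ne'
  obtain ⟨hlower, hupper⟩ := h x r (R / r) hr ((ENNReal.ofReal_le_ofReal hrR).trans_lt hR)
    ((one_le_div hr).2 hrR) (by rwa [hcancel])
  have hreal : ∀ s, 0 < s → μ (ball x s) = ENNReal.ofReal (μ.real (ball x s)) := fun s hs =>
    (ENNReal.ofReal_toReal (hμ x s hs).2.ne).symm
  rw [hcancel, hreal r hr, hreal R hR0, ← ENNReal.ofReal_mul (by positivity),
    ENNReal.ofReal_le_ofReal_iff (by positivity), Real.div_rpow hR0.le hr.le] at hlower hupper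
  constructor
  · calc ballDensity n μ x r
        = C₁⁻¹ * ((C₁ * (R ^ n / r ^ n) * μ.real (ball x r)) / R ^ n) := by
          have : 0 < R ^ n := by positivity
          rw [ballDensity]
          field_simp
      _ ≤ max C₁⁻¹ C₂ * ballDensity n μ x R := by
          unfold ballDensity
          gcongr
          exact le_max_left _ _
  · calc ballDensity n μ x R ≤ C₂ * (R ^ n / r ^ n) * μ.real (ball x r) / R ^ n := by
          unfold ballDensity
          gcongr
      _ = C₂ * ballDensity n μ x r := by
          rw [ballDensity]
          field_simp
      _ ≤ max C₁⁻¹ C₂ * ballDensity n μ x r := by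
          unfold ballDensity
          gcongr
          exact le_max_right _ _

lemma AhlforsRegular.exists_ballDensity_mem_Icc [Nontrivial X] (hn : 0 < n)
    (hμ : BallsFinitePos μ) (h : AhlforsRegular n μ) :
    ∃ a b : ℝ, 0 < a ∧ ∀ (x : X) (ρ : ℝ), 0 < ρ →
      ENNReal.ofReal ρ < 2 * ediam (univ : Set X) → ballDensity n μ x ρ ∈ Icc a b := by
  obtain ⟨C, hC, hcomp⟩ := h.exists_ballDensity_comparable hμ
  obtain ⟨x₀, -⟩ := exists_pair_ne X
  obtain ⟨r₀, hr₀, hballs⟩ := exists_comparable_balls x₀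
  set θ := ballDensity n μ x₀ r₀
  have hθ : 0 < θ := div_pos (ENNReal.toReal_pos (hμ x₀ r₀ hr₀).1.ne' (hμ x₀ r₀ hr₀).2.ne)
    (by positivity)
  refine ⟨θ / (C * (2 ^ n * C)), C * (2 ^ n * (C * θ)), by positivity, fun x ρ hρ hρD => ?_⟩
  obtain ⟨R, R', hρR, hr₀R, hRR', hR'R, hR'D, hsub, hsub'⟩ := hballs x ρ hρD
  have hR : 0 < R := hρ.trans_le hρR
  have hRD : ENNReal.ofReal R < 2 * ediam (univ : Set X) :=
    (ENNReal.ofReal_le_ofReal hRR').trans_lt hR'D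
  constructor
  · rw [div_le_iff₀' (by positivity), mul_assoc, mul_assoc]
    calc θ ≤ C * ballDensity n μ x₀ R := (hcomp x₀ r₀ R hr₀ hr₀R hRD).1
      _ ≤ C * (2 ^ n * ballDensity n μ x R') := by
          gcongr
          exact ballDensity_le_of_subset hn hμ hR hRR' hR'R hsub'
      _ ≤ C * (2 ^ n * (C * ballDensity n μ x ρ)) := by
          gcongr
          exact (hcomp x ρ R' hρ (hρR.trans hRR') hR'D).2
  · calc ballDensity n μ x ρ ≤ C * ballDensity n μ x R := (hcomp x ρ R hρ hρR hRD).1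
      _ ≤ C * (2 ^ n * ballDensity n μ x₀ R') := by
          gcongr
          exact ballDensity_le_of_subset hn hμ hR hRR' hR'R hsub
      _ ≤ C * (2 ^ n * (C * θ)) := by
          gcongr
          exact (hcomp x₀ r₀ R' hr₀ (hr₀R.trans hRR') hR'D).2

/-- `n`-regularity with explicit constants: `c ρ ^ n ≤ μ(B(x, ρ)) ≤ K ρ ^ n`, the lower bound for
radii `ρ` not exceeding some distance in `X`, i.e. essentially for `ρ ≤ diam X`. -/
structure BallBounds (n c : ℝ) (K : ℝ≥0) (μ : Measure X) : Prop where
  exponent_pos : 0 < n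
  const_pos : 0 < c
  upper : UpperRegular n K μ
  lower : ∀ (x a b : X) (ρ : ℝ), 0 < ρ → ρ ≤ dist a b → ENNReal.ofReal (c * ρ ^ n) ≤ μ (ball x ρ)

theorem AhlforsRegular.exists_ballBounds [Nontrivial X] (hn : 0 < n) (hμ : BallsFinitePos μ)
    (h : AhlforsRegular n μ) : ∃ (c : ℝ) (K : ℝ≥0), BallBounds n c K μ := by
  obtain ⟨a, b, ha, hab⟩ := h.exists_ballDensity_mem_Icc hn hμ
  have hreal : ∀ (x : X) (ρ : ℝ), 0 < ρ →
      μ (ball x ρ) = ENNReal.ofReal (ballDensity n μ x ρ * ρ ^ n) := fun x ρ hρ => by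
    rw [ballDensity, div_mul_cancel₀ _ (by positivity), Measure.real,
      ENNReal.ofReal_toReal (hμ x ρ hρ).2.ne]
  have hmul : ∀ ρ : ℝ, 0 < ρ →
      ENNReal.ofReal (b * ρ ^ n) = b.toNNReal * ENNReal.ofReal (ρ ^ n) := fun ρ hρ => by
    rw [ENNReal.ofReal_mul' (by positivity), ENNReal.ofReal]
  have hsmall : ∀ (x : X) (ρ : ℝ), 0 < ρ → ENNReal.ofReal ρ < 2 * ediam (univ : Set X) →
      μ (ball x ρ) ≤ b.toNNReal * ENNReal.ofReal (ρ ^ n) := fun x ρ hρ hρD => by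
    rw [hreal x ρ hρ, ← hmul ρ hρ]
    gcongr
    exact (hab x ρ hρ hρD).2
  refine ⟨a, b.toNNReal, hn, ha, fun x ρ hρ => ?_, fun x y z ρ hρ hyz => ?_⟩
  · rcases lt_or_ge (ENNReal.ofReal ρ) (2 * ediam (univ : Set X)) with hlt | hge
    · exact hsmall x ρ hρ hlt
    obtain ⟨r, hr, hrρ, hrD, hball⟩ := exists_ball_eq_ball_of_two_mul_ediam_le x hge
    rw [hball]
    refine (hsmall x r hr hrD).trans ?_
    gcongr
  · rw [hreal x ρ hρ]
    gcongr
    exact (hab x ρ hρ (ofReal_lt_two_mul_ediam hρ hyz)).1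

section Consequences

variable {c : ℝ} {K : ℝ≥0}

lemma BallBounds.ballsFinitePos [Nontrivial X] (h : BallBounds n c K μ) : BallsFinitePos μ := by
  obtain ⟨a, b, hab⟩ := exists_pair_ne X
  have hc := h.const_pos
  refine fun x r hr => ⟨?_, (h.upper x r hr).trans_lt (by finiteness)⟩
  have hr' : 0 < min r (dist a b) := lt_min hr (dist_pos.2 hab)
  calc 0 < ENNReal.ofReal (c * min r (dist a b) ^ n) := ENNReal.ofReal_pos.2 (by positivity)
    _ ≤ μ (ball x (min r (dist a b))) := h.lower x a b _ hr' (min_le_right _ _)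
    _ ≤ μ (ball x r) := measure_mono (ball_subset_ball (min_le_left _ _))

lemma BallsFinitePos.isLocallyFiniteMeasure (hμ : BallsFinitePos μ) : IsLocallyFiniteMeasure μ :=
  ⟨fun x => ⟨ball x 1, ball_mem_nhds x one_pos, (hμ x 1 one_pos).2⟩⟩

lemma countable_of_pairwiseDisjoint_ball [OpensMeasurableSpace X] (hμ : BallsFinitePos μ)
    {u : Set X} {r : ℝ} (hr : 0 < r) (hu : u.PairwiseDisjoint fun x => ball x r) :
    u.Countable := by
  rcases u.eq_empty_or_nonempty with rfl | ⟨x₀, -⟩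
  · exact countable_empty
  have hcover : u = ⋃ N : ℕ, u ∩ ball x₀ N := by
    rw [← inter_iUnion, iUnion_ball_nat, inter_univ]
  rw [hcover]
  refine countable_iUnion fun N => ?_
  have hfin : IsFiniteMeasure (μ.restrict (ball x₀ (N + r))) :=
    isFiniteMeasure_restrict.2 (hμ x₀ _ (by positivity)).2.ne
  refine ((Measure.countable_meas_pos_of_disjoint_iUnion (μ := μ.restrict (ball x₀ (N + r)))
    (As := fun x : u => ball (x : X) r) (fun _ => measurableSet_ball)
    (hu.subtype _ _)).image Subtype.val).mono ?_
  rintro x ⟨hxu, hxN⟩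
  refine ⟨⟨x, hxu⟩, ?_, rfl⟩
  have hsub : ball x r ⊆ ball x₀ (N + r) := ball_subset_ball' (by linarith [mem_ball.1 hxN])
  rw [mem_ofPred_eq, Measure.restrict_apply measurableSet_ball, inter_eq_left.2 hsub]
  exact (hμ x r hr).1

lemma BallsFinitePos.secondCountableTopology [OpensMeasurableSpace X] (hμ : BallsFinitePos μ) :
    SecondCountableTopology X := by
  refine secondCountable_of_almost_dense_set fun ε hε => ?_
  obtain ⟨u, -, hdisj, hcover⟩ := Vitali.exists_disjoint_subfamily_covering_enlargement_ball
    (univ : Set X) id (fun _ => ε / 4) (ε / 4) (fun _ _ => le_rfl) 4 (by norm_num)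
  refine ⟨u, countable_of_pairwiseDisjoint_ball hμ (by positivity) hdisj, fun x => ?_⟩
  obtain ⟨y, hy, hsub⟩ := hcover x (mem_univ x)
  have hxy : dist x y < 4 * (ε / 4) := hsub (mem_ball_self (by positivity))
  exact ⟨y, hy, by linarith⟩

lemma BallBounds.measure_ball_mul_le (h : BallBounds n c K μ) {t : ℝ} (ht : 0 < t) {x y a b : X}
    {ρ : ℝ} (hρ : 0 < ρ) (hab : ρ ≤ dist a b) :
    μ (ball x (t * ρ)) ≤ K * ENNReal.ofReal (t ^ n / c) * μ (ball y ρ) := by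
  have hc := h.const_pos
  calc μ (ball x (t * ρ)) ≤ K * ENNReal.ofReal ((t * ρ) ^ n) := h.upper x _ (by positivity)
    _ = K * ENNReal.ofReal (t ^ n / c) * ENNReal.ofReal (c * ρ ^ n) := by
        rw [mul_assoc, ← ENNReal.ofReal_mul (by positivity), Real.mul_rpow ht.le hρ.le,
          ← mul_assoc, div_mul_cancel₀ _ hc.ne']
    _ ≤ K * ENNReal.ofReal (t ^ n / c) * μ (ball y ρ) := by
        gcongr
        exact h.lower y a b ρ hρ hab

lemma BallBounds.isUnifLocDoublingMeasure [Nontrivial X] (h : BallBounds n c K μ) :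
    IsUnifLocDoublingMeasure μ := by
  obtain ⟨a, b, hab⟩ := exists_pair_ne X
  refine ⟨⟨K * (3 ^ n / c).toNNReal, ?_⟩⟩
  filter_upwards [Ioc_mem_nhdsGT (dist_pos.2 hab)] with ρ hρ x
  calc μ (closedBall x (2 * ρ)) ≤ μ (ball x (3 * ρ)) :=
        measure_mono (closedBall_subset_ball (by linarith [hρ.1]))
    _ ≤ K * ENNReal.ofReal (3 ^ n / c) * μ (ball x ρ) :=
        h.measure_ball_mul_le three_pos hρ.1 hρ.2
    _ ≤ (K * (3 ^ n / c).toNNReal : ℝ≥0) * μ (closedBall x ρ) := by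
        rw [ENNReal.coe_mul, ENNReal.ofReal]
        gcongr
        exact ball_subset_closedBall

lemma BallBounds.exists_measure_ball_mul_le (h : BallBounds n c K μ) {ε : ℝ≥0∞} (hε : 0 < ε) :
    ∃ δ : ℝ, 0 < δ ∧ δ < 1 ∧ ∀ (x a b : X) (ρ : ℝ), 0 < ρ → ρ ≤ dist a b →
      μ (ball x (δ * ρ)) ≤ ε * μ (ball x ρ) := by
  have hpow : Tendsto (fun δ : ℝ => δ ^ n / c) (𝓝[>] 0) (𝓝 0) := by
    have := ((Real.continuousAt_rpow_const 0 n (Or.inr h.exponent_pos.le)).tendsto.mono_left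
      (nhdsWithin_le_nhds (s := Ioi 0))).div_const c
    rwa [Real.zero_rpow h.exponent_pos.ne', zero_div] at this
  have hlim : Tendsto (fun δ : ℝ => K * ENNReal.ofReal (δ ^ n / c)) (𝓝[>] 0) (𝓝 0) := by
    have := ENNReal.Tendsto.const_mul (a := (K : ℝ≥0∞)) (ENNReal.tendsto_ofReal hpow)
      (Or.inr ENNReal.coe_ne_top)
    rwa [ENNReal.ofReal_zero, mul_zero] at this
  obtain ⟨δ, hδ, hδ1⟩ := ((hlim.eventually_lt_const hε).and
    (Ioo_mem_nhdsGT (one_pos : (0 : ℝ) < 1))).exists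
  refine ⟨δ, hδ1.1, hδ1.2, fun x a b ρ hρ hab => ?_⟩
  refine (h.measure_ball_mul_le (y := x) hδ1.1 hρ hab).trans ?_
  gcongr

end Consequences

end Regularity

/-! ### Quasisymmetric maps -/

section RatioControl

variable {X Y : Type*} [MetricSpace X] [MetricSpace Y] {f : X ≃ₜ Y} {t T : ℝ}

/-- `f` maps pairs of points at distance ratio at most `t` from a third point to pairs at distance
ratio at most `T`; ratios are written multiplicatively to allow coinciding points. -/
def RatioBound (f : X ≃ₜ Y) (t T : ℝ) : Prop :=
  ∀ x a b : X, dist x a ≤ t * dist x b → dist (f x) (f a) ≤ T * dist (f x) (f b)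

/-- The form of quasisymmetry which is visibly symmetric under `f ↦ f.symm`: bounded ratios go to
bounded ratios and small ratios go to small ratios. -/
structure RatioControl (f : X ≃ₜ Y) : Prop where
  exists_bound : ∀ t : ℝ, 0 < t → ∃ T : ℝ, 0 < T ∧ RatioBound f t T
  exists_small : ∀ T : ℝ, 0 < T → ∃ t : ℝ, 0 < t ∧ RatioBound f t T

lemma strictMono_of_homeomorph (η : ℝ≥0 ≃ₜ ℝ≥0) : StrictMono η := by
  refine (η.continuous.strictMono_of_inj η.injective).resolve_right fun hanti => ?_
  obtain ⟨y, hy⟩ := η.surjective (η 0 + 1)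
  exact (hy ▸ hanti.antitone (zero_le : 0 ≤ y)).not_gt (lt_add_one (η 0))

lemma Quasisymmetric.ratioControl (hf : Quasisymmetric f) : RatioControl f := by
  obtain ⟨η, hη⟩ := hf
  have hmono := strictMono_of_homeomorph η
  have hzero : η 0 = 0 := (hmono.orderIsoOfSurjective η η.surjective).map_bot
  have hbound : ∀ t : ℝ≥0, RatioBound f t (η t) := fun t x a b hab => by
    rcases eq_or_ne x b with rfl | hxb
    · rw [dist_self, mul_zero] at hab
      rw [dist_le_zero.1 hab, dist_self, mul_zero]
    · have hd : 0 < nndist x b := pos_iff_ne_zero.2 (nndist_eq_zero.not.2 hxb)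
      have hd' : 0 < nndist (f x) (f b) :=
        pos_iff_ne_zero.2 (nndist_eq_zero.not.2 (f.injective.ne hxb))
      have hle : nndist (f x) (f a) / nndist (f x) (f b) ≤ η t :=
        (hη a b x hxb).trans (hmono.monotone ((div_le_iff₀ hd).2 (by exact_mod_cast hab)))
      exact_mod_cast (div_le_iff₀ hd').1 hle
  refine ⟨fun t ht => ⟨η t.toNNReal, ?_, ?_⟩, fun T hT => ⟨η.symm T.toNNReal, ?_, ?_⟩⟩
  · exact NNReal.coe_pos.2 (hzero ▸ hmono (Real.toNNReal_pos.2 ht))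
  · simpa only [Real.coe_toNNReal t ht.le] using hbound t.toNNReal
  · rw [NNReal.coe_pos, ← hmono.lt_iff_lt, hzero, η.apply_symm_apply, Real.toNNReal_pos]
    exact hT
  · simpa only [η.apply_symm_apply, Real.coe_toNNReal T hT.le] using hbound (η.symm T.toNNReal)

lemma RatioBound.symm (h : RatioBound f t T) (ht : 0 < t) (hT : 0 < T) {t' : ℝ}
    (ht' : T * t' < 1) : RatioBound f.symm t' t⁻¹ := by
  intro x a b hab
  by_contra! hlt
  have hle := h (f.symm x) (f.symm b) (f.symm a) ((inv_mul_lt_iff₀ ht).1 hlt).le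
  simp only [f.apply_symm_apply] at hle
  have hxa : 0 < dist x a := dist_pos.2 fun hxa => by
    subst hxa
    exact hlt.not_ge (by rw [dist_self]; positivity)
  have hxb : 0 < dist x b := by
    by_contra! hxb
    rw [dist_le_zero] at hxb
    subst hxb
    rw [dist_self, mul_zero] at hab
    exact hxa.not_ge hab
  nlinarith [mul_le_mul_of_nonneg_left hab hT.le]

lemma RatioControl.symm (hf : RatioControl f) : RatioControl f.symm := by
  constructor
  · intro t' ht'
    obtain ⟨t, ht, h⟩ := hf.exists_small (2 * t')⁻¹ (by positivity)
    refine ⟨t⁻¹, by positivity, h.symm ht (by positivity) ?_⟩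
    rw [inv_mul_lt_iff₀ (by positivity)]
    linarith
  · intro T' hT'
    obtain ⟨T, hT, h⟩ := hf.exists_bound T'⁻¹ (by positivity)
    refine ⟨(2 * T)⁻¹, by positivity, ?_⟩
    rw [← inv_inv T']
    refine h.symm (by positivity) hT ?_
    rw [mul_inv_lt_iff₀ (by positivity)]
    linarith

lemma RatioBound.ball_subset_image_ball (h : RatioBound f t T) (ht : 0 ≤ t) (hT : 0 < T)
    {x z : X} {ρ : ℝ} (hz : dist x z ≤ t * ρ) :
    ball (f x) (dist (f x) (f z) / T) ⊆ f '' ball x ρ := by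
  intro y hy
  refine ⟨f.symm y, ?_, f.apply_symm_apply y⟩
  by_contra hρ
  rw [mem_ball, not_lt, dist_comm] at hρ
  have hle := h x z (f.symm y) (hz.trans (by gcongr))
  rw [f.apply_symm_apply] at hle
  rw [mem_ball, dist_comm, lt_div_iff₀' hT] at hy
  exact hy.not_ge hle

variable [MeasurableSpace Y] {ν : Measure Y}

lemma RatioControl.exists_ofReal_dist_rpow_le (hf : RatioControl f) {n c : ℝ} {K : ℝ≥0}
    (hν : BallBounds n c K ν) (ht : 0 < t) :
    ∃ C : ℝ≥0, ∀ (x z : X) (ρ : ℝ), dist x z ≤ t * ρ →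
      ENNReal.ofReal (dist (f x) (f z) ^ n) ≤ C * ν (f '' ball x ρ) := by
  obtain ⟨T₀, hT₀, hbound⟩ := hf.exists_bound t ht
  have hc := hν.const_pos
  set T := max T₀ 1
  have hT : 0 < T := by positivity
  refine ⟨(T ^ n / c).toNNReal, fun x z ρ hz => ?_⟩
  rcases eq_or_ne x z with rfl | hxz
  · simp [Real.zero_rpow hν.exponent_pos.ne']
  set d := dist (f x) (f z)
  have hd : 0 < d := dist_pos.2 (f.injective.ne hxz)
  have hsub : ball (f x) (d / T) ⊆ f '' ball x ρ :=
    (ball_subset_ball (by gcongr; exact le_max_left _ _)).trans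
      (hbound.ball_subset_image_ball ht.le hT₀ hz)
  calc ENNReal.ofReal (d ^ n)
      = ENNReal.ofReal (T ^ n / c) * ENNReal.ofReal (c * (d / T) ^ n) := by
        rw [← ENNReal.ofReal_mul (by positivity), Real.div_rpow hd.le hT.le]
        congr 1
        field_simp
    _ ≤ ENNReal.ofReal (T ^ n / c) * ν (f '' ball x ρ) := by
        gcongr
        exact (hν.lower (f x) (f x) (f z) (d / T) (by positivity)
          (div_le_self hd.le (le_max_right _ _))).trans (measure_mono hsub)

lemma RatioControl.exists_ofReal_dist_image_rpow_le (hf : RatioControl f) {n c : ℝ} {K : ℝ≥0}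
    (hν : BallBounds n c K ν) (ht : 0 < t) :
    ∃ C : ℝ≥0, ∀ (x z w : X) (ρ : ℝ), dist x z ≤ t * ρ → dist x w ≤ t * ρ →
      ENNReal.ofReal (dist (f z) (f w) ^ n) ≤ C * ν (f '' ball x ρ) := by
  obtain ⟨C, hC⟩ := hf.exists_ofReal_dist_rpow_le hν ht
  refine ⟨(2 ^ n : ℝ).toNNReal * C, fun x z w ρ hz hw => ?_⟩
  set m := max (dist (f x) (f z)) (dist (f x) (f w)) with hm
  have hm₀ : 0 ≤ m := dist_nonneg.trans (le_max_left _ _)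
  have hdist : dist (f z) (f w) ≤ 2 * m := by
    linarith [dist_triangle_left (f z) (f w) (f x), le_max_left (dist (f x) (f z))
      (dist (f x) (f w)), le_max_right (dist (f x) (f z)) (dist (f x) (f w))]
  have hmC : ENNReal.ofReal (m ^ n) ≤ C * ν (f '' ball x ρ) := by
    rcases max_choice (dist (f x) (f z)) (dist (f x) (f w)) with h | h <;> rw [hm, h]
    exacts [hC x z ρ hz, hC x w ρ hw]
  calc ENNReal.ofReal (dist (f z) (f w) ^ n) ≤ ENNReal.ofReal ((2 * m) ^ n) := by
        gcongr
        exact hν.exponent_pos.le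
    _ = ENNReal.ofReal (2 ^ n) * ENNReal.ofReal (m ^ n) := by
        rw [Real.mul_rpow two_pos.le hm₀, ENNReal.ofReal_mul (by positivity)]
    _ ≤ ENNReal.ofReal (2 ^ n) * (C * ν (f '' ball x ρ)) := by gcongr
    _ = ((2 ^ n : ℝ).toNNReal * C : ℝ≥0) * ν (f '' ball x ρ) := by
        rw [ENNReal.coe_mul, mul_assoc]
        rfl

lemma RatioControl.measure_image_ball_lt_top [Nontrivial X] (hf : RatioControl f)
    (hν : BallsFinitePos ν) (x : X) {ρ : ℝ} (hρ : 0 < ρ) : ν (f '' ball x ρ) < ∞ := by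
  obtain ⟨b, hb⟩ := exists_ne x
  have hxb : 0 < dist x b := dist_pos.2 hb.symm
  obtain ⟨T, hT, h⟩ := hf.exists_bound (ρ / dist x b) (by positivity)
  refine (measure_mono ?_).trans_lt (hν (f x) (T * dist (f x) (f b) + 1) (by positivity)).2
  rintro _ ⟨a, ha, rfl⟩
  have hle := h x a b (by rw [div_mul_cancel₀ _ hxb.ne', dist_comm]; exact (mem_ball.1 ha).le)
  rw [mem_ball, dist_comm]
  linarith

lemma BallsFinitePos.measure_image_ball_pos (hν : BallsFinitePos ν) (f : X ≃ₜ Y)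
    (x : X) {ρ : ℝ} (hρ : 0 < ρ) : 0 < ν (f '' ball x ρ) := by
  obtain ⟨r, hr, hsub⟩ := Metric.isOpen_iff.1 (f.isOpenMap _ isOpen_ball) (f x)
    (mem_image_of_mem f (mem_ball_self hρ))
  exact (hν (f x) r hr).1.trans_le (measure_mono hsub)

end RatioControl

/-! ### Sequence norms -/

section SequenceNorm

variable {q : ℝ≥0∞}

lemma ellENorm_mono (q : ℝ≥0∞) {a b : ℤ → ℝ≥0∞} (h : ∀ k, a k ≤ b k) :
    ellENorm q a ≤ ellENorm q b := by
  unfold ellENorm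
  split_ifs
  · exact iSup_mono h
  · gcongr with k
    exact h k

lemma ellENorm_const_mul (hq : 0 < q) (c : ℝ≥0∞) (a : ℤ → ℝ≥0∞) :
    ellENorm q (fun k => c * a k) = c * ellENorm q a := by
  unfold ellENorm
  split_ifs with hqt
  · rw [ENNReal.mul_iSup]
  · have hQ : 0 < q.toReal := ENNReal.toReal_pos hq.ne' hqt
    simp_rw [ENNReal.mul_rpow_of_nonneg _ _ hQ.le]
    rw [ENNReal.tsum_mul_left, ENNReal.mul_rpow_of_nonneg _ _ (by positivity),
      ← ENNReal.rpow_mul, mul_one_div_cancel hQ.ne', ENNReal.rpow_one]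

lemma le_ellENorm (hq : 0 < q) (a : ℤ → ℝ≥0∞) (k : ℤ) : a k ≤ ellENorm q a := by
  unfold ellENorm
  split_ifs with hqt
  · exact le_iSup a k
  · have hQ : 0 < q.toReal := ENNReal.toReal_pos hq.ne' hqt
    rw [one_div, ENNReal.le_rpow_inv_iff hQ]
    exact ENNReal.le_tsum (f := fun k => a k ^ q.toReal) k

lemma measurable_ellENorm {X : Type*} [MeasurableSpace X] (q : ℝ≥0∞) {φ : ℤ → X → ℝ≥0∞}
    (hφ : ∀ j, Measurable (φ j)) : Measurable fun x => ellENorm q fun j => φ j x := by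
  unfold ellENorm
  split_ifs
  · exact Measurable.iSup hφ
  · exact (Measurable.tsum fun j => (hφ j).pow_const _).pow_const _

lemma iSup_rpow_le_tsum {ι : Sort*} {κ : Type*} {Q : ℝ} (hQ : 0 < Q) {a : ι → ℝ≥0∞}
    {b : κ → ℝ≥0∞} (h : ∀ i, ∃ k, a i ^ Q ≤ b k) : (⨆ i, a i) ^ Q ≤ ∑' k, b k := by
  rw [show (⨆ i, a i) ^ Q = ⨆ i, a i ^ Q from (ENNReal.orderIsoRpow Q hQ).map_iSup a]
  refine iSup_le fun i => ?_
  obtain ⟨k, hk⟩ := h i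
  exact hk.trans (ENNReal.le_tsum k)

lemma tsum_two_rpow_neg_mul_le_geomSum_mul_iSup (s : ℝ) (a : ℕ → ℝ≥0∞) :
    ∑' l : ℕ, (2 : ℝ≥0∞) ^ (-(l * s)) * a l ≤
      geomSum (s / 2) * ⨆ l : ℕ, (2 : ℝ≥0∞) ^ (-(l * (s / 2))) * a l := by
  rw [geomSum, ← ENNReal.tsum_mul_right]
  refine ENNReal.tsum_le_tsum fun l => ?_
  calc (2 : ℝ≥0∞) ^ (-(l * s)) * a l
      = (2 : ℝ≥0∞) ^ (-(l * (s / 2))) * ((2 : ℝ≥0∞) ^ (-(l * (s / 2))) * a l) := by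
        rw [← mul_assoc, ← two_rpow_add]
        ring_nf
    _ ≤ (2 : ℝ≥0∞) ^ (-(l * (s / 2))) * ⨆ l : ℕ, (2 : ℝ≥0∞) ^ (-(l * (s / 2))) * a l := by
        gcongr
        exact le_iSup (fun l : ℕ => (2 : ℝ≥0∞) ^ (-(l * (s / 2))) * a l) l

lemma exists_ellENorm_iSup_two_rpow_neg_mul_le {s : ℝ} (hs : 0 < s) (hq : 0 < q) :
    ∃ C : ℝ≥0∞, C ≠ ∞ ∧ ∀ a : ℤ → ℝ≥0∞,
      ellENorm q (fun k => ⨆ l : ℕ, (2 : ℝ≥0∞) ^ (-(l * s)) * a (k + l)) ≤ C * ellENorm q a := by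
  by_cases hqt : q = ∞
  · refine ⟨1, ENNReal.one_ne_top, fun a => ?_⟩
    simp only [ellENorm, if_pos hqt, one_mul]
    refine iSup_le fun k => iSup_le fun l => ?_
    calc (2 : ℝ≥0∞) ^ (-(l * s)) * a (k + l) ≤ 1 * a (k + l) := by
          gcongr
          rw [ENNReal.rpow_neg, ENNReal.inv_le_one]
          simpa only [ENNReal.rpow_zero] using
            ENNReal.rpow_le_rpow_of_exponent_le one_le_two (by positivity : (0 : ℝ) ≤ l * s)
      _ ≤ ⨆ k, a k := (one_mul (a (k + l))).trans_le (le_iSup a (k + l))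
  · set Q := q.toReal
    have hQ : 0 < Q := ENNReal.toReal_pos hq.ne' hqt
    refine ⟨geomSum (s * Q) ^ (1 / Q), ENNReal.rpow_ne_top_of_nonneg (by positivity)
      (geomSum_ne_top (by positivity)), fun a => ?_⟩
    simp only [ellENorm, if_neg hqt]
    rw [← ENNReal.mul_rpow_of_nonneg _ _ (by positivity)]
    gcongr
    calc ∑' k : ℤ, (⨆ l : ℕ, (2 : ℝ≥0∞) ^ (-(l * s)) * a (k + l)) ^ Q
        ≤ ∑' k : ℤ, ∑' l : ℕ, (2 : ℝ≥0∞) ^ (-(l * (s * Q))) * a (k + l) ^ Q := by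
          refine ENNReal.tsum_le_tsum fun k => iSup_rpow_le_tsum hQ fun l => ⟨l, ?_⟩
          rw [ENNReal.mul_rpow_of_nonneg _ _ hQ.le, ← ENNReal.rpow_mul, neg_mul, mul_assoc]
      _ = ∑' l : ℕ, (2 : ℝ≥0∞) ^ (-(l * (s * Q))) * ∑' k : ℤ, a (k + l) ^ Q := by
          rw [ENNReal.tsum_comm]
          simp_rw [ENNReal.tsum_mul_left]
      _ = ∑' l : ℕ, (2 : ℝ≥0∞) ^ (-(l * (s * Q))) * ∑' k : ℤ, a k ^ Q := by
          congr 1 with l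
          exact congrArg _ ((Equiv.addRight (l : ℤ)).tsum_eq fun k => a k ^ Q)
      _ = geomSum (s * Q) * ∑' k : ℤ, a k ^ Q := ENNReal.tsum_mul_right

lemma exists_ellENorm_tsum_two_rpow_neg_mul_le {s : ℝ} (hs : 0 < s) (hq : 0 < q) :
    ∃ C : ℝ≥0∞, C ≠ ∞ ∧ ∀ a : ℤ → ℝ≥0∞,
      ellENorm q (fun k => ∑' l : ℕ, (2 : ℝ≥0∞) ^ (-(l * s)) * a (k + l)) ≤ C * ellENorm q a := by
  obtain ⟨C, hC, h⟩ := exists_ellENorm_iSup_two_rpow_neg_mul_le (half_pos hs) hq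
  refine ⟨geomSum (s / 2) * C, ENNReal.mul_ne_top (geomSum_ne_top (half_pos hs)) hC, fun a => ?_⟩
  calc ellENorm q (fun k => ∑' l : ℕ, (2 : ℝ≥0∞) ^ (-(l * s)) * a (k + l))
      ≤ ellENorm q fun k =>
          geomSum (s / 2) * ⨆ l : ℕ, (2 : ℝ≥0∞) ^ (-(l * (s / 2))) * a (k + l) :=
        ellENorm_mono q fun k => tsum_two_rpow_neg_mul_le_geomSum_mul_iSup s fun l => a (k + l)
    _ ≤ geomSum (s / 2) * C * ellENorm q a := by
        rw [ellENorm_const_mul hq, mul_assoc]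
        gcongr
        exact h a

lemma tsum_biSup_rpow_le {Q : ℝ} (hQ : 0 < Q) {W : ℤ → Set ℤ} {N : ℕ}
    (hW : ∀ i j j', i ∈ W j → i ∈ W j' → j' ≤ j + N) (a : ℤ → ℝ≥0∞) :
    ∑' j, (⨆ i ∈ W j, a i) ^ Q ≤ (2 * N + 1 : ℕ) * ∑' i, a i ^ Q := by
  classical
  calc ∑' j, (⨆ i ∈ W j, a i) ^ Q ≤ ∑' j, ∑' i, if i ∈ W j then a i ^ Q else 0 := by
        refine ENNReal.tsum_le_tsum fun j => ?_
        rw [iSup_subtype']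
        exact iSup_rpow_le_tsum hQ fun i => ⟨i, (if_pos i.2).ge⟩
    _ = ∑' i, ∑' j, if i ∈ W j then a i ^ Q else 0 := ENNReal.tsum_comm
    _ ≤ ∑' i, (2 * N + 1 : ℕ) * a i ^ Q := by
        refine ENNReal.tsum_le_tsum fun i => ?_
        by_cases hi : ∃ j₀, i ∈ W j₀
        · obtain ⟨j₀, hj₀⟩ := hi
          rw [tsum_eq_sum (s := Finset.Icc (j₀ - N) (j₀ + N)) fun j hj => if_neg fun hij => hj
            (Finset.mem_Icc.2 ⟨by linarith [hW i j j₀ hij hj₀], hW i j₀ j hj₀ hij⟩)]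
          calc ∑ j ∈ Finset.Icc (j₀ - N) (j₀ + N), (if i ∈ W j then a i ^ Q else 0)
              ≤ (Finset.Icc (j₀ - N) (j₀ + N)).card • a i ^ Q :=
                Finset.sum_le_card_nsmul _ _ _ fun j _ => by split_ifs <;> simp
            _ = (2 * N + 1 : ℕ) * a i ^ Q := by
                rw [nsmul_eq_mul, Int.card_Icc]
                congr 2
                omega
        · push Not at hi
          simp [hi]
    _ = (2 * N + 1 : ℕ) * ∑' i, a i ^ Q := ENNReal.tsum_mul_left

lemma ellENorm_biSup_le (hq : 0 < q) {W : ℤ → Set ℤ} {N : ℕ}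
    (hW : ∀ i j j', i ∈ W j → i ∈ W j' → j' ≤ j + N) (a : ℤ → ℝ≥0∞) :
    ellENorm q (fun j => ⨆ i ∈ W j, a i) ≤
      ((2 * N + 1 : ℕ) : ℝ≥0∞) ^ (1 / q.toReal) * ellENorm q a := by
  by_cases hqt : q = ∞
  · simp only [ellENorm, if_true, hqt, ENNReal.toReal_top, div_zero, ENNReal.rpow_zero, one_mul]
    exact iSup_le fun j => iSup₂_le fun i _ => le_iSup a i
  · simp only [ellENorm, if_neg hqt]
    rw [← ENNReal.mul_rpow_of_nonneg _ _ (by positivity)]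
    gcongr
    exact tsum_biSup_rpow_le (ENNReal.toReal_pos hq.ne' hqt) hW a

end SequenceNorm

/-! ### Pulling back a gradient -/

section PulledBackGradient

variable {X Y : Type*} [MetricSpace X] [MetricSpace Y] {f : X ≃ₜ Y} {κ p : ℝ} {q : ℝ≥0∞}
  {J : X → ℝ≥0∞} {G : ℤ → Y → ℝ≥0∞}

/-- The distances that are comparable to `2 ^ (-j)`, up to the factor `κ`. -/
def dyadicShell (κ : ℝ) (j : ℤ) : Set ℝ := Ioo (κ * 2 ^ (-j)) (κ⁻¹ * 2 ^ (-j))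

/-- The indices `i` such that `dist (f z) (f w)` is about `2 ^ (-i)` for some `w` whose distance
to `z` is about `2 ^ (-j)`. -/
def scaleWindow (f : X ≃ₜ Y) (κ : ℝ) (j : ℤ) (z : X) : Set ℤ :=
  {i | ∃ w, dist z w ∈ dyadicShell κ j ∧ dist (f z) (f w) ∈ dyadicShell 4⁻¹ i}

/-- The candidate, before averaging, for a gradient of `u ∘ f` when `G` is a gradient of `u` and
`J` is the density of the pulled-back measure. -/
def pullGrad (f : X ≃ₜ Y) (κ p : ℝ) (J : X → ℝ≥0∞) (G : ℤ → Y → ℝ≥0∞) (j : ℤ) (z : X) : ℝ≥0∞ :=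
  J z ^ (1 / p) * ⨆ i ∈ scaleWindow f κ j z, G i (f z)

lemma isOpen_setOf_mem_scaleWindow (f : X ≃ₜ Y) (κ : ℝ) (i j : ℤ) :
    IsOpen {z | i ∈ scaleWindow f κ j z} := by
  have hunion : {z | i ∈ scaleWindow f κ j z} = ⋃ w, (fun z => dist z w) ⁻¹' dyadicShell κ j ∩
      (fun z => dist (f z) (f w)) ⁻¹' dyadicShell 4⁻¹ i := by
    ext z
    simp only [scaleWindow, mem_ofPred_eq, mem_iUnion, mem_inter_iff, mem_preimage]
  rw [hunion]
  have hf := f.continuous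
  exact isOpen_iUnion fun w => (isOpen_Ioo.preimage (by fun_prop)).inter
    (isOpen_Ioo.preimage (by fun_prop))

lemma measurable_pullGrad [MeasurableSpace X] [BorelSpace X] [MeasurableSpace Y] [BorelSpace Y]
    (hJ : Measurable J) (hG : ∀ i, Measurable (G i)) (j : ℤ) :
    Measurable (pullGrad f κ p J G j) := by
  classical
  refine (hJ.pow_const _).mul (Measurable.iSup fun i => ?_)
  simp only [iSup_eq_if]
  exact ((hG i).comp f.continuous.measurable).ite
    (isOpen_setOf_mem_scaleWindow f κ i j).measurableSet measurable_const

lemma le_pullGrad {i j : ℤ} {z : X} (h : i ∈ scaleWindow f κ j z) :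
    J z ^ (1 / p) * G i (f z) ≤ pullGrad f κ p J G j z := by
  unfold pullGrad
  gcongr
  exact le_iSup₂ (f := fun i (_ : i ∈ scaleWindow f κ j z) => G i (f z)) i h

lemma exists_two_zpow_neg_sub_one_le_lt {d : ℝ} (hd : 0 < d) :
    ∃ k : ℤ, (2 : ℝ) ^ (-k - 1) ≤ d ∧ d < 2 ^ (-k) := by
  obtain ⟨i, hi, hi'⟩ := exists_mem_Ico_zpow hd (one_lt_two (α := ℝ))
  exact ⟨-(i + 1), by rwa [neg_neg, add_sub_cancel_right], by rwa [neg_neg]⟩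

lemma mem_scaleWindow_of_dist {i j : ℤ} {z w : X} (hi : (2 : ℝ) ^ (-i - 1) ≤ dist (f z) (f w))
    (hi' : dist (f z) (f w) < (2 : ℝ) ^ (-i)) (hj : dist z w ∈ dyadicShell κ j) :
    i ∈ scaleWindow f κ j z := by
  have hpos : (0 : ℝ) < 2 ^ (-i) := by positivity
  rw [zpow_sub_one₀ two_ne_zero] at hi
  exact ⟨w, hj, by linarith, by linarith⟩

lemma RatioControl.exists_scaleWindow_le (hf : RatioControl f) (hκ : 0 < κ) :
    ∃ N : ℕ, ∀ (z : X) (i j j' : ℤ), i ∈ scaleWindow f κ j z → i ∈ scaleWindow f κ j' z →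
      j' ≤ j + N := by
  obtain ⟨t, ht, hsmall⟩ := hf.exists_small 16⁻¹ (by norm_num)
  obtain ⟨N, hN⟩ := pow_unbounded_of_one_lt (κ⁻¹ * κ⁻¹ / t) (one_lt_two (α := ℝ))
  refine ⟨N, ?_⟩
  rintro z i j j' ⟨w, ⟨hjw, -⟩, -, hiw⟩ ⟨w', ⟨-, hjw'⟩, hiw', -⟩
  have hratio : t * dist z w < dist z w' := by
    by_contra! hle
    linarith [hsmall z w' w hle]
  have hpow : t * (κ * 2 ^ (-j)) < κ⁻¹ * 2 ^ (-j') :=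
    (mul_lt_mul_of_pos_left hjw ht).trans (hratio.trans hjw')
  have hlt : (2 : ℝ) ^ (j' - j) < 2 ^ (N : ℤ) := by
    rw [zpow_natCast]
    refine lt_trans ?_ hN
    rw [zpow_neg, zpow_neg] at hpow
    rw [lt_div_iff₀ ht, zpow_sub₀ two_ne_zero]
    field_simp at hpow ⊢
    linarith
  linarith [(zpow_lt_zpow_iff_right₀ (one_lt_two (α := ℝ))).1 hlt]

lemma RatioControl.exists_ellENorm_pullGrad_le (hf : RatioControl f) (hκ : 0 < κ) (hq : 0 < q) :
    ∃ C : ℝ≥0∞, C ≠ ∞ ∧ ∀ (p : ℝ) (J : X → ℝ≥0∞) (G : ℤ → Y → ℝ≥0∞) (z : X),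
      ellENorm q (fun j => pullGrad f κ p J G j z) ≤
        C * (J z ^ (1 / p) * ellENorm q fun i => G i (f z)) := by
  obtain ⟨N, hN⟩ := hf.exists_scaleWindow_le hκ
  refine ⟨((2 * N + 1 : ℕ) : ℝ≥0∞) ^ (1 / q.toReal), ENNReal.rpow_ne_top_of_nonneg
    (by positivity) (ENNReal.natCast_ne_top _), fun p J G z => ?_⟩
  unfold pullGrad
  rw [ellENorm_const_mul hq, mul_left_comm]
  gcongr
  exact ellENorm_biSup_le hq (hN z) fun i => G i (f z)

variable [MeasurableSpace X] [MeasurableSpace Y] {μ : Measure X} {ν : Measure Y}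

/-- One half of the change of variables formula for `f` with volume derivative `J`. -/
def ChangeOfVariablesLE (μ : Measure X) (ν : Measure Y) (f : X ≃ₜ Y) (J : X → ℝ≥0∞) : Prop :=
  ∀ G : Y → ℝ≥0∞, Measurable G → ∫⁻ z, J z * G (f z) ∂μ ≤ ∫⁻ y, G y ∂ν

lemma RatioControl.exists_lintegral_pullGrad_le (hf : RatioControl f) (hκ : 0 < κ) (hp : 0 < p)
    (hJ : ChangeOfVariablesLE μ ν f J) (hq : 0 < q) :
    ∃ C : ℝ≥0∞, C ≠ ∞ ∧ ∀ G : ℤ → Y → ℝ≥0∞, (∀ i, Measurable (G i)) →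
      ∫⁻ z, ellENorm q (fun j => pullGrad f κ p J G j z) ^ p ∂μ ≤
        C * ∫⁻ y, ellENorm q (fun i => G i y) ^ p ∂ν := by
  obtain ⟨C, hC, h⟩ := hf.exists_ellENorm_pullGrad_le hκ hq
  have hCp : C ^ p ≠ ∞ := ENNReal.rpow_ne_top_of_nonneg hp.le hC
  refine ⟨C ^ p, hCp, fun G hG => ?_⟩
  calc ∫⁻ z, ellENorm q (fun j => pullGrad f κ p J G j z) ^ p ∂μ
      ≤ ∫⁻ z, (C * (J z ^ (1 / p) * ellENorm q fun i => G i (f z))) ^ p ∂μ :=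
        lintegral_mono fun z => ENNReal.rpow_le_rpow (h p J G z) hp.le
    _ = C ^ p * ∫⁻ z, J z * ellENorm q (fun i => G i (f z)) ^ p ∂μ := by
        rw [← lintegral_const_mul' _ _ hCp]
        simp only [ENNReal.mul_rpow_of_nonneg _ _ hp.le, ← ENNReal.rpow_mul,
          one_div_mul_cancel hp.ne', ENNReal.rpow_one]
    _ ≤ C ^ p * ∫⁻ y, ellENorm q (fun i => G i y) ^ p ∂ν := by
        gcongr
        exact hJ _ ((measurable_ellENorm q hG).pow_const p)

end PulledBackGradient

/-! ### Approximate continuity and selection of points -/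

section Selection

variable {X Z : Type*} [MetricSpace X] [MeasurableSpace X] {μ : Measure X} {n c₁ : ℝ} {K : ℝ≥0}

lemma exists_mem_le_dyadicAvg {φ : X → ℝ≥0∞} (hφ : Measurable φ) {c : ℝ} (hc : 0 < c)
    {x : X} {j : ℤ} {S N : Set X} (hSB : S ⊆ ball x (2 ^ (-j))) (hSfin : μ S ≠ ∞)
    (hSμ : ENNReal.ofReal (c * (2 ^ (-j)) ^ n) ≤ μ S) (hN : μ N = 0) :
    ∃ z ∈ S, z ∉ N ∧ φ z ≤ ENNReal.ofReal c⁻¹ * dyadicAvg n μ j φ x := by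
  have hpos : 0 < ENNReal.ofReal (c * (2 ^ (-j)) ^ n) := ENNReal.ofReal_pos.2 (by positivity)
  have hsmall := measure_le_setLAverage_pos (hpos.trans_le hSμ).ne' hSfin hφ.aemeasurable
  rw [← measure_sdiff_null hN] at hsmall
  obtain ⟨z, ⟨hzS, hz⟩, hzN⟩ := nonempty_of_measure_ne_zero hsmall.ne'
  refine ⟨z, hzS, hzN, hz.trans ?_⟩
  rw [setLAverage_eq]
  calc (∫⁻ y in S, φ y ∂μ) / μ S
      ≤ (∫⁻ y in ball x (2 ^ (-j)), φ y ∂μ) / ENNReal.ofReal (c * (2 ^ (-j)) ^ n) := by gcongr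
    _ = ENNReal.ofReal c⁻¹ * dyadicAvg n μ j φ x := by
        unfold dyadicAvg
        rw [ENNReal.div_eq_inv_mul, ← ENNReal.ofReal_inv_of_pos (by positivity), mul_inv,
          ENNReal.ofReal_mul (by positivity), ← Real.rpow_neg (by positivity), mul_assoc]

lemma tendsto_two_zpow_neg_atTop : Tendsto (fun j : ℤ => (2 : ℝ) ^ (-j)) atTop (𝓝[>] 0) := by
  refine tendsto_nhdsWithin_iff.2 ⟨?_, Eventually.of_forall fun j => mem_Ioi.2 (by positivity)⟩
  refine ((tendsto_rpow_atBot_of_base_gt_one 2 one_lt_two).comp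
    (tendsto_neg_atTop_atBot.comp tendsto_intCast_atTop_atTop)).congr fun j => ?_
  simp only [Function.comp_apply, ← Int.cast_neg, Real.rpow_intCast]

lemma BallBounds.ae_eventually_measure_inter_ball_le [Nontrivial X] [BorelSpace X]
    (hμ : BallBounds n c₁ K μ) {A : Set X} (hA : MeasurableSet A) :
    ∀ᵐ x ∂μ, x ∉ A → ∀ c > 0, ∀ᶠ j : ℤ in atTop,
      μ (A ∩ ball x (2 ^ (-j))) ≤ ENNReal.ofReal (c * (2 ^ (-j)) ^ n) := by
  have := hμ.isUnifLocDoublingMeasure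
  have := hμ.ballsFinitePos.isLocallyFiniteMeasure
  have := hμ.ballsFinitePos.secondCountableTopology
  have hC : (K * ENNReal.ofReal (2 ^ n) : ℝ≥0∞) ≠ ∞ := by finiteness
  filter_upwards [VitaliFamily.ae_tendsto_measure_inter_div_of_measurableSet
    (IsUnifLocDoublingMeasure.vitaliFamily μ 1) hA] with x hx hxA c hc
  rw [indicator_of_notMem hxA] at hx
  have hlim := ENNReal.Tendsto.mul_const (hx.comp
    (IsUnifLocDoublingMeasure.tendsto_closedBall_filterAt (K := 1) μ (fun _ : ℤ => x)
      (fun j : ℤ => (2 : ℝ) ^ (-j)) tendsto_two_zpow_neg_atTop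
      (Eventually.of_forall fun j => mem_closedBall_self (by positivity)))) (Or.inr hC)
  rw [zero_mul] at hlim
  filter_upwards [hlim.eventually_lt_const (ENNReal.ofReal_pos.2 hc)] with j hj
  set r : ℝ := 2 ^ (-j)
  have hr : 0 < r := by positivity
  have hle : μ (closedBall x r) ≤ K * ENNReal.ofReal ((2 * r) ^ n) :=
    (measure_mono (closedBall_subset_ball (by linarith))).trans (hμ.upper x _ (by positivity))
  have hpos : μ (closedBall x r) ≠ 0 :=
    ((hμ.ballsFinitePos x r hr).1.trans_le (measure_mono ball_subset_closedBall)).ne'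
  calc μ (A ∩ ball x r) ≤ μ (A ∩ closedBall x r) := by gcongr; exact ball_subset_closedBall
    _ = μ (A ∩ closedBall x r) / μ (closedBall x r) * μ (closedBall x r) :=
        (ENNReal.div_mul_cancel hpos (ne_top_of_le_ne_top (by finiteness) hle)).symm
    _ ≤ μ (A ∩ closedBall x r) / μ (closedBall x r) * (K * ENNReal.ofReal ((2 * r) ^ n)) := by
        gcongr
    _ = μ (A ∩ closedBall x r) / μ (closedBall x r) * (K * ENNReal.ofReal (2 ^ n)) *
          ENNReal.ofReal (r ^ n) := by
        rw [Real.mul_rpow two_pos.le hr.le, ENNReal.ofReal_mul (by positivity)]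
        ring
    _ ≤ ENNReal.ofReal c * ENNReal.ofReal (r ^ n) := by gcongr; exact hj.le
    _ = ENNReal.ofReal (c * r ^ n) := (ENNReal.ofReal_mul hc.le).symm

variable [PseudoMetricSpace Z]

/-- Approximate continuity of `v` at `x`, tested on the balls of radius `2 ^ (-j)` and with their
measure replaced by `2 ^ (-j n)`. -/
def ApproxContinuousAt (n : ℝ) (μ : Measure X) (v : X → Z) (x : X) : Prop :=
  ∀ η > 0, ∀ c > 0, ∀ᶠ j : ℤ in atTop,
    μ ({z | η < dist (v z) (v x)} ∩ ball x (2 ^ (-j))) ≤ ENNReal.ofReal (c * (2 ^ (-j)) ^ n)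

theorem BallBounds.ae_approxContinuousAt [Nontrivial X] [BorelSpace X]
    [SecondCountableTopology Z] [MeasurableSpace Z] [OpensMeasurableSpace Z]
    (hμ : BallBounds n c₁ K μ) {v : X → Z} (hv : Measurable v) :
    ∀ᵐ x ∂μ, ApproxContinuousAt n μ v x := by
  have hbasis : ∀ᵐ x ∂μ, ∀ U ∈ TopologicalSpace.countableBasis Z, x ∉ (v ⁻¹' U)ᶜ →
      ∀ c > 0, ∀ᶠ j : ℤ in atTop,
        μ ((v ⁻¹' U)ᶜ ∩ ball x (2 ^ (-j))) ≤ ENNReal.ofReal (c * (2 ^ (-j)) ^ n) :=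
    (ae_ball_iff (TopologicalSpace.countable_countableBasis Z)).2 fun U hU =>
      hμ.ae_eventually_measure_inter_ball_le
        (hv (TopologicalSpace.isOpen_of_mem_countableBasis hU).measurableSet).compl
  filter_upwards [hbasis] with x hx η hη c hc
  obtain ⟨U, hU, hxU, hUball⟩ :=
    (TopologicalSpace.isBasis_countableBasis Z).exists_subset_of_mem_open
      (mem_ball_self hη) (isOpen_ball (x := v x) (ε := η))
  filter_upwards [hx U hU (notMem_compl_iff.2 hxU) c hc] with j hj
  refine (measure_mono ?_).trans hj
  exact inter_subset_inter_left _ fun z hz hzU => (mem_ball.1 (hUball hzU)).not_gt hz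

end Selection

/-! ### Chaining -/

lemma two_zpow_neg_add_natCast (j : ℤ) (m : ℕ) :
    (2 : ℝ) ^ (-(j + m)) = 2⁻¹ ^ m * 2 ^ (-j) := by
  rw [neg_add, zpow_add₀ two_ne_zero, zpow_neg 2 (m : ℤ), zpow_natCast, inv_pow, mul_comm]

lemma mem_dyadicShell_of_lt {m : ℕ} (hm : 2 * (2 : ℝ)⁻¹ ^ m ≤ 1) {j : ℤ} {t : ℝ}
    (h : (2⁻¹ ^ m) ^ 2 * 2 ^ (-j) < t) (h' : t < 2 * 2 ^ (-j)) :
    t ∈ dyadicShell ((2⁻¹ ^ m) ^ 2) j ∧ t ∈ dyadicShell ((2⁻¹ ^ m) ^ 2) (j + m) := by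
  have hr : (0 : ℝ) < 2 ^ (-j) := by positivity
  simp only [dyadicShell, mem_Ioo, two_zpow_neg_add_natCast]
  set e : ℝ := 2⁻¹ ^ m
  have he : 0 < e := by positivity
  have hupper : 2 * (2 : ℝ) ^ (-j) ≤ (e ^ 2)⁻¹ * (e * 2 ^ (-j)) := by
    rw [le_inv_mul_iff₀ (by positivity)]
    nlinarith [mul_pos he hr]
  have hshrink : e * (2 : ℝ) ^ (-j) ≤ 2 ^ (-j) := mul_le_of_le_one_left hr.le (by linarith)
  exact ⟨⟨h, h'.trans_le (hupper.trans (by gcongr))⟩,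
    h.trans_le' (by gcongr), h'.trans_le hupper⟩

lemma dist_mem_dyadicShell_of_mem_ball {X : Type*} [PseudoMetricSpace X] {m : ℕ}
    (hm : 8 * (2 : ℝ)⁻¹ ^ m ≤ 1) {x y z w : X} {k : ℤ} (hxy : (2 : ℝ) ^ (-k - 1) ≤ dist x y)
    (hxy' : dist x y < 2 ^ (-k)) (hz : z ∈ ball x (2 ^ (-(k + m))))
    (hw : w ∈ ball y (2 ^ (-(k + m)))) : dist z w ∈ dyadicShell ((2⁻¹ ^ m) ^ 2) (k + m) := by
  have hr : (0 : ℝ) < 2 ^ (-k) := by positivity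
  have he : (0 : ℝ) < 2⁻¹ ^ m := by positivity
  rw [mem_ball, two_zpow_neg_add_natCast] at hz hw
  rw [zpow_sub_one₀ two_ne_zero] at hxy
  have htri := dist_triangle4 x z w y
  rw [dist_comm x z] at htri
  have htri' := dist_triangle4 z x y w
  rw [dist_comm y w] at htri'
  refine (mem_dyadicShell_of_lt (by linarith) ?_ ?_).2 <;> nlinarith [mul_pos he hr]

lemma tsum_add_mul_le (a : ℤ → ℝ≥0∞) (k : ℤ) {m : ℕ} (hm : m ≠ 0) :
    ∑' l : ℕ, a (k + m + m * l) ≤ ∑' l : ℕ, a (k + l) := by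
  have hinj : Function.Injective fun l : ℕ => m + m * l := fun l l' h =>
    mul_left_cancel₀ hm (Nat.add_left_cancel h)
  calc ∑' l : ℕ, a (k + m + m * l) = ∑' l : ℕ, a (k + (m + m * l : ℕ)) := by
        push_cast
        simp only [add_assoc]
    _ ≤ ∑' l : ℕ, a (k + l) := ENNReal.tsum_comp_le_tsum_of_injective hinj fun l : ℕ => a (k + l)

lemma edist_le_two_mul_tsum {Z : Type*} [PseudoMetricSpace Z] {v : ℕ → Z} {b : ℕ → ℝ≥0∞}
    (h : ∀ l, edist (v l) (v (l + 1)) ≤ b l + b (l + 1)) (L : ℕ) :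
    edist (v 0) (v L) ≤ 2 * ∑' l, b l :=
  calc edist (v 0) (v L) ≤ ∑ l ∈ Finset.range L, edist (v l) (v (l + 1)) :=
        edist_le_range_sum_edist v L
    _ ≤ ∑ l ∈ Finset.range L, b l + ∑ l ∈ Finset.range L, b (l + 1) := by
        rw [← Finset.sum_add_distrib]
        exact Finset.sum_le_sum fun l _ => h l
    _ ≤ ∑' l, b l + ∑' l, b l := by
        gcongr
        · exact ENNReal.sum_le_tsum _
        · exact (ENNReal.sum_le_tsum (f := fun l => b (l + 1)) _).trans
            (ENNReal.tsum_comp_le_tsum_of_injective (add_left_injective 1) b)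
    _ = 2 * ∑' l, b l := (two_mul _).symm

section Chaining

variable {X Z : Type*} [MetricSpace X] [MeasurableSpace X] {μ : Measure X} {n c δ σ : ℝ}
  {T : ℤ → X → Set X} {N : Set X} {D : ℤ → X → ℝ≥0∞}

/-- The sets `T j x` occupy, up to the factor `c`, a fixed proportion of the ball
`B(x, 2 ^ (-j))`, and they avoid the smaller ball `B(x, δ 2 ^ (-j))`. -/
structure ThickAnnuli (n c δ : ℝ) (μ : Measure X) (T : ℤ → X → Set X) : Prop where
  const_pos : 0 < c
  ratio_pos : 0 < δ
  ratio_lt_one : δ < 1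
  subset_ball : ∀ (j : ℤ) (x : X), T j x ⊆ ball x (2 ^ (-j))
  le_dist : ∀ (j : ℤ) (x : X), ∀ z ∈ T j x, δ * 2 ^ (-j) ≤ dist z x
  le_measure : ∀ (j : ℤ) (x a b : X), (2 : ℝ) ^ (-j) ≤ dist a b →
    ENNReal.ofReal (c * (2 ^ (-j)) ^ n) ≤ μ (T j x)

/-- The value which `D j` does not exceed on half of `T j x`, in the sense of Chebyshev's
inequality for the power `σ`. -/
def sampleBound (n c σ : ℝ) (μ : Measure X) (D : ℤ → X → ℝ≥0∞) (j : ℤ) (x : X) : ℝ≥0∞ :=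
  (ENNReal.ofReal (c / 2)⁻¹ * dyadicAvg n μ j (fun z => D j z ^ σ) x) ^ (1 / σ)

lemma ThickAnnuli.dist_mem_dyadicShell (hT : ThickAnnuli n c δ μ T) {m : ℕ}
    (hm : 8 * (2 : ℝ)⁻¹ ^ m ≤ δ) {x z z' : X} {j : ℤ} (hz : z ∈ T j x) (hz' : z' ∈ T (j + m) x) :
    dist z z' ∈ dyadicShell ((2⁻¹ ^ m) ^ 2) j ∧
      dist z z' ∈ dyadicShell ((2⁻¹ ^ m) ^ 2) (j + m) := by
  have hr : (0 : ℝ) < 2 ^ (-j) := by positivity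
  have hzx : dist z x < 2 ^ (-j) := hT.subset_ball j x hz
  have hzx' := hT.le_dist j x z hz
  have hz'x : dist z' x < 2⁻¹ ^ m * 2 ^ (-j) :=
    two_zpow_neg_add_natCast j m ▸ hT.subset_ball _ x hz'
  have htri := dist_triangle z z' x
  have htri' := dist_triangle_right z z' x
  have hδ := hT.ratio_lt_one
  have he : (0 : ℝ) < 2⁻¹ ^ m := by positivity
  refine mem_dyadicShell_of_lt (by linarith) ?_ ?_ <;> nlinarith [mul_pos he hr]

variable [PseudoMetricSpace Z] {v : X → Z}

/-- The oscillation of `v` between points of the sets `T j x` and `T j' x'`, at a distance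
comparable to both `2 ^ (-j)` and `2 ^ (-j')`, is controlled by `D`. -/
def OscillationLE (v : X → Z) (T : ℤ → X → Set X) (N : Set X) (κ : ℝ) (D : ℤ → X → ℝ≥0∞) : Prop :=
  ∀ (x x' z z' : X) (j j' : ℤ), z ∈ T j x → z' ∈ T j' x' → z ∉ N → z' ∉ N →
    dist z z' ∈ dyadicShell κ j → dist z z' ∈ dyadicShell κ j' →
      edist (v z) (v z') ≤ D j z + D j' z'

lemma ThickAnnuli.exists_subset_dist_le (hT : ThickAnnuli n c δ μ T) {x : X}
    (hx : ApproxContinuousAt n μ v x) {η : ℝ} (hη : 0 < η) :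
    ∃ J : ℤ, ∀ (j : ℤ) (a b : X), (2 : ℝ) ^ (-j) ≤ dist a b → ∃ S ⊆ T j x,
      ENNReal.ofReal (c / 2 * (2 ^ (-j)) ^ n) ≤ μ S ∧ (J ≤ j → ∀ z ∈ S, dist (v z) (v x) ≤ η) := by
  have hc := hT.const_pos
  obtain ⟨J, hJ⟩ := eventually_atTop.1 (hx η hη (c / 2) (half_pos hc))
  refine ⟨J, fun j a b hab => ?_⟩
  have hle := hT.le_measure j x a b hab
  by_cases hj : J ≤ j
  · refine ⟨T j x \ ({z | η < dist (v z) (v x)} ∩ ball x (2 ^ (-j))), sdiff_subset, ?_,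
      fun _ z hz => not_lt.1 fun h => hz.2 ⟨h, hT.subset_ball j x hz.1⟩⟩
    calc ENNReal.ofReal (c / 2 * (2 ^ (-j)) ^ n)
        = ENNReal.ofReal (c * (2 ^ (-j)) ^ n) - ENNReal.ofReal (c / 2 * (2 ^ (-j)) ^ n) := by
          rw [← ENNReal.ofReal_sub _ (by positivity)]
          ring_nf
      _ ≤ μ (T j x) - μ ({z | η < dist (v z) (v x)} ∩ ball x (2 ^ (-j))) :=
          tsub_le_tsub hle (hJ j hj)
      _ ≤ μ (T j x \ ({z | η < dist (v z) (v x)} ∩ ball x (2 ^ (-j)))) := le_measure_sdiff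
  · refine ⟨T j x, Subset.rfl, hle.trans' (ENNReal.ofReal_le_ofReal ?_), fun h => absurd h hj⟩
    gcongr
    exact half_le_self hc.le

lemma ThickAnnuli.exists_sample (hT : ThickAnnuli n c δ μ T) (hμ : BallsFinitePos μ)
    (hσ : 0 < σ) (hN : μ N = 0) (hD : ∀ j, Measurable (D j)) {x : X}
    (hx : ApproxContinuousAt n μ v x) {η : ℝ} (hη : 0 < η) :
    ∃ J : ℤ, ∀ (j : ℤ) (a b : X), (2 : ℝ) ^ (-j) ≤ dist a b → ∃ z ∈ T j x, z ∉ N ∧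
      D j z ≤ sampleBound n c σ μ D j x ∧ (J ≤ j → dist (v z) (v x) ≤ η) := by
  obtain ⟨J, hJ⟩ := hT.exists_subset_dist_le hx hη
  refine ⟨J, fun j a b hab => ?_⟩
  obtain ⟨S, hST, hSμ, hSη⟩ := hJ j a b hab
  have hSB := hST.trans (hT.subset_ball j x)
  obtain ⟨z, hzS, hzN, hz⟩ := exists_mem_le_dyadicAvg ((hD j).pow_const σ)
    (half_pos hT.const_pos) hSB ((measure_mono hSB).trans_lt (hμ x _ (by positivity)).2).ne hSμ hN
  refine ⟨z, hST hzS, hzN, ?_, fun hj => hSη hj z hzS⟩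
  rwa [sampleBound, one_div, ENNReal.le_rpow_inv_iff hσ]

lemma ThickAnnuli.exists_sample_edist_le (hT : ThickAnnuli n c δ μ T) (hμ : BallsFinitePos μ)
    (hσ : 0 < σ) (hN : μ N = 0) (hD : ∀ j, Measurable (D j)) {m : ℕ}
    (hm : 8 * (2 : ℝ)⁻¹ ^ m ≤ δ) (hm₀ : m ≠ 0) (hosc : OscillationLE v T N ((2⁻¹ ^ m) ^ 2) D)
    {x a b : X} (hx : ApproxContinuousAt n μ v x) {η : ℝ} (hη : 0 < η) {j : ℤ}
    (hab : (2 : ℝ) ^ (-j) ≤ dist a b) :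
    ∃ z ∈ T j x, z ∉ N ∧ D j z ≤ sampleBound n c σ μ D j x ∧
      edist (v x) (v z) ≤
        ENNReal.ofReal η + 2 * ∑' l : ℕ, sampleBound n c σ μ D (j + m * l) x := by
  obtain ⟨J, hJ⟩ := hT.exists_sample hμ hσ hN hD hx hη
  have hab' (l : ℕ) : (2 : ℝ) ^ (-(j + m * l)) ≤ dist a b :=
    (zpow_le_zpow_right₀ one_le_two (neg_le_neg (le_add_of_nonneg_right (by positivity)))).trans hab
  choose z hzT hzN hzD hzη using fun l : ℕ => hJ (j + m * l) a b (hab' l)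
  have hstep (l : ℕ) : edist (v (z l)) (v (z (l + 1))) ≤ sampleBound n c σ μ D (j + m * l) x +
      sampleBound n c σ μ D (j + m * (l + 1 : ℕ)) x := by
    have hsucc : j + m * (l + 1 : ℕ) = j + m * l + m := by push_cast; ring
    obtain ⟨hd, hd'⟩ := hT.dist_mem_dyadicShell hm (hzT l) (hsucc ▸ hzT (l + 1))
    exact (hosc x x _ _ _ _ (hzT l) (hzT (l + 1)) (hzN l) (hzN (l + 1)) hd (hsucc ▸ hd')).trans
      (add_le_add (hzD l) (hzD (l + 1)))
  set L := (J - j).toNat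
  have hL : J ≤ j + m * L := by
    have hJL : J - j ≤ L := Int.self_le_toNat _
    have hmL : (L : ℤ) ≤ m * L := le_mul_of_one_le_left (by positivity) (by lia)
    lia
  refine ⟨z 0, by simpa using hzT 0, hzN 0, by simpa using hzD 0, ?_⟩
  calc edist (v x) (v (z 0)) ≤ edist (v x) (v (z L)) + edist (v (z L)) (v (z 0)) :=
        edist_triangle _ _ _
    _ ≤ ENNReal.ofReal η + 2 * ∑' l : ℕ, sampleBound n c σ μ D (j + m * l) x := by
        gcongr
        · rw [edist_comm, edist_dist]
          exact ENNReal.ofReal_le_ofReal (hzη L hL)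
        · rw [edist_comm]
          exact edist_le_two_mul_tsum hstep L

/-- Points `z` near `x` and `w` near `y` are chosen in the sets `T`; then
`|v x - v y| ≤ |v x - v z| + |v z - v w| + |v w - v y|`, and the outer terms are estimated along a
sequence of such points converging to `x` or `y`. -/
theorem ThickAnnuli.exists_edist_le (hT : ThickAnnuli n c δ μ T) (hμ : BallsFinitePos μ)
    (hσ : 0 < σ) :
    ∃ κ : ℝ, 0 < κ ∧ ∀ (v : X → Z) (D : ℤ → X → ℝ≥0∞) (N : Set X), μ N = 0 →
      (∀ j, Measurable (D j)) → OscillationLE v T N κ D → ∀ (k : ℤ) (x y : X),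
        ApproxContinuousAt n μ v x → ApproxContinuousAt n μ v y →
        (2 : ℝ) ^ (-k - 1) ≤ dist x y → dist x y < (2 : ℝ) ^ (-k) →
        edist (v x) (v y) ≤ 3 * (∑' l : ℕ, sampleBound n c σ μ D (k + l) x +
          ∑' l : ℕ, sampleBound n c σ μ D (k + l) y) := by
  have hδ := hT.ratio_pos
  obtain ⟨m, hm⟩ := exists_pow_lt_of_lt_one (show 0 < δ / 8 by positivity) (two_inv_lt_one (α := ℝ))
  replace hm : 8 * (2 : ℝ)⁻¹ ^ m ≤ δ := by linarith
  have hm₁ : 8 * (2 : ℝ)⁻¹ ^ m ≤ 1 := hm.trans hT.ratio_lt_one.le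
  have hm₀ : m ≠ 0 := by
    rintro rfl
    norm_num at hm₁
  refine ⟨(2⁻¹ ^ m) ^ 2, by positivity, fun v D N hN hD hosc k x y hx hy hxy hxy' => ?_⟩
  set S : X → ℝ≥0∞ := fun x => ∑' l : ℕ, sampleBound n c σ μ D (k + l) x
  have hab : (2 : ℝ) ^ (-(k + m)) ≤ dist x y :=
    (zpow_le_zpow_right₀ one_le_two (by lia)).trans hxy
  have hsum (x : X) : ∑' l : ℕ, sampleBound n c σ μ D (k + m + m * l) x ≤ S x :=
    tsum_add_mul_le (fun j => sampleBound n c σ μ D j x) k hm₀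
  have hsingle (x : X) : sampleBound n c σ μ D (k + m) x ≤ S x :=
    ENNReal.le_tsum (f := fun l : ℕ => sampleBound n c σ μ D (k + l) x) m
  refine ENNReal.le_of_forall_pos_le_add fun ε hε _ => ?_
  have hε₂ : (0 : ℝ) < ε / 2 := by positivity
  obtain ⟨z, hzT, hzN, hzD, hz⟩ := hT.exists_sample_edist_le hμ hσ hN hD hm hm₀ hosc hx hε₂ hab
  obtain ⟨w, hwT, hwN, hwD, hw⟩ := hT.exists_sample_edist_le hμ hσ hN hD hm hm₀ hosc hy hε₂ hab
  have hd := dist_mem_dyadicShell_of_mem_ball hm₁ hxy hxy' (hT.subset_ball _ _ hzT)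
    (hT.subset_ball _ _ hwT)
  have hzw : edist (v z) (v w) ≤ S x + S y :=
    (hosc x y z w _ _ hzT hwT hzN hwN hd hd).trans
      (add_le_add (hzD.trans (hsingle x)) (hwD.trans (hsingle y)))
  calc edist (v x) (v y) ≤ edist (v x) (v z) + edist (v z) (v w) + edist (v w) (v y) :=
        edist_triangle4 _ _ _ _
    _ ≤ (ENNReal.ofReal (ε / 2) + 2 * S x) + (S x + S y) + (ENNReal.ofReal (ε / 2) + 2 * S y) := by
        gcongr
        · exact hz.trans (by gcongr; exact hsum x)
        · rw [edist_comm]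
          exact hw.trans (by gcongr; exact hsum y)
    _ = 3 * (S x + S y) + (ENNReal.ofReal (ε / 2) + ENNReal.ofReal (ε / 2)) := by ring
    _ = 3 * (S x + S y) + ε := by
        rw [← ENNReal.ofReal_add hε₂.le hε₂.le, add_halves, ENNReal.ofReal_coe_nnreal]

end Chaining

/-! ### Good parts of balls -/

section GoodParts

variable {X Y : Type*} [MetricSpace X] [MetricSpace Y] [MeasurableSpace X] [MeasurableSpace Y]

/-- The part of the ball `B(x, ρ)` on which the density `J` is at least `c` times the mean
`ν(f(B)) / μ(B)`. -/
def goodPart (μ : Measure X) (ν : Measure Y) (f : X ≃ₜ Y) (J : X → ℝ≥0∞) (c : ℝ≥0)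
    (x : X) (ρ : ℝ) : Set X :=
  {z ∈ ball x ρ | c * ν (f '' ball x ρ) ≤ J z * μ (ball x ρ)}

/-- The only quantitative consequence of the reverse Hölder inequality that is needed: good parts
occupy a fixed proportion of every ball whose radius does not exceed some distance in `X`. -/
def HasGoodParts (μ : Measure X) (ν : Measure Y) (f : X ≃ₜ Y) (J : X → ℝ≥0∞) : Prop :=
  ∃ ε c : ℝ≥0, 0 < ε ∧ 0 < c ∧ ∀ (x a b : X) (ρ : ℝ), 0 < ρ → ρ ≤ dist a b →
    ε * μ (ball x ρ) ≤ μ (goodPart μ ν f J c x ρ)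

/-- The inequality defining fractional `s`-Hajłasz gradients, off a given set `E` and for
extended-valued `G`. -/
def GradientOff (s : ℝ) (E : Set Y) (u : Y → ℝ) (G : ℤ → Y → ℝ≥0∞) : Prop :=
  ∀ (i : ℤ) (y y' : Y), y ∉ E → y' ∉ E → (2 : ℝ) ^ (-i - 1) ≤ dist y y' →
    dist y y' < (2 : ℝ) ^ (-i) →
      edist (u y) (u y') ≤ ENNReal.ofReal (dist y y' ^ s) * (G i y + G i y')

variable {μ : Measure X} {ν : Measure Y} {f : X ≃ₜ Y} {J : X → ℝ≥0∞}
  {n₁ n₂ s₁ s₂ p κ c₁ c₂ : ℝ} {K₁ K₂ c : ℝ≥0}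

lemma measure_image_ball_le_of_mem_goodPart (hK : UpperRegular n₁ K₁ μ) (hc : 0 < c) {x z : X}
    {ρ : ℝ} (hρ : 0 < ρ) (hz : z ∈ goodPart μ ν f J c x ρ) :
    ν (f '' ball x ρ) ≤ (c⁻¹ * K₁ : ℝ≥0) * (ENNReal.ofReal (ρ ^ n₁) * J z) :=
  calc ν (f '' ball x ρ) = (c⁻¹ : ℝ≥0) * (c * ν (f '' ball x ρ)) := by
        rw [← mul_assoc, ← ENNReal.coe_mul, inv_mul_cancel₀ hc.ne', ENNReal.coe_one, one_mul]
    _ ≤ (c⁻¹ : ℝ≥0) * (J z * (K₁ * ENNReal.ofReal (ρ ^ n₁))) := by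
        refine mul_le_mul_right ?_ _
        refine hz.2.trans ?_
        gcongr
        exact hK x ρ hρ
    _ = (c⁻¹ * K₁ : ℝ≥0) * (ENNReal.ofReal (ρ ^ n₁) * J z) := by
        rw [ENNReal.coe_mul]
        ring

lemma ofReal_rpow_eq_rpow_one_div (hp : 0 < p) {a s n : ℝ} (ha : 0 ≤ a) (hsn : s * p = n) :
    ENNReal.ofReal (a ^ s) = ENNReal.ofReal (a ^ n) ^ (1 / p) := by
  rw [ENNReal.ofReal_rpow_of_nonneg (by positivity) (by positivity), ← Real.rpow_mul ha, ← hsn,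
    mul_assoc, mul_one_div_cancel hp.ne', mul_one]

lemma RatioControl.exists_ofReal_dist_rpow_le_of_mem_goodPart (hf : RatioControl f)
    (hK : UpperRegular n₁ K₁ μ) (hν : BallBounds n₂ c₂ K₂ ν) (hp : 0 < p) (hs₁ : s₁ * p = n₁)
    (hs₂ : s₂ * p = n₂) (hc : 0 < c) (hκ : 0 < κ) :
    ∃ C : ℝ≥0∞, C ≠ ∞ ∧ ∀ (J : X → ℝ≥0∞) (x z w : X) (ρ : ℝ), 0 < ρ →
      z ∈ goodPart μ ν f J c x ρ → dist z w < κ⁻¹ * ρ →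
        ENNReal.ofReal (dist (f z) (f w) ^ s₂) ≤ C * ENNReal.ofReal (ρ ^ s₁) * J z ^ (1 / p) := by
  have hκ' : 0 < κ⁻¹ := inv_pos.2 hκ
  obtain ⟨C₀, hC₀⟩ := hf.exists_ofReal_dist_image_rpow_le hν (t := 1 + κ⁻¹) (by positivity)
  set C₁ : ℝ≥0∞ := C₀ * (c⁻¹ * K₁ : ℝ≥0)
  have hC₁ : C₁ ≠ ∞ := by finiteness
  refine ⟨C₁ ^ (1 / p), ENNReal.rpow_ne_top_of_nonneg (by positivity) hC₁,
    fun J x z w ρ hρ hz hzw => ?_⟩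
  have hxz : dist x z < ρ := mem_ball'.1 hz.1
  have hbound : ENNReal.ofReal (dist (f z) (f w) ^ n₂) ≤ C₁ * (ENNReal.ofReal (ρ ^ n₁) * J z) :=
    calc ENNReal.ofReal (dist (f z) (f w) ^ n₂) ≤ C₀ * ν (f '' ball x ρ) :=
          hC₀ x z w ρ (by nlinarith) (by nlinarith [dist_triangle x z w])
      _ ≤ C₀ * ((c⁻¹ * K₁ : ℝ≥0) * (ENNReal.ofReal (ρ ^ n₁) * J z)) := by
          gcongr
          exact measure_image_ball_le_of_mem_goodPart hK hc hρ hz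
      _ = C₁ * (ENNReal.ofReal (ρ ^ n₁) * J z) := (mul_assoc _ _ _).symm
  rw [ofReal_rpow_eq_rpow_one_div hp dist_nonneg hs₂, ofReal_rpow_eq_rpow_one_div hp hρ.le hs₁,
    mul_assoc, ← ENNReal.mul_rpow_of_nonneg _ _ (by positivity),
    ← ENNReal.mul_rpow_of_nonneg _ _ (by positivity)]
  gcongr

lemma ofReal_two_zpow_rpow (j : ℤ) (s : ℝ) :
    ENNReal.ofReal (((2 : ℝ) ^ (-j)) ^ s) = 2 ^ (-(j * s)) := by
  rw [← Real.rpow_intCast, ← Real.rpow_mul two_pos.le, ← ENNReal.ofReal_rpow_of_pos two_pos,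
    ENNReal.ofReal_ofNat, Int.cast_neg, neg_mul]

lemma RatioControl.exists_oscillationLE_goodPart (hf : RatioControl f)
    (hK : UpperRegular n₁ K₁ μ) (hν : BallBounds n₂ c₂ K₂ ν) (hp : 0 < p) (hs₁ : s₁ * p = n₁)
    (hs₂ : s₂ * p = n₂) (hc : 0 < c) (hκ : 0 < κ) :
    ∃ C : ℝ≥0∞, C ≠ ∞ ∧ ∀ (J : X → ℝ≥0∞) (u : Y → ℝ) (E : Set Y) (G : ℤ → Y → ℝ≥0∞),
      GradientOff s₂ E u G →
      OscillationLE (u ∘ f) (fun j x => goodPart μ ν f J c x (2 ^ (-j))) (f ⁻¹' E) κ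
        fun j z => C * 2 ^ (-(j * s₁)) * pullGrad f κ p J G j z := by
  obtain ⟨C, hC, h⟩ := hf.exists_ofReal_dist_rpow_le_of_mem_goodPart hK hν hp hs₁ hs₂ hc hκ
  have hterm {J : X → ℝ≥0∞} {G : ℤ → Y → ℝ≥0∞} {x z w : X} {i j : ℤ}
      (hz : z ∈ goodPart μ ν f J c x (2 ^ (-j))) (hzw : dist z w ∈ dyadicShell κ j)
      (hi : i ∈ scaleWindow f κ j z) :
      ENNReal.ofReal (dist (f z) (f w) ^ s₂) * G i (f z) ≤
        C * 2 ^ (-(j * s₁)) * pullGrad f κ p J G j z :=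
    calc ENNReal.ofReal (dist (f z) (f w) ^ s₂) * G i (f z)
        ≤ C * ENNReal.ofReal ((2 ^ (-j)) ^ s₁) * J z ^ (1 / p) * G i (f z) := by
          gcongr
          exact h J x z w _ (by positivity) hz hzw.2
      _ = C * 2 ^ (-(j * s₁)) * (J z ^ (1 / p) * G i (f z)) := by
          rw [ofReal_two_zpow_rpow, mul_assoc (C * _)]
      _ ≤ C * 2 ^ (-(j * s₁)) * pullGrad f κ p J G j z := by
          gcongr
          exact le_pullGrad hi
  refine ⟨C, hC, fun J u E G hG x x' z z' j j' hz hz' hzE hzE' hj hj' => ?_⟩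
  have hd : 0 < dist (f z) (f z') :=
    dist_pos.2 (f.injective.ne (dist_pos.1 (hj.1.trans' (by positivity))))
  obtain ⟨i, hi, hi'⟩ := exists_two_zpow_neg_sub_one_le_lt hd
  have hwin := mem_scaleWindow_of_dist hi hi' hj
  have hwin' : i ∈ scaleWindow f κ j' z' := by
    rw [dist_comm] at hi hi' hj'
    exact mem_scaleWindow_of_dist hi hi' hj'
  refine (hG i _ _ hzE hzE' hi hi').trans ?_
  rw [mul_add]
  gcongr ?_ + ?_
  · exact hterm hz hj hwin
  · rw [dist_comm] at hj' ⊢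
    exact hterm hz' hj' hwin'

lemma HasGoodParts.exists_thickAnnuli [Nontrivial X] (h : HasGoodParts μ ν f J)
    (hμ : BallBounds n₁ c₁ K₁ μ) :
    ∃ (c : ℝ≥0) (δ c' : ℝ), 0 < c ∧ ThickAnnuli n₁ c' δ μ
      fun j x => goodPart μ ν f J c x (2 ^ (-j)) \ ball x (δ * 2 ^ (-j)) := by
  obtain ⟨ε, c, hε, hc, h⟩ := h
  obtain ⟨δ, hδ, hδ1, hδb⟩ := hμ.exists_measure_ball_mul_le (ε := (ε / 2 : ℝ≥0))
    (by exact_mod_cast half_pos hε)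
  have hc₁ := hμ.const_pos
  refine ⟨c, δ, (ε / 2 : ℝ≥0) * c₁, hc, by positivity, hδ, hδ1, fun j x z hz => hz.1.1,
    fun j x z hz => not_lt.1 hz.2, fun j x a b hab => ?_⟩
  set ρ : ℝ := 2 ^ (-j)
  have hρ : 0 < ρ := by positivity
  have hfin : ((ε / 2 : ℝ≥0) : ℝ≥0∞) * μ (ball x ρ) ≠ ∞ :=
    ENNReal.mul_ne_top ENNReal.coe_ne_top (hμ.ballsFinitePos x ρ hρ).2.ne
  calc ENNReal.ofReal ((ε / 2 : ℝ≥0) * c₁ * ρ ^ n₁)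
      = (ε / 2 : ℝ≥0) * ENNReal.ofReal (c₁ * ρ ^ n₁) := by
        rw [mul_assoc, ENNReal.ofReal_mul (by positivity), ENNReal.ofReal_coe_nnreal]
    _ ≤ (ε / 2 : ℝ≥0) * μ (ball x ρ) := by
        gcongr
        exact hμ.lower x a b ρ hρ hab
    _ = ε * μ (ball x ρ) - (ε / 2 : ℝ≥0) * μ (ball x ρ) := by
        refine ENNReal.eq_sub_of_add_eq hfin ?_
        rw [← add_mul, ← ENNReal.coe_add, add_halves]
    _ ≤ μ (goodPart μ ν f J c x ρ) - μ (ball x (δ * ρ)) :=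
        tsub_le_tsub (h x a b ρ hρ hab) (hδb x a b ρ hρ hab)
    _ ≤ μ (goodPart μ ν f J c x ρ \ ball x (δ * ρ)) := le_measure_sdiff

end GoodParts

/-! ### Boundedness of composition operators -/

section AveragedGradient

variable {X : Type*} [MetricSpace X] [MeasurableSpace X] {μ : Measure X} {n s σ p : ℝ} {K : ℝ≥0}
  {q : ℝ≥0∞} {H : ℤ → X → ℝ≥0∞}

/-- The gradient obtained from a candidate `H` by averaging and by summing over all finer scales,
as chaining requires. -/
def averagedGrad (n c s σ : ℝ) (μ : Measure X) (H : ℤ → X → ℝ≥0∞) (k : ℤ) (x : X) : ℝ≥0∞ :=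
  ∑' l : ℕ, 2 ^ (-(l * s)) * sampleBound n c σ μ H (k + l) x

lemma sampleBound_const_mul (c : ℝ) (hσ : 0 < σ) {b : ℤ → ℝ≥0∞} (hb : ∀ j, b j ≠ ∞) (j : ℤ)
    (x : X) :
    sampleBound n c σ μ (fun j z => b j * H j z) j x = b j * sampleBound n c σ μ H j x := by
  have hbσ : b j ^ σ ≠ ∞ := ENNReal.rpow_ne_top_of_nonneg hσ.le (hb j)
  have havg : dyadicAvg n μ j (fun z => (b j * H j z) ^ σ) x =
      b j ^ σ * dyadicAvg n μ j (fun z => H j z ^ σ) x := by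
    simp only [dyadicAvg, ENNReal.mul_rpow_of_nonneg _ _ hσ.le]
    rw [lintegral_const_mul' _ _ hbσ, mul_left_comm]
  rw [sampleBound, sampleBound, havg, mul_left_comm, ENNReal.mul_rpow_of_nonneg _ _ (by positivity),
    ← ENNReal.rpow_mul, mul_one_div_cancel hσ.ne', ENNReal.rpow_one]

lemma tsum_sampleBound_eq (c : ℝ) (hσ : 0 < σ) {C : ℝ≥0∞} (hC : C ≠ ∞) (k : ℤ) (x : X) :
    ∑' l : ℕ, sampleBound n c σ μ (fun j z => C * 2 ^ (-(j * s)) * H j z) (k + l) x =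
      C * 2 ^ (-(k * s)) * averagedGrad n c s σ μ H k x := by
  rw [averagedGrad, ← ENNReal.tsum_mul_left]
  congr 1 with l
  have hexp : -(((k + l : ℤ) : ℝ) * s) = -(k * s) + -(l * s) := by push_cast; ring
  rw [sampleBound_const_mul c hσ fun j => ENNReal.mul_ne_top hC (two_rpow_ne_top _), hexp,
    two_rpow_add]
  simp only [mul_assoc]

variable [BorelSpace X] [SecondCountableTopology X] [SigmaFinite μ]

lemma measurable_sampleBound (c : ℝ) (hH : ∀ j, Measurable (H j)) (j : ℤ) :
    Measurable (sampleBound n c σ μ H j) :=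
  ((measurable_dyadicAvg ((hH j).pow_const σ) j).const_mul _).pow_const _

lemma measurable_averagedGrad (c : ℝ) (hH : ∀ j, Measurable (H j)) (k : ℤ) :
    Measurable (averagedGrad n c s σ μ H k) :=
  Measurable.tsum fun l => (measurable_sampleBound c hH (k + l)).const_mul _

lemma exists_lintegral_ellENorm_averagedGrad_le (hK : UpperRegular n K μ) (hp : 0 < p)
    (hq : 0 < q) (hs : 0 < s) :
    ∃ σ : ℝ, 0 < σ ∧ ∀ c : ℝ, ∃ C : ℝ≥0∞, C ≠ ∞ ∧ ∀ H : ℤ → X → ℝ≥0∞, (∀ j, Measurable (H j)) →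
      ∫⁻ x, ellENorm q (fun k => averagedGrad n c s σ μ H k x) ^ p ∂μ ≤
        C * ∫⁻ x, ellENorm q (fun j => H j x) ^ p ∂μ := by
  obtain ⟨σ, hσ, C₁, hC₁, havg⟩ := exists_lintegral_ellENorm_dyadicAvg_le (μ := μ) hK hp hq
  obtain ⟨C₂, hC₂, hsum⟩ := exists_ellENorm_tsum_two_rpow_neg_mul_le hs hq
  refine ⟨σ, hσ, fun c => ?_⟩
  set b : ℝ≥0∞ := ENNReal.ofReal (c / 2)⁻¹ ^ (1 / σ)
  have hb : b ≠ ∞ := ENNReal.rpow_ne_top_of_nonneg (by positivity) ENNReal.ofReal_ne_top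
  have hCp : (C₂ * b) ^ p ≠ ∞ := ENNReal.rpow_ne_top_of_nonneg hp.le (by finiteness)
  refine ⟨(C₂ * b) ^ p * C₁, ENNReal.mul_ne_top hCp hC₁, fun H hH => ?_⟩
  have hpointwise (x : X) : ellENorm q (fun k => averagedGrad n c s σ μ H k x) ≤
      C₂ * b * ellENorm q fun j => dyadicAvg n μ j (fun z => H j z ^ σ) x ^ (1 / σ) := by
    rw [mul_assoc, ← ellENorm_const_mul hq]
    refine (hsum fun j => sampleBound n c σ μ H j x).trans_eq ?_
    simp only [sampleBound, ENNReal.mul_rpow_of_nonneg _ _ (one_div_nonneg.2 hσ.le), b]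
  calc ∫⁻ x, ellENorm q (fun k => averagedGrad n c s σ μ H k x) ^ p ∂μ
      ≤ ∫⁻ x, (C₂ * b * ellENorm q fun j =>
          dyadicAvg n μ j (fun z => H j z ^ σ) x ^ (1 / σ)) ^ p ∂μ :=
        lintegral_mono fun x => ENNReal.rpow_le_rpow (hpointwise x) hp.le
    _ = (C₂ * b) ^ p * ∫⁻ x, ellENorm q (fun j =>
          dyadicAvg n μ j (fun z => H j z ^ σ) x ^ (1 / σ)) ^ p ∂μ := by
        simp only [ENNReal.mul_rpow_of_nonneg _ _ hp.le]
        exact lintegral_const_mul' _ _ (by finiteness)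
    _ ≤ (C₂ * b) ^ p * C₁ * ∫⁻ x, ellENorm q (fun j => H j x) ^ p ∂μ := by
        rw [mul_assoc]
        gcongr
        exact havg H hH

end AveragedGradient

section Gradients

variable {X : Type*} [MetricSpace X] [MeasurableSpace X] {μ : Measure X} {s p : ℝ} {q : ℝ≥0∞}
  {u v : X → ℝ}

lemma IsFracHajlaszGradient.congr_ae {g : ℤ → X → ℝ≥0} (hg : IsFracHajlaszGradient s μ u g)
    (huv : u =ᵐ[μ] v) : IsFracHajlaszGradient s μ v g := by
  obtain ⟨hgm, E, hE, h⟩ := hg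
  refine ⟨hgm, E ∪ {x | ¬u x = v x}, measure_union_null hE huv, fun k x y hx hy => ?_⟩
  simp only [mem_union, mem_ofPred_eq, not_or, not_not] at hx hy
  rw [← hx.2, ← hy.2]
  exact h k x y hx.1 hy.1

lemma hajlaszTLNorm_congr_ae (huv : u =ᵐ[μ] v) :
    hajlaszTLNorm s p q μ u = hajlaszTLNorm s p q μ v :=
  iInf_congr fun _ => iInf_congr_Prop
    ⟨fun h => h.congr_ae huv, fun h => h.congr_ae huv.symm⟩ fun _ => rfl

lemma IsFracHajlaszGradient.exists_gradientOff {g : ℤ → X → ℝ≥0}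
    (hg : IsFracHajlaszGradient s μ u g) :
    ∃ (E : Set X) (G : ℤ → X → ℝ≥0∞), μ E = 0 ∧ (∀ i, Measurable (G i)) ∧ GradientOff s E u G ∧
      ∀ᵐ x ∂μ, ∀ i, G i x = g i x := by
  obtain ⟨hgm, E, hE, h⟩ := hg
  have hae : ∀ᵐ x ∂μ, ∀ i, g i x = (hgm i).mk (g i) x := ae_all_iff.2 fun i => (hgm i).ae_eq_mk
  refine ⟨E ∪ {x | ¬∀ i, g i x = (hgm i).mk (g i) x}, fun i x => ((hgm i).mk (g i) x : ℝ≥0),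
    measure_union_null hE hae, fun i => (hgm i).measurable_mk.coe_nnreal_ennreal,
    fun i x y hx hy hxy hxy' => ?_, hae.mono fun x hx i => congrArg ENNReal.ofNNReal (hx i).symm⟩
  simp only [mem_union, mem_ofPred_eq, not_or, not_not] at hx hy
  simp only [← hx.2 i, ← hy.2 i, edist_dist, Real.dist_eq]
  refine (ENNReal.ofReal_le_ofReal (h i x y hx.1 hy.1 hxy hxy')).trans_eq ?_
  rw [ENNReal.ofReal_mul (by positivity), ENNReal.ofReal_add (by positivity) (by positivity),
    ENNReal.ofReal_coe_nnreal, ENNReal.ofReal_coe_nnreal]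

lemma GradientOff.isFracHajlaszGradient {E : Set X} {G : ℤ → X → ℝ≥0∞} (hG : GradientOff s E u G)
    (hE : μ E = 0) (hGm : ∀ i, Measurable (G i)) (hfin : ∀ᵐ x ∂μ, ∀ i, G i x ≠ ∞) :
    IsFracHajlaszGradient s μ u fun i x => (G i x).toNNReal := by
  refine ⟨fun i => (hGm i).ennreal_toNNReal.aemeasurable, E ∪ {x | ¬∀ i, G i x ≠ ∞},
    measure_union_null hE hfin, fun i x y hx hy hxy hxy' => ?_⟩
  simp only [mem_union, mem_ofPred_eq, not_or, not_not] at hx hy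
  have hle := hG i x y hx.1 hy.1 hxy hxy'
  rwa [← ENNReal.coe_toNNReal (hx.2 i), ← ENNReal.coe_toNNReal (hy.2 i), edist_dist,
    Real.dist_eq, ← ENNReal.ofReal_coe_nnreal, ← ENNReal.ofReal_coe_nnreal,
    ← ENNReal.ofReal_add (by positivity) (by positivity), ← ENNReal.ofReal_mul (by positivity),
    ENNReal.ofReal_le_ofReal_iff (by positivity)] at hle

lemma GradientOff.hajlaszTLNorm_le {E : Set X} {G : ℤ → X → ℝ≥0∞} (hG : GradientOff s E u G)
    (hE : μ E = 0) (hGm : ∀ i, Measurable (G i)) (hp : 0 < p) (hq : 0 < q) :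
    hajlaszTLNorm s p q μ u ≤ (∫⁻ x, ellENorm q (fun i => G i x) ^ p ∂μ) ^ (1 / p) := by
  rcases eq_or_ne (∫⁻ x, ellENorm q (fun i => G i x) ^ p ∂μ) ∞ with htop | htop
  · rw [htop, ENNReal.top_rpow_of_pos (by positivity)]
    exact le_top
  have hfin : ∀ᵐ x ∂μ, ∀ i, G i x ≠ ∞ := by
    filter_upwards [ae_lt_top ((measurable_ellENorm q hGm).pow_const p) htop] with x hx i
    exact ((le_ellENorm hq (fun i => G i x) i).trans_lt
      ((ENNReal.rpow_lt_top_iff_of_pos hp).1 hx)).ne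
  refine (iInf₂_le _ (hG.isFracHajlaszGradient hE hGm hfin)).trans ?_
  unfold mixedNorm
  gcongr with x
  exact ellENorm_mono q fun k => ENNReal.coe_toNNReal_le_self

end Gradients

section NormBound

variable {X Y : Type*} [MetricSpace X] [MetricSpace Y] [MeasurableSpace X] [MeasurableSpace Y]
  {μ : Measure X} {ν : Measure Y} {f : X ≃ₜ Y} {J : X → ℝ≥0∞} {n₁ n₂ s s₁ s₂ p σ c₁ c₂ : ℝ}
  {K₁ K₂ : ℝ≥0} {q : ℝ≥0∞}

lemma two_rpow_neg_mul_le_ofReal_rpow (hs : 0 ≤ s) {k : ℤ} {d : ℝ} (hd : (2 : ℝ) ^ (-k - 1) ≤ d) :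
    (2 : ℝ≥0∞) ^ (-(k * s)) ≤ 2 ^ s * ENNReal.ofReal (d ^ s) :=
  calc (2 : ℝ≥0∞) ^ (-(k * s)) = 2 ^ s * 2 ^ (-((k + 1 : ℤ) * s)) := by
        rw [← two_rpow_add]
        congr 1
        push_cast
        ring
    _ = 2 ^ s * ENNReal.ofReal ((2 ^ (-k - 1)) ^ s) := by
        rw [← ofReal_two_zpow_rpow, neg_add, sub_eq_add_neg]
    _ ≤ 2 ^ s * ENNReal.ofReal (d ^ s) := by gcongr

variable [Nontrivial X] [BorelSpace X] [BorelSpace Y]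

lemma RatioControl.exists_gradientOff_comp (hf : RatioControl f) (hμ : BallBounds n₁ c₁ K₁ μ)
    (hν : BallBounds n₂ c₂ K₂ ν) (hfm : Measure.QuasiMeasurePreserving f μ ν) (hJ : Measurable J)
    (hgood : HasGoodParts μ ν f J) (hp : 0 < p) (hs : 0 ≤ s₁) (hs₁ : s₁ * p = n₁)
    (hs₂ : s₂ * p = n₂) (hσ : 0 < σ) :
    ∃ c κ : ℝ, 0 < κ ∧ ∃ C : ℝ≥0∞, C ≠ ∞ ∧ ∀ (u : Y → ℝ) (E : Set Y) (G : ℤ → Y → ℝ≥0∞),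
      Measurable u → ν E = 0 → (∀ i, Measurable (G i)) → GradientOff s₂ E u G →
      ∃ N : Set X, μ N = 0 ∧ GradientOff s₁ N (u ∘ f) fun k x =>
        C * averagedGrad n₁ c s₁ σ μ (pullGrad f κ p J G) k x := by
  obtain ⟨c, δ, c', hc, hT⟩ := hgood.exists_thickAnnuli hμ
  obtain ⟨κ, hκ, hchain⟩ := hT.exists_edist_le (Z := ℝ) hμ.ballsFinitePos hσ
  obtain ⟨C, hC, hosc⟩ := hf.exists_oscillationLE_goodPart hμ.upper hν hp hs₁ hs₂ hc hκ
  refine ⟨c', κ, hκ, 3 * C * 2 ^ s₁, ENNReal.mul_ne_top (by finiteness) (two_rpow_ne_top _),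
    fun u E G hu hE hGm hG => ⟨{x | ¬ApproxContinuousAt n₁ μ (u ∘ f) x},
      hμ.ae_approxContinuousAt (hu.comp f.continuous.measurable),
      fun k x y hx hy hxy hxy' => ?_⟩⟩
  have hD (j : ℤ) : Measurable fun z => C * 2 ^ (-(j * s₁)) * pullGrad f κ p J G j z :=
    (measurable_pullGrad hJ hGm j).const_mul _
  set S : X → ℝ≥0∞ := averagedGrad n₁ c' s₁ σ μ (pullGrad f κ p J G) k
  calc edist (u (f x)) (u (f y))
      ≤ 3 * (C * 2 ^ (-(k * s₁)) * S x + C * 2 ^ (-(k * s₁)) * S y) := by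
        simp only [S, ← tsum_sampleBound_eq c' hσ hC]
        exact hchain (u ∘ f) _ (f ⁻¹' E) (hfm.preimage_null hE) hD
          (fun x x' z z' j j' hz hz' => hosc J u E G hG x x' z z' j j' hz.1 hz'.1)
          k x y (not_not.1 hx) (not_not.1 hy) hxy hxy'
    _ = 2 ^ (-(k * s₁)) * (3 * C * (S x + S y)) := by ring
    _ ≤ 2 ^ s₁ * ENNReal.ofReal (dist x y ^ s₁) * (3 * C * (S x + S y)) := by
        gcongr
        exact two_rpow_neg_mul_le_ofReal_rpow hs hxy
    _ = ENNReal.ofReal (dist x y ^ s₁) * (3 * C * 2 ^ s₁ * S x + 3 * C * 2 ^ s₁ * S y) := by ring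

lemma RatioControl.exists_hajlaszTLNorm_comp_le_lintegral (hf : RatioControl f)
    (hμ : BallBounds n₁ c₁ K₁ μ) (hν : BallBounds n₂ c₂ K₂ ν)
    (hfm : Measure.QuasiMeasurePreserving f μ ν) (hJ : Measurable J)
    (hgood : HasGoodParts μ ν f J) (hcv : ChangeOfVariablesLE μ ν f J) (hp : 0 < p) (hs : 0 < s₁)
    (hs₁ : s₁ * p = n₁) (hs₂ : s₂ * p = n₂) (hq : 0 < q) :
    ∃ C : ℝ≥0∞, C ≠ ∞ ∧ ∀ (u : Y → ℝ) (E : Set Y) (G : ℤ → Y → ℝ≥0∞),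
      Measurable u → ν E = 0 → (∀ i, Measurable (G i)) → GradientOff s₂ E u G →
      hajlaszTLNorm s₁ p q μ (u ∘ f) ≤
        (C * ∫⁻ y, ellENorm q (fun i => G i y) ^ p ∂ν) ^ (1 / p) := by
  have := hμ.ballsFinitePos.secondCountableTopology
  have := hμ.ballsFinitePos.isLocallyFiniteMeasure
  obtain ⟨σ, hσ, havg⟩ := exists_lintegral_ellENorm_averagedGrad_le (μ := μ) hμ.upper hp hq hs
  obtain ⟨c, κ, hκ, A, hA, hgrad⟩ :=
    hf.exists_gradientOff_comp hμ hν hfm hJ hgood hp hs.le hs₁ hs₂ hσ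
  obtain ⟨C₁, hC₁, havg⟩ := havg c
  obtain ⟨C₂, hC₂, hpull⟩ := hf.exists_lintegral_pullGrad_le hκ hp hcv hq
  have hAp : A ^ p ≠ ∞ := ENNReal.rpow_ne_top_of_nonneg hp.le hA
  refine ⟨A ^ p * (C₁ * C₂), by finiteness, fun u E G hu hE hGm hG => ?_⟩
  obtain ⟨N, hN, hNG⟩ := hgrad u E G hu hE hGm hG
  have hH (j : ℤ) : Measurable (pullGrad f κ p J G j) := measurable_pullGrad hJ hGm j
  refine (hNG.hajlaszTLNorm_le hN
    (fun k => (measurable_averagedGrad c hH k).const_mul A) hp hq).trans ?_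
  gcongr
  calc ∫⁻ x, ellENorm q
        (fun k => A * averagedGrad n₁ c s₁ σ μ (pullGrad f κ p J G) k x) ^ p ∂μ
      = A ^ p * ∫⁻ x, ellENorm q
        (fun k => averagedGrad n₁ c s₁ σ μ (pullGrad f κ p J G) k x) ^ p ∂μ := by
        simp only [ellENorm_const_mul hq, ENNReal.mul_rpow_of_nonneg _ _ hp.le]
        exact lintegral_const_mul' _ _ hAp
    _ ≤ A ^ p * (C₁ * (C₂ * ∫⁻ y, ellENorm q (fun i => G i y) ^ p ∂ν)) := by
        gcongr
        refine (havg _ hH).trans ?_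
        gcongr
        exact hpull G hGm
    _ = A ^ p * (C₁ * C₂) * ∫⁻ y, ellENorm q (fun i => G i y) ^ p ∂ν := by ring

theorem RatioControl.exists_hajlaszTLNorm_comp_le (hf : RatioControl f)
    (hμ : BallBounds n₁ c₁ K₁ μ) (hν : BallBounds n₂ c₂ K₂ ν)
    (hfm : Measure.QuasiMeasurePreserving f μ ν) (hJ : Measurable J)
    (hgood : HasGoodParts μ ν f J) (hcv : ChangeOfVariablesLE μ ν f J) (hp : 0 < p)
    (hs₁ : s₁ * p = n₁) (hs₂ : s₂ * p = n₂) (hq : 0 < q) :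
    ∃ C : ℝ≥0, ∀ u ∈ MSpace s₂ p q ν, u ∘ f ∈ MSpace s₁ p q μ ∧
      hajlaszTLNorm s₁ p q μ (u ∘ f) ≤ C * hajlaszTLNorm s₂ p q ν u := by
  have hs : 0 < s₁ := pos_of_mul_pos_left (hs₁ ▸ hμ.exponent_pos) hp.le
  obtain ⟨B, hB, hbound⟩ := hf.exists_hajlaszTLNorm_comp_le_lintegral hμ hν hfm hJ hgood hcv hp hs
    hs₁ hs₂ hq
  obtain ⟨C, hC⟩ : ∃ C : ℝ≥0, C = B ^ (1 / p) :=
    ⟨_, ENNReal.coe_toNNReal (ENNReal.rpow_ne_top_of_nonneg (one_div_nonneg.2 hp.le) hB)⟩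
  have hgrad {u : Y → ℝ} (hu : AEMeasurable u ν) {g : ℤ → Y → ℝ≥0}
      (hg : IsFracHajlaszGradient s₂ ν u g) :
      hajlaszTLNorm s₁ p q μ (u ∘ f) ≤ C * mixedNorm p q ν g := by
    obtain ⟨E, G, hE, hGm, hG, hGg⟩ := (hg.congr_ae hu.ae_eq_mk).exists_gradientOff
    calc hajlaszTLNorm s₁ p q μ (u ∘ f) = hajlaszTLNorm s₁ p q μ (hu.mk u ∘ f) :=
          hajlaszTLNorm_congr_ae (hfm.ae_eq_comp hu.ae_eq_mk)
      _ ≤ (B * ∫⁻ y, ellENorm q (fun i => G i y) ^ p ∂ν) ^ (1 / p) :=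
          hbound _ E G hu.measurable_mk hE hGm hG
      _ = C * (∫⁻ y, ellENorm q (fun i => G i y) ^ p ∂ν) ^ (1 / p) := by
          rw [ENNReal.mul_rpow_of_nonneg _ _ (by positivity), hC]
      _ = C * mixedNorm p q ν g := by
          unfold mixedNorm
          congr 2
          exact lintegral_congr_ae (hGg.mono fun y hy => by simp only [hy]; rfl)
  refine ⟨C + 1, fun u hu => ?_⟩
  have hle : hajlaszTLNorm s₁ p q μ (u ∘ f) ≤ (C + 1 : ℝ≥0) * hajlaszTLNorm s₂ p q ν u := by
    simp only [hajlaszTLNorm.eq_1 s₂,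
      ENNReal.mul_iInf_of_ne (a := (C + 1 : ℝ≥0)) (by simp) (by simp)]
    refine le_iInf₂ fun g hg => (hgrad hu.1 hg).trans ?_
    gcongr
    exact le_self_add
  exact ⟨⟨hu.1.comp_quasiMeasurePreserving hfm,
    hle.trans_lt (ENNReal.mul_lt_top ENNReal.coe_lt_top hu.2)⟩, hle⟩

end NormBound
/-! ### Volume derivatives and reverse Hölder weights -/

section VolumeDerivative

variable {X Y : Type*} [MetricSpace X] [MetricSpace Y] [MeasurableSpace X] [MeasurableSpace Y]
  {μ : Measure X} {ν : Measure Y} {f : X ≃ₜ Y} {w : X → ℝ≥0∞}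

/-- `w` is the Radon–Nikodym derivative with respect to `μ` of the pull-back `E ↦ ν (f '' E)`. -/
structure IsPullbackDensity (μ : Measure X) (ν : Measure Y) (f : X ≃ₜ Y) (w : X → ℝ≥0∞) : Prop where
  measurable : Measurable w
  withDensity_eq : μ.withDensity w = ν.map f.symm

lemma map_symm_apply_eq [BorelSpace X] [BorelSpace Y] (f : X ≃ₜ Y) (ν : Measure Y) (A : Set X) :
    ν.map f.symm A = ν (f '' A) := by
  rw [f.symm.measurableEmbedding.map_apply, f.image_eq_preimage_symm]

lemma div_le_const_mul_div {a a' b b' C : ℝ≥0∞} (ha : a ≤ a') (hb : b' ≤ C * b) (hC₀ : C ≠ 0)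
    (hC : C ≠ ∞) : a / b ≤ C * (a' / b') := by
  have hinv : b⁻¹ ≤ C * b'⁻¹ :=
    calc b⁻¹ = C * (C * b)⁻¹ := by
          rw [ENNReal.mul_inv (Or.inl hC₀) (Or.inl hC), ENNReal.mul_inv_cancel_left hC₀ hC]
      _ ≤ C * b'⁻¹ := by gcongr
  rw [div_eq_mul_inv, div_eq_mul_inv, mul_left_comm]
  gcongr

section BallQuotients

variable {ν' : Measure X} {x : X} {D C : ℝ≥0∞}

lemma limsup_measure_ball_div_le
    (hD : Tendsto (fun r => ν' (closedBall x r) / μ (closedBall x r)) (𝓝[>] 0) (𝓝 D))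
    (hμ : ∀ᶠ r in 𝓝[>] 0, μ (closedBall x r) ≤ C * μ (ball x r)) (hC₀ : C ≠ 0) (hC : C ≠ ∞) :
    limsup (fun r => ν' (ball x r) / μ (ball x r)) (𝓝[>] 0) ≤ C * D := by
  rw [← (ENNReal.Tendsto.const_mul hD (Or.inr hC)).limsup_eq]
  exact limsup_le_limsup (hμ.mono fun r hr =>
    div_le_const_mul_div (measure_mono ball_subset_closedBall) hr hC₀ hC)

lemma le_limsup_measure_ball_div
    (hD : Tendsto (fun r => ν' (closedBall x r) / μ (closedBall x r)) (𝓝[>] 0) (𝓝 D))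
    (hμ : ∀ᶠ r in 𝓝[>] 0, μ (ball x r) ≤ C * μ (closedBall x (r / 2))) (hC₀ : C ≠ 0)
    (hC : C ≠ ∞) :
    D ≤ C * limsup (fun r => ν' (ball x r) / μ (ball x r)) (𝓝[>] 0) := by
  have hhalf : Tendsto (fun r : ℝ => r / 2) (𝓝[>] 0) (𝓝[>] 0) :=
    tendsto_nhdsWithin_of_tendsto_nhds_of_eventually_within _
      (Tendsto.mono_left (Continuous.tendsto' (by fun_prop) 0 0 (zero_div 2)) nhdsWithin_le_nhds)
      (eventually_mem_nhdsWithin.mono fun _ hr => half_pos (mem_Ioi.1 hr))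
  rw [← ENNReal.limsup_const_mul_of_ne_top hC, ← (hD.comp hhalf).limsup_eq]
  refine limsup_le_limsup ?_
  filter_upwards [hμ, self_mem_nhdsWithin] with r hr hr₀
  exact div_le_const_mul_div (measure_mono (closedBall_subset_ball (half_lt_self hr₀))) hr hC₀ hC

end BallQuotients

lemma ae_tendsto_measure_closedBall_div [SecondCountableTopology X] [BorelSpace X]
    [IsLocallyFiniteMeasure μ] [IsUnifLocDoublingMeasure μ] (ν' : Measure X)
    [IsLocallyFiniteMeasure ν'] :
    ∀ᵐ x ∂μ, Tendsto (fun r => ν' (closedBall x r) / μ (closedBall x r)) (𝓝[>] 0)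
      (𝓝 (ν'.rnDeriv μ x)) := by
  filter_upwards [VitaliFamily.ae_tendsto_rnDeriv (IsUnifLocDoublingMeasure.vitaliFamily μ 1) ν']
    with x hx
  refine hx.comp (IsUnifLocDoublingMeasure.tendsto_closedBall_filterAt μ (fun _ => x) id
    tendsto_id ?_)
  filter_upwards [self_mem_nhdsWithin] with r hr
  exact mem_closedBall_self (by simpa using (mem_Ioi.1 hr).le)

variable [Nontrivial X] [BorelSpace X] [BorelSpace Y]

lemma RatioControl.isLocallyFiniteMeasure_map_symm (hf : RatioControl f) (hν : BallsFinitePos ν) :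
    IsLocallyFiniteMeasure (ν.map f.symm) :=
  ⟨fun x => ⟨ball x 1, ball_mem_nhds x one_pos, by
    rw [map_symm_apply_eq]
    exact hf.measure_image_ball_lt_top hν x one_pos⟩⟩

lemma BallBounds.exists_volDeriv_comparable {n c : ℝ} {K : ℝ≥0} (hμ : BallBounds n c K μ)
    (hf : RatioControl f) (hν : BallsFinitePos ν) :
    ∃ C : ℝ≥0, ∀ᵐ x ∂μ, volDeriv μ ν f x ≤ C * (ν.map f.symm).rnDeriv μ x ∧
      (ν.map f.symm).rnDeriv μ x ≤ C * volDeriv μ ν f x := by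
  have := hμ.ballsFinitePos.secondCountableTopology
  have := hμ.ballsFinitePos.isLocallyFiniteMeasure
  have := hμ.isUnifLocDoublingMeasure
  have := hf.isLocallyFiniteMeasure_map_symm hν
  obtain ⟨a, b, hab⟩ := exists_pair_ne X
  set C : ℝ≥0 := K * (2 ^ n / c).toNNReal + 1
  have hC₀ : (C : ℝ≥0∞) ≠ 0 := ENNReal.coe_ne_zero.2 (by positivity)
  have hdouble (x : X) {r : ℝ} (hr : 0 < r) (hrd : r ≤ dist a b) :
      μ (ball x (2 * r)) ≤ C * μ (ball x r) := by
    refine (hμ.measure_ball_mul_le (x := x) (y := x) two_pos hr hrd).trans ?_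
    gcongr
    rw [ENNReal.ofReal, ← ENNReal.coe_mul, ENNReal.coe_le_coe]
    exact le_self_add
  refine ⟨C, (ae_tendsto_measure_closedBall_div (ν.map f.symm)).mono fun x hx => ?_⟩
  simp only [volDeriv, ← map_symm_apply_eq]
  have hsmall := Ioc_mem_nhdsGT (dist_pos.2 hab)
  refine ⟨limsup_measure_ball_div_le hx ?_ hC₀ ENNReal.coe_ne_top,
    le_limsup_measure_ball_div hx ?_ hC₀ ENNReal.coe_ne_top⟩
  · filter_upwards [hsmall] with r ⟨hr, hrd⟩
    exact (measure_mono (closedBall_subset_ball (by linarith))).trans (hdouble x hr hrd)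
  · filter_upwards [hsmall] with r ⟨hr, hrd⟩
    rw [← mul_div_cancel₀ r two_ne_zero]
    refine (hdouble x (half_pos hr) (by linarith)).trans ?_
    rw [mul_div_cancel₀ r two_ne_zero]
    gcongr
    exact ball_subset_closedBall

theorem BallBounds.exists_isPullbackDensity {n c : ℝ} {K : ℝ≥0} (hμ : BallBounds n c K μ)
    (hf : RatioControl f) (hν : BallsFinitePos ν) (hac : AbsContMap μ ν f) :
    ∃ (w : X → ℝ≥0∞) (C : ℝ≥0), IsPullbackDensity μ ν f w ∧
      ∀ᵐ x ∂μ, volDeriv μ ν f x ≤ C * w x ∧ w x ≤ C * volDeriv μ ν f x := by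
  have := hμ.ballsFinitePos.secondCountableTopology
  have := hμ.ballsFinitePos.isLocallyFiniteMeasure
  have := hf.isLocallyFiniteMeasure_map_symm hν
  obtain ⟨C, hC⟩ := hμ.exists_volDeriv_comparable hf hν
  have hll : ν.map f.symm ≪ μ := fun A hA => (map_symm_apply_eq f ν A).trans (hac A hA)
  exact ⟨_, C, ⟨Measure.measurable_rnDeriv _ _, Measure.withDensity_rnDeriv_eq _ _ hll⟩, hC⟩

end VolumeDerivative

section SetAverages

variable {X : Type*} [MeasurableSpace X] {μ : Measure X} {J w : X → ℝ≥0∞} {B E : Set X} {C : ℝ≥0∞}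

lemma setLAverage_le_const_mul (hC : C ≠ ∞) (h : ∀ᵐ x ∂μ, J x ≤ C * w x) :
    ⨍⁻ y in B, J y ∂μ ≤ C * ⨍⁻ y in B, w y ∂μ := by
  rw [setLAverage_eq, setLAverage_eq, ← mul_div_assoc, ← lintegral_const_mul' _ _ hC]
  gcongr ?_ / _
  exact lintegral_mono_ae (ae_restrict_of_ae h)

lemma setLIntegral_le_of_essSup_le (hEB : E ⊆ B)
    (h : essSup w (μ.restrict B) ≤ C * ⨍⁻ y in B, w y ∂μ) :
    ∫⁻ y in E, w y ∂μ ≤ C * (μ E / μ B) * ∫⁻ y in B, w y ∂μ :=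
  calc ∫⁻ y in E, w y ∂μ ≤ ∫⁻ _ in E, C * ⨍⁻ y in B, w y ∂μ ∂μ :=
        lintegral_mono_ae (ae_restrict_of_ae_restrict_of_subset hEB
          ((ENNReal.ae_le_essSup w).mono fun y hy => hy.trans h))
    _ = C * (μ E / μ B) * ∫⁻ y in B, w y ∂μ := by
        rw [setLIntegral_const, setLAverage_eq, div_eq_mul_inv, div_eq_mul_inv]
        ring

lemma setLIntegral_le_of_rpow_setLAverage_le {R : ℝ} (hR : 1 < R) (hw : AEMeasurable w μ)
    (hEB : E ⊆ B) (hB₀ : μ B ≠ 0) (hB : μ B ≠ ∞)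
    (h : (⨍⁻ y in B, w y ^ R ∂μ) ^ (1 / R) ≤ C * ⨍⁻ y in B, w y ∂μ) :
    ∫⁻ y in E, w y ∂μ ≤ C * (μ E / μ B) ^ (1 - 1 / R) * ∫⁻ y in B, w y ∂μ := by
  have hR₀ : 0 < R := one_pos.trans hR
  have hRi : 0 ≤ 1 / R := by positivity
  have hθ : 0 ≤ 1 - 1 / R := sub_nonneg.2 ((div_le_one hR₀).2 hR.le)
  have hholder : ∫⁻ y in E, w y ∂μ ≤ (∫⁻ y in B, w y ^ R ∂μ) ^ (1 / R) * μ E ^ (1 - 1 / R) := by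
    have hE := ENNReal.lintegral_mul_norm_pow_le (μ := μ.restrict E) (f := fun y => w y ^ R)
      (g := 1) (hw.restrict.pow_const R) aemeasurable_one hRi hθ (by ring)
    simp only [Pi.one_apply, ENNReal.one_rpow, mul_one, ← ENNReal.rpow_mul,
      mul_one_div_cancel hR₀.ne', ENNReal.rpow_one, lintegral_one, Measure.restrict_apply_univ]
      at hE
    refine hE.trans ?_
    gcongr
  have hmean : ∫⁻ y in B, w y ^ R ∂μ = μ B * ⨍⁻ y in B, w y ^ R ∂μ := by
    rw [setLAverage_eq, ENNReal.mul_div_cancel hB₀ hB]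
  have hpow : μ B ^ (1 / R) * (μ B)⁻¹ = (μ B)⁻¹ ^ (1 - 1 / R) := by
    rw [ENNReal.inv_rpow, ← ENNReal.rpow_neg, ← ENNReal.rpow_neg_one, ← ENNReal.rpow_add _ _ hB₀ hB]
    congr 1
    ring
  calc ∫⁻ y in E, w y ∂μ
      ≤ μ B ^ (1 / R) * (⨍⁻ y in B, w y ^ R ∂μ) ^ (1 / R) * μ E ^ (1 - 1 / R) := by
        rwa [← ENNReal.mul_rpow_of_nonneg _ _ hRi, ← hmean]
    _ ≤ μ B ^ (1 / R) * (C * ⨍⁻ y in B, w y ∂μ) * μ E ^ (1 - 1 / R) := by gcongr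
    _ = C * (μ B ^ (1 / R) * (μ B)⁻¹ * μ E ^ (1 - 1 / R)) * ∫⁻ y in B, w y ∂μ := by
        rw [setLAverage_eq, div_eq_mul_inv (∫⁻ y in B, w y ∂μ)]
        ring
    _ = C * (μ E / μ B) ^ (1 - 1 / R) * ∫⁻ y in B, w y ∂μ := by
        rw [hpow, ← ENNReal.mul_rpow_of_nonneg _ _ hθ, mul_comm (μ B)⁻¹, ← div_eq_mul_inv]

end SetAverages

section ReverseHolder

variable {X : Type*} [MetricSpace X] [MeasurableSpace X] {μ : Measure X} {J w : X → ℝ≥0∞}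

/-- The Muckenhoupt class `A_∞`, in the form: a subset of a ball of sufficiently small relative
`μ`-measure carries at most half of the `w`-mass of the ball. -/
def IsAInfty (μ : Measure X) (w : X → ℝ≥0∞) : Prop :=
  ∃ δ : ℝ≥0, 0 < δ ∧ ∀ (x : X) (ρ : ℝ) (E : Set X), 0 < ρ → MeasurableSet E → E ⊆ ball x ρ →
    μ E ≤ δ * μ (ball x ρ) → ∫⁻ y in E, w y ∂μ ≤ 2⁻¹ * ∫⁻ y in ball x ρ, w y ∂μ

lemma ReverseHolder.of_comparable {r : ℝ≥0∞} {C : ℝ≥0} (hr : 0 < r) (hJ : ReverseHolder r μ J)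
    (hJw : ∀ᵐ x ∂μ, J x ≤ C * w x) (hwJ : ∀ᵐ x ∂μ, w x ≤ C * J x) : ReverseHolder r μ w := by
  obtain ⟨C₀, hC₀⟩ := hJ
  refine ⟨C * C₀ * C, fun x ρ hρ => ?_⟩
  set B := ball x ρ
  have hJB := hC₀ x ρ hρ
  have hmean : C₀ * ⨍⁻ y in B, J y ∂μ ≤ C₀ * (C * ⨍⁻ y in B, w y ∂μ) := by
    gcongr
    exact setLAverage_le_const_mul ENNReal.coe_ne_top hJw
  suffices hw : (if r = ∞ then essSup w (μ.restrict B)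
      else (⨍⁻ y in B, w y ^ r.toReal ∂μ) ^ (1 / r.toReal)) ≤
      C * if r = ∞ then essSup J (μ.restrict B)
      else (⨍⁻ y in B, J y ^ r.toReal ∂μ) ^ (1 / r.toReal) by
    calc _ ≤ C * (C₀ * (C * ⨍⁻ y in B, w y ∂μ)) := by
          refine hw.trans ?_
          gcongr
          exact hJB.trans hmean
      _ = (C * C₀ * C : ℝ≥0) * ⨍⁻ y in B, w y ∂μ := by
          push_cast
          ring
  split_ifs with hrt
  · rw [← ENNReal.essSup_const_mul]
    exact essSup_mono_ae (ae_restrict_of_ae hwJ)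
  · have hr₀ : 0 < r.toReal := ENNReal.toReal_pos hr.ne' hrt
    have hpow : ∀ᵐ y ∂μ, w y ^ r.toReal ≤ C ^ r.toReal * J y ^ r.toReal := hwJ.mono fun y hy => by
      rw [← ENNReal.mul_rpow_of_nonneg _ _ hr₀.le]
      gcongr
    calc (⨍⁻ y in B, w y ^ r.toReal ∂μ) ^ (1 / r.toReal)
        ≤ (C ^ r.toReal * ⨍⁻ y in B, J y ^ r.toReal ∂μ) ^ (1 / r.toReal) := by
          gcongr
          exact setLAverage_le_const_mul (by finiteness) hpow
      _ = C * (⨍⁻ y in B, J y ^ r.toReal ∂μ) ^ (1 / r.toReal) := by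
          rw [ENNReal.mul_rpow_of_nonneg _ _ (by positivity), ← ENNReal.rpow_mul,
            mul_one_div_cancel hr₀.ne', ENNReal.rpow_one]

lemma ReverseHolder.exists_setLIntegral_le_rpow {r : ℝ≥0∞} (h : ReverseHolder r μ w) (hr : 1 < r)
    (hμ : BallsFinitePos μ) (hw : AEMeasurable w μ) :
    ∃ (C : ℝ≥0) (θ : ℝ), 0 < θ ∧ ∀ (x : X) (ρ : ℝ) (E : Set X), 0 < ρ → E ⊆ ball x ρ →
      ∫⁻ y in E, w y ∂μ ≤ C * (μ E / μ (ball x ρ)) ^ θ * ∫⁻ y in ball x ρ, w y ∂μ := by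
  obtain ⟨C, hC⟩ := h
  rcases eq_or_ne r ∞ with hrt | hrt
  · simp only [if_pos hrt] at hC
    refine ⟨C, 1, one_pos, fun x ρ E hρ hE => ?_⟩
    rw [ENNReal.rpow_one]
    exact setLIntegral_le_of_essSup_le hE (hC x ρ hρ)
  · simp only [if_neg hrt] at hC
    have hR : 1 < r.toReal := ENNReal.toReal_one ▸ ENNReal.toReal_strict_mono hrt hr
    exact ⟨C, 1 - 1 / r.toReal, sub_pos.2 ((div_lt_one (one_pos.trans hR)).2 hR),
      fun x ρ E hρ hE => setLIntegral_le_of_rpow_setLAverage_le hR hw hE (hμ x ρ hρ).1.ne'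
        (hμ x ρ hρ).2.ne (hC x ρ hρ)⟩

lemma exists_const_mul_rpow_le_half (C : ℝ≥0) {θ : ℝ} (hθ : 0 < θ) :
    ∃ δ : ℝ≥0, 0 < δ ∧ (C : ℝ≥0∞) * δ ^ θ ≤ 2⁻¹ := by
  refine ⟨((2 * (C + 1))⁻¹) ^ (1 / θ), by positivity, ?_⟩
  rw [← ENNReal.coe_rpow_of_nonneg _ hθ.le, ← NNReal.rpow_mul, one_div_mul_cancel hθ.ne',
    NNReal.rpow_one, ← ENNReal.coe_mul, ← ENNReal.coe_ofNat, ← ENNReal.coe_inv two_ne_zero,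
    ENNReal.coe_le_coe, mul_inv, mul_left_comm]
  refine mul_le_of_le_one_right' ?_
  rw [← div_eq_mul_inv, div_le_one (by positivity)]
  exact le_self_add

theorem ReverseHolder.isAInfty {r : ℝ≥0∞} (h : ReverseHolder r μ w) (hr : 1 < r)
    (hμ : BallsFinitePos μ) (hw : AEMeasurable w μ) : IsAInfty μ w := by
  obtain ⟨C, θ, hθ, hE⟩ := h.exists_setLIntegral_le_rpow hr hμ hw
  obtain ⟨δ, hδ, hCδ⟩ := exists_const_mul_rpow_le_half C hθ
  refine ⟨δ, hδ, fun x ρ E hρ _ hEB hle => (hE x ρ E hρ hEB).trans ?_⟩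
  gcongr
  refine le_trans ?_ hCδ
  gcongr
  exact ENNReal.div_le_of_le_mul hle

end ReverseHolder

/-! ### Good parts of a quasisymmetric map and of its inverse -/

section BallComparison

variable {X Y : Type*} [MetricSpace X] [MetricSpace Y] {f : X ≃ₜ Y}

lemma RatioBound.image_ball_subset_closedBall {t T : ℝ} (h : RatioBound f t T) {x z : X} {ρ : ℝ}
    (hz : ρ ≤ t * dist x z) : f '' ball x ρ ⊆ closedBall (f x) (T * dist (f x) (f z)) := by
  rintro _ ⟨a, ha, rfl⟩
  exact mem_closedBall'.2 (h x a z ((mem_ball'.1 ha).le.trans hz))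

variable [MeasurableSpace X] {μ : Measure X} {n₁ n₂ c₁ c₂ : ℝ} {K₁ K₂ : ℝ≥0}

lemma BallBounds.exists_dist_mem_Ico (hμ : BallBounds n₁ c₁ K₁ μ) :
    ∃ δ : ℝ, 0 < δ ∧ ∀ (x a b : X) (ρ : ℝ), 0 < ρ → ρ ≤ dist a b →
      ∃ z, dist x z ∈ Ico (δ * ρ) ρ := by
  obtain ⟨δ, hδ, -, hball⟩ := hμ.exists_measure_ball_mul_le (ε := 2⁻¹) (by simp)
  refine ⟨δ, hδ, fun x a b ρ hρ hab => ?_⟩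
  have : Nontrivial X := ⟨a, b, dist_pos.1 (hρ.trans_le hab)⟩
  obtain ⟨hpos, hfin⟩ := hμ.ballsFinitePos x ρ hρ
  have hlt : μ (ball x (δ * ρ)) < μ (ball x ρ) :=
    (hball x a b ρ hρ hab).trans_lt (by
      rw [← ENNReal.div_eq_inv_mul]
      exact ENNReal.half_lt_self hpos.ne' hfin.ne)
  obtain ⟨z, hz, hzδ⟩ := not_subset.1 fun hsub => hlt.not_ge (measure_mono hsub)
  exact ⟨z, not_lt.1 (mem_ball'.not.1 hzδ), mem_ball'.1 hz⟩

lemma RatioControl.exists_measure_ball_le_symm_image (hf : RatioControl f)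
    (hμ : BallBounds n₁ c₁ K₁ μ) {A S : ℝ} (hA : 0 ≤ A) (hS : 0 < S) :
    ∃ C : ℝ≥0, ∀ (x z : X) (ρ R : ℝ), 0 < ρ → ρ ≤ A * dist x z → dist (f x) (f z) ≤ S * R →
      μ (ball x ρ) ≤ C * μ (f.symm '' ball (f x) R) := by
  obtain ⟨C, hC⟩ := hf.symm.exists_ofReal_dist_rpow_le hμ hS
  refine ⟨K₁ * (A ^ n₁).toNNReal * C, fun x z ρ R hρ hρz hR => ?_⟩
  have hinv := hC (f x) (f z) R hR
  simp only [f.symm_apply_apply] at hinv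
  calc μ (ball x ρ) ≤ K₁ * ENNReal.ofReal ((A * dist x z) ^ n₁) := by
        refine (hμ.upper x ρ hρ).trans ?_
        gcongr
        exact hμ.exponent_pos.le
    _ = K₁ * ENNReal.ofReal (A ^ n₁) * ENNReal.ofReal (dist x z ^ n₁) := by
        rw [Real.mul_rpow hA dist_nonneg, ENNReal.ofReal_mul (by positivity), mul_assoc]
    _ ≤ K₁ * ENNReal.ofReal (A ^ n₁) * (C * μ (f.symm '' ball (f x) R)) := by gcongr
    _ = (K₁ * (A ^ n₁).toNNReal * C : ℝ≥0) * μ (f.symm '' ball (f x) R) := by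
        rw [← mul_assoc]
        rfl

variable [MeasurableSpace Y] {ν : Measure Y}

theorem RatioControl.exists_ball_subset_image_ball (hf : RatioControl f)
    (hμ : BallBounds n₁ c₁ K₁ μ) (hν : BallBounds n₂ c₂ K₂ ν) :
    ∃ C : ℝ≥0, 0 < C ∧ ∀ (x a b : X) (ρ : ℝ), 0 < ρ → ρ ≤ dist a b →
      ∃ R : ℝ, 0 < R ∧ ball (f x) R ⊆ f '' ball x ρ ∧
        ν (f '' ball x ρ) ≤ C * ν (ball (f x) R) ∧
        μ (ball x ρ) ≤ C * μ (f.symm '' ball (f x) R) := by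
  obtain ⟨δ, hδ, hpoint⟩ := hμ.exists_dist_mem_Ico
  obtain ⟨T, hT, hinner⟩ := hf.exists_bound 1 one_pos
  obtain ⟨T', hT', houter⟩ := hf.exists_bound δ⁻¹ (inv_pos.2 hδ)
  set S := max T 1
  have hS : 0 < S := by positivity
  set C₁ : ℝ≥0 := K₂ * ((2 * T' * S) ^ n₂ / c₂).toNNReal
  obtain ⟨C₂, hC₂⟩ := hf.exists_measure_ball_le_symm_image hμ (inv_nonneg.2 hδ.le) hS
  refine ⟨C₁ + C₂ + 1, by positivity, fun x a b ρ hρ hab => ?_⟩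
  obtain ⟨z, hδz, hzρ⟩ := hpoint x a b ρ hρ hab
  have hρz : ρ ≤ δ⁻¹ * dist x z := by rwa [le_inv_mul_iff₀ hδ]
  have hd : 0 < dist (f x) (f z) :=
    dist_pos.2 (f.injective.ne (dist_pos.1 (hδz.trans_lt' (by positivity))))
  set R := dist (f x) (f z) / S
  have hR : 0 < R := by positivity
  have hRd : dist (f x) (f z) = S * R := (mul_div_cancel₀ _ hS.ne').symm
  refine ⟨R, hR, ?_, ?_, ?_⟩
  · calc ball (f x) R ⊆ ball (f x) (dist (f x) (f z) / T) :=
          ball_subset_ball (div_le_div_of_nonneg_left hd.le hT (le_max_left _ _))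
      _ ⊆ f '' ball x (dist x z) :=
          hinner.ball_subset_image_ball zero_le_one hT (one_mul (dist x z)).ge
      _ ⊆ f '' ball x ρ := image_mono (ball_subset_ball hzρ.le)
  · calc ν (f '' ball x ρ) ≤ ν (ball (f x) (2 * T' * S * R)) := by
          refine measure_mono ((houter.image_ball_subset_closedBall hρz).trans
            (closedBall_subset_ball ?_))
          rw [mul_assoc (2 * T'), ← hRd, mul_assoc]
          linarith [mul_pos hT' hd]
      _ ≤ C₁ * ν (ball (f x) R) :=
          hν.measure_ball_mul_le (by positivity) hR (div_le_self hd.le (le_max_right _ _))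
      _ ≤ (C₁ + C₂ + 1 : ℝ≥0) * ν (ball (f x) R) := by
          gcongr
          rw [add_assoc]
          exact le_self_add
  · refine (hC₂ x z ρ R hρ hρz hRd.le).trans ?_
    gcongr
    rw [add_right_comm]
    exact le_add_self

end BallComparison

section PullbackDensity

variable {X Y : Type*} [MetricSpace X] [MetricSpace Y] [MeasurableSpace X] [MeasurableSpace Y]
  {μ : Measure X} {ν : Measure Y} {f : X ≃ₜ Y} {w : X → ℝ≥0∞} {n₁ n₂ c₁ c₂ : ℝ} {K₁ K₂ : ℝ≥0}

lemma setLIntegral_sdiff_goodPart_le (hμ : BallsFinitePos μ) (c : ℝ≥0) (x : X) {ρ : ℝ}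
    (hρ : 0 < ρ) :
    ∫⁻ z in ball x ρ \ goodPart μ ν f w c x ρ, w z ∂μ ≤ c * ν (f '' ball x ρ) := by
  obtain ⟨hpos, hfin⟩ := hμ x ρ hρ
  calc ∫⁻ z in ball x ρ \ goodPart μ ν f w c x ρ, w z ∂μ
      ≤ ∫⁻ _ in ball x ρ \ goodPart μ ν f w c x ρ, c * ν (f '' ball x ρ) / μ (ball x ρ) ∂μ := by
        refine setLIntegral_mono measurable_const fun z ⟨hz, hgood⟩ => ?_
        rw [ENNReal.le_div_iff_mul_le (Or.inl hpos.ne') (Or.inl hfin.ne)]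
        exact (not_le.1 fun hle => hgood ⟨hz, hle⟩).le
    _ ≤ c * ν (f '' ball x ρ) / μ (ball x ρ) * μ (ball x ρ) := by
        rw [setLIntegral_const]
        gcongr
        exact sdiff_subset
    _ = c * ν (f '' ball x ρ) := ENNReal.div_mul_cancel hpos.ne' hfin.ne

variable [BorelSpace X]

lemma HasGoodParts.ae_ne_zero [Nontrivial X] (h : HasGoodParts μ ν f w)
    (hμ : BallBounds n₁ c₁ K₁ μ) (hν : BallsFinitePos ν) (hw : Measurable w) :
    ∀ᵐ x ∂μ, w x ≠ 0 := by
  obtain ⟨ε, c, hε, hc, h⟩ := h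
  obtain ⟨a, b, hab⟩ := exists_pair_ne X
  have hc₁ := hμ.const_pos
  have hsmall : ∀ᶠ j : ℤ in atTop, (2 : ℝ) ^ (-j) < dist a b :=
    (tendsto_two_zpow_neg_atTop.mono_right nhdsWithin_le_nhds).eventually_lt_const (dist_pos.2 hab)
  have hS : MeasurableSet {x | w x ≠ 0} := hw (measurableSet_singleton 0).compl
  filter_upwards [hμ.ae_eventually_measure_inter_ball_le hS] with x hx hwx
  obtain ⟨j, hj, hjab⟩ := ((hx (not_not.2 hwx) (ε * c₁ / 2) (by positivity)).and hsmall).exists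
  set ρ : ℝ := 2 ^ (-j)
  have hρ : 0 < ρ := by positivity
  have hsub : goodPart μ ν f w c x ρ ⊆ {x | w x ≠ 0} ∩ ball x ρ := fun z hz =>
    ⟨fun hz₀ => mul_ne_zero (ENNReal.coe_ne_zero.2 hc.ne')
      (hν.measure_image_ball_pos f x hρ).ne' (le_zero_iff.1 (by simpa [hz₀] using hz.2)), hz.1⟩
  have hle : ENNReal.ofReal (ε * c₁ * ρ ^ n₁) ≤ ENNReal.ofReal (ε * c₁ / 2 * ρ ^ n₁) :=
    calc ENNReal.ofReal (ε * c₁ * ρ ^ n₁) = ε * ENNReal.ofReal (c₁ * ρ ^ n₁) := by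
          rw [mul_assoc, ENNReal.ofReal_mul (by positivity), ENNReal.ofReal_coe_nnreal]
      _ ≤ ε * μ (ball x ρ) := by
          gcongr
          exact hμ.lower x a b ρ hρ hjab.le
      _ ≤ μ (goodPart μ ν f w c x ρ) := h x a b ρ hρ hjab.le
      _ ≤ μ ({x | w x ≠ 0} ∩ ball x ρ) := measure_mono hsub
      _ ≤ ENNReal.ofReal (ε * c₁ / 2 * ρ ^ n₁) := hj
  rw [ENNReal.ofReal_le_ofReal_iff (by positivity)] at hle
  have : 0 < ε * c₁ * ρ ^ n₁ := by positivity
  linarith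

lemma IsAInfty.exists_half_le_setLIntegral_sublevel (hA : IsAInfty μ w) (hw : Measurable w) :
    ∃ δ : ℝ≥0, 0 < δ ∧ ∀ (x : X) (ρ : ℝ) (I : ℝ≥0∞), 0 < ρ → I ≠ 0 → I ≠ ∞ →
      ∫⁻ z in ball x ρ, w z ∂μ = I →
        2⁻¹ * I ≤ ∫⁻ z in {z ∈ ball x ρ | w z * (δ * μ (ball x ρ)) ≤ I}, w z ∂μ := by
  obtain ⟨δ, hδ, hhalf⟩ := hA
  refine ⟨δ, hδ, fun x ρ I hρ hI₀ hI hIw => ?_⟩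
  set B := ball x ρ
  set S := {z ∈ B | I < w z * (δ * μ B)}
  have hS : MeasurableSet S :=
    measurableSet_ball.inter (measurableSet_lt measurable_const (hw.mul_const _))
  have hSB : S ⊆ B := sep_subset _ _
  have hchebyshev : I * μ S ≤ I * (δ * μ B) :=
    calc I * μ S = ∫⁻ _ in S, I ∂μ := (setLIntegral_const _ _).symm
      _ ≤ ∫⁻ z in S, w z * (δ * μ B) ∂μ :=
          setLIntegral_mono (hw.mul_const _) fun z hz => hz.2.le
      _ ≤ ∫⁻ z in B, w z * (δ * μ B) ∂μ := lintegral_mono_set hSB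
      _ = I * (δ * μ B) := by rw [lintegral_mul_const _ hw, hIw]
  have hlarge : ∫⁻ z in S, w z ∂μ ≤ 2⁻¹ * I :=
    hIw ▸ hhalf x ρ S hρ hS hSB ((ENNReal.mul_le_mul_iff_right hI₀ hI).1 hchebyshev)
  have hsplit : 2⁻¹ * I + 2⁻¹ * I ≤ 2⁻¹ * I + ∫⁻ z in B \ S, w z ∂μ :=
    calc 2⁻¹ * I + 2⁻¹ * I = ∫⁻ z in S ∪ B \ S, w z ∂μ := by
          rw [← add_mul, ENNReal.inv_two_add_inv_two, one_mul, union_sdiff_cancel hSB, hIw]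
      _ ≤ ∫⁻ z in S, w z ∂μ + ∫⁻ z in B \ S, w z ∂μ := lintegral_union_le _ _ _
      _ ≤ 2⁻¹ * I + ∫⁻ z in B \ S, w z ∂μ := by gcongr
  refine ((ENNReal.add_le_add_iff_left (by finiteness)).1 hsplit).trans (lintegral_mono_set ?_)
  exact fun z hz => ⟨hz.1, not_lt.1 fun hlt => hz.2 ⟨hz.1, hlt⟩⟩

variable [BorelSpace Y]

lemma IsPullbackDensity.setLIntegral_eq (hd : IsPullbackDensity μ ν f w) {A : Set X}
    (hA : MeasurableSet A) : ∫⁻ x in A, w x ∂μ = ν (f '' A) := by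
  rw [← withDensity_apply w hA, hd.withDensity_eq, map_symm_apply_eq]

lemma IsPullbackDensity.lintegral_mul_eq (hd : IsPullbackDensity μ ν f w) {g : X → ℝ≥0∞}
    (hg : Measurable g) : ∫⁻ x, w x * g x ∂μ = ∫⁻ y, g (f.symm y) ∂ν := by
  rw [← lintegral_map hg f.symm.measurable, ← hd.withDensity_eq]
  exact (lintegral_withDensity_eq_lintegral_mul μ hd.measurable hg).symm

lemma IsPullbackDensity.changeOfVariablesLE (hd : IsPullbackDensity μ ν f w) :
    ChangeOfVariablesLE μ ν f w := fun G hG => by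
  refine (hd.lintegral_mul_eq (hG.comp f.measurable)).trans_le ?_
  simp only [Function.comp_apply, f.apply_symm_apply, le_refl]

lemma IsPullbackDensity.changeOfVariablesLE_symm (hd : IsPullbackDensity μ ν f w) :
    ChangeOfVariablesLE ν μ f.symm fun y => (w (f.symm y))⁻¹ := fun G hG => by
  refine (hd.lintegral_mul_eq (hd.measurable.inv.mul hG)).symm.trans_le (lintegral_mono fun x => ?_)
  rw [Pi.mul_apply, Pi.inv_apply]
  rw [← mul_assoc]
  exact mul_le_of_le_one_left' (ENNReal.mul_inv_le_one _)

theorem IsPullbackDensity.hasGoodParts [Nontrivial X] (hd : IsPullbackDensity μ ν f w)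
    (hA : IsAInfty μ w) (hf : RatioControl f) (hμ : BallsFinitePos μ) (hν : BallsFinitePos ν) :
    HasGoodParts μ ν f w := by
  obtain ⟨δ, hδ, hhalf⟩ := hA
  refine ⟨δ, 4⁻¹, hδ, by positivity, fun x _ _ ρ hρ _ => ?_⟩
  by_contra! hlt
  set B := ball x ρ
  set G := goodPart μ ν f w 4⁻¹ x ρ
  set I := ν (f '' B)
  have hI₀ : I ≠ 0 := (hν.measure_image_ball_pos f x hρ).ne'
  have hI : I ≠ ∞ := (hf.measure_image_ball_lt_top hν x hρ).ne
  have hIw : ∫⁻ z in B, w z ∂μ = I := hd.setLIntegral_eq measurableSet_ball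
  have hGB : G ⊆ B := sep_subset _ _
  have hgood : ∫⁻ z in G, w z ∂μ ≤ 2⁻¹ * I :=
    hIw ▸ hhalf x ρ G hρ (measurableSet_ball.inter
      (measurableSet_le measurable_const (hd.measurable.mul_const _))) hGB hlt.le
  have hbad : ∫⁻ z in B \ G, w z ∂μ < 2⁻¹ * I :=
    (setLIntegral_sdiff_goodPart_le hμ 4⁻¹ x hρ).trans_lt
      ((ENNReal.mul_lt_mul_iff_left hI₀ hI).2 (by
        rw [ENNReal.coe_inv four_ne_zero, ENNReal.inv_lt_inv]
        norm_num))
  refine lt_irrefl I ?_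
  calc I = ∫⁻ z in G ∪ B \ G, w z ∂μ := by rw [union_sdiff_cancel hGB, hIw]
    _ ≤ ∫⁻ z in G, w z ∂μ + ∫⁻ z in B \ G, w z ∂μ := lintegral_union_le _ _ _
    _ < 2⁻¹ * I + 2⁻¹ * I := ENNReal.add_lt_add_of_le_of_lt
        (hgood.trans_lt (by finiteness)).ne hgood hbad
    _ = I := by rw [← add_mul, ENNReal.inv_two_add_inv_two, one_mul]

theorem IsPullbackDensity.hasGoodParts_symm [Nontrivial X] (hd : IsPullbackDensity μ ν f w)
    (hA : IsAInfty μ w) (hf : RatioControl f) (hμ : BallBounds n₁ c₁ K₁ μ)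
    (hν : BallBounds n₂ c₂ K₂ ν) :
    HasGoodParts ν μ f.symm fun y => (w (f.symm y))⁻¹ := by
  have : Nontrivial Y := f.injective.nontrivial
  obtain ⟨C, hC, hball⟩ := hf.symm.exists_ball_subset_image_ball hν hμ
  obtain ⟨δ, hδ, hhalf⟩ := hA.exists_half_le_setLIntegral_sublevel hd.measurable
  have hC₀ : (C : ℝ≥0∞) ≠ 0 := ENNReal.coe_ne_zero.2 hC.ne'
  refine ⟨2⁻¹ * C⁻¹, δ * C⁻¹, by positivity, by positivity, fun y a b ρ hρ hab => ?_⟩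
  obtain ⟨R, hR, hsub, hμC, hνC⟩ := hball y a b ρ hρ hab
  rw [← ENNReal.inv_mul_le_iff hC₀ ENNReal.coe_ne_top] at hμC hνC
  set B := ball (f.symm y) R
  set I := ν (f '' B)
  have hI₀ : I ≠ 0 := (hν.ballsFinitePos.measure_image_ball_pos f _ hR).ne'
  have hI : I ≠ ∞ := (hf.measure_image_ball_lt_top hν.ballsFinitePos _ hR).ne
  have hfB : f '' B ⊆ ball y ρ := by
    rintro _ ⟨z, hz, rfl⟩
    obtain ⟨v, hv, rfl⟩ := hsub hz
    rwa [f.apply_symm_apply]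
  have hgood : f '' {z ∈ B | w z * (δ * μ B) ≤ I} ⊆
      goodPart ν μ f.symm (fun y => (w (f.symm y))⁻¹) (δ * C⁻¹) y ρ := by
    rintro _ ⟨z, ⟨hz, hzI⟩, rfl⟩
    refine ⟨hfB (mem_image_of_mem f hz), ?_⟩
    calc ((δ * C⁻¹ : ℝ≥0) : ℝ≥0∞) * μ (f.symm '' ball y ρ)
        = δ * ((C : ℝ≥0∞)⁻¹ * μ (f.symm '' ball y ρ)) := by
          rw [ENNReal.coe_mul, ENNReal.coe_inv hC.ne', mul_assoc]
      _ ≤ δ * μ B := by gcongr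
      _ ≤ I / w z := by rwa [ENNReal.le_div_iff_mul_le (Or.inr hI₀) (Or.inr hI), mul_comm]
      _ ≤ (w (f.symm (f z)))⁻¹ * ν (ball y ρ) := by
          rw [f.symm_apply_apply, ENNReal.div_eq_inv_mul]
          gcongr
          exact measure_mono hfB
  have hmeas : MeasurableSet {z ∈ B | w z * (δ * μ B) ≤ I} :=
    measurableSet_ball.inter (measurableSet_le (hd.measurable.mul_const _) measurable_const)
  calc ((2⁻¹ * C⁻¹ : ℝ≥0) : ℝ≥0∞) * ν (ball y ρ) = 2⁻¹ * ((C : ℝ≥0∞)⁻¹ * ν (ball y ρ)) := by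
        rw [ENNReal.coe_mul, ENNReal.coe_inv hC.ne', ENNReal.coe_inv two_ne_zero, mul_assoc]
        rfl
    _ ≤ 2⁻¹ * I := by
        gcongr
        exact hνC
    _ ≤ ν (f '' {z ∈ B | w z * (δ * μ B) ≤ I}) := by
        rw [← hd.setLIntegral_eq hmeas]
        exact hhalf _ R I hR hI₀ hI (hd.setLIntegral_eq measurableSet_ball)
    _ ≤ ν (goodPart ν μ f.symm (fun y => (w (f.symm y))⁻¹) (δ * C⁻¹) y ρ) := measure_mono hgood

lemma IsPullbackDensity.quasiMeasurePreserving (hd : IsPullbackDensity μ ν f w)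
    (hw : ∀ᵐ x ∂μ, w x ≠ 0) : Measure.QuasiMeasurePreserving f μ ν := by
  refine ⟨f.measurable, ?_⟩
  have hac : μ ≪ ν.map f.symm :=
    hd.withDensity_eq ▸ withDensity_absolutelyContinuous' hd.measurable.aemeasurable hw
  have hmap := hac.map f.measurable
  rwa [Measure.map_map f.measurable f.symm.measurable, f.self_comp_symm, Measure.map_id] at hmap

lemma IsPullbackDensity.quasiMeasurePreserving_symm (hd : IsPullbackDensity μ ν f w) :
    Measure.QuasiMeasurePreserving f.symm ν μ :=
  ⟨f.symm.measurable, hd.withDensity_eq ▸ withDensity_absolutelyContinuous μ w⟩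

end PullbackDensity

section CompositionOperators

variable {X Y : Type*} [MetricSpace X] [MetricSpace Y] [MeasurableSpace X] [MeasurableSpace Y]
  {μ : Measure X} {ν : Measure Y} {p s₁ s₂ : ℝ} {q : ℝ≥0∞}

lemma hajlaszTLNorm_eq_zero_of_subsingleton [Subsingleton X] {s : ℝ} (hp : 0 < p) (hq : 0 < q)
    (u : X → ℝ) : hajlaszTLNorm s p q μ u = 0 := by
  have hgrad : IsFracHajlaszGradient s μ u 0 := by
    refine ⟨fun _ => aemeasurable_const, ∅, measure_empty, fun k x y _ _ h _ => ?_⟩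
    rw [Subsingleton.elim x y, dist_self] at h
    exact absurd h (not_le.2 (by positivity))
  have hell : ellNorm q 0 = 0 := by
    rw [ellNorm]
    split_ifs with hqt
    · simp
    · have hq' := ENNReal.toReal_pos hq.ne' hqt
      simp [hq']
  have hzero : mixedNorm p q μ (0 : ℤ → X → ℝ≥0) = 0 := by
    change (∫⁻ _, ellNorm q 0 ^ p ∂μ) ^ (1 / p) = 0
    simp [hell, hp]
  exact le_antisymm (hzero ▸ iInf₂_le 0 hgrad) zero_le

lemma comp_mem_MSpace_of_subsingleton [Subsingleton X] (hp : 0 < p) (hq : 0 < q) {C : ℝ≥0∞}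
    (f : X → Y) (u : Y → ℝ) :
    u ∘ f ∈ MSpace s₁ p q μ ∧
      hajlaszTLNorm s₁ p q μ (u ∘ f) ≤ C * hajlaszTLNorm s₂ p q ν u := by
  rw [MSpace, mem_ofPred_eq, hajlaszTLNorm_eq_zero_of_subsingleton hp hq]
  exact ⟨⟨Subsingleton.measurable.aemeasurable, ENNReal.zero_lt_top⟩, zero_le⟩

variable [Nontrivial X] [BorelSpace X] [BorelSpace Y] {f : X ≃ₜ Y} {w : X → ℝ≥0∞}
  {n₁ n₂ c₁ c₂ : ℝ} {K₁ K₂ : ℝ≥0}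

lemma ReverseHolder.exists_isPullbackDensity_isAInfty {r : ℝ≥0∞}
    (hJ : ReverseHolder r μ (volDeriv μ ν f)) (hr : 1 < r) (hf : RatioControl f)
    (hμ : BallBounds n₁ c₁ K₁ μ) (hν : BallsFinitePos ν) (hac : AbsContMap μ ν f) :
    ∃ w, IsPullbackDensity μ ν f w ∧ IsAInfty μ w := by
  obtain ⟨w, C, hd, hw⟩ := hμ.exists_isPullbackDensity hf hν hac
  have hrw : ReverseHolder r μ w :=
    hJ.of_comparable (one_pos.trans hr) (hw.mono fun _ h => h.1) (hw.mono fun _ h => h.2)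
  exact ⟨w, hd, hrw.isAInfty hr hμ.ballsFinitePos hd.measurable.aemeasurable⟩

theorem IsPullbackDensity.exists_hajlaszTLNorm_comp_le (hd : IsPullbackDensity μ ν f w)
    (hA : IsAInfty μ w) (hf : RatioControl f) (hμ : BallBounds n₁ c₁ K₁ μ)
    (hν : BallBounds n₂ c₂ K₂ ν) (hp : 0 < p) (hs₁ : s₁ * p = n₁) (hs₂ : s₂ * p = n₂)
    (hq : 0 < q) :
    ∃ C : ℝ≥0, ∀ u ∈ MSpace s₂ p q ν, u ∘ f ∈ MSpace s₁ p q μ ∧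
      hajlaszTLNorm s₁ p q μ (u ∘ f) ≤ C * hajlaszTLNorm s₂ p q ν u := by
  have : Nontrivial Y := f.injective.nontrivial
  have hgood := hd.hasGoodParts hA hf hμ.ballsFinitePos hν.ballsFinitePos
  have hw := hgood.ae_ne_zero hμ hν.ballsFinitePos hd.measurable
  exact hf.exists_hajlaszTLNorm_comp_le hμ hν (hd.quasiMeasurePreserving hw) hd.measurable hgood
    hd.changeOfVariablesLE hp hs₁ hs₂ hq

theorem IsPullbackDensity.exists_hajlaszTLNorm_comp_symm_le (hd : IsPullbackDensity μ ν f w)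
    (hA : IsAInfty μ w) (hf : RatioControl f) (hμ : BallBounds n₁ c₁ K₁ μ)
    (hν : BallBounds n₂ c₂ K₂ ν) (hp : 0 < p) (hs₁ : s₁ * p = n₁) (hs₂ : s₂ * p = n₂)
    (hq : 0 < q) :
    ∃ C : ℝ≥0, ∀ v ∈ MSpace s₁ p q μ, v ∘ f.symm ∈ MSpace s₂ p q ν ∧
      hajlaszTLNorm s₂ p q ν (v ∘ f.symm) ≤ C * hajlaszTLNorm s₁ p q μ v :=
  have : Nontrivial Y := f.injective.nontrivial
  hf.symm.exists_hajlaszTLNorm_comp_le hν hμ hd.quasiMeasurePreserving_symm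
    (hd.measurable.comp f.symm.measurable).inv (hd.hasGoodParts_symm hA hf hμ hν)
    hd.changeOfVariablesLE_symm hp hs₂ hs₁ hq

end CompositionOperators

end HajlaszTL

end

theorem corollary5p2_general {X Y : Type*}
    [MetricSpace X] [MeasurableSpace X] [BorelSpace X]
    [MetricSpace Y] [MeasurableSpace Y] [BorelSpace Y]
    (μX : Measure X) (μY : Measure Y)
    (hμX : HajlaszTL.BallsFinitePos μX) (hμY : HajlaszTL.BallsFinitePos μY)
    (n₁ n₂ : ℝ) (hn₁ : 0 < n₁) (hn₂ : 0 < n₂)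
    (hX : HajlaszTL.AhlforsRegular n₁ μX) (hY : HajlaszTL.AhlforsRegular n₂ μY)
    (f : X ≃ₜ Y) (hf : HajlaszTL.Quasisymmetric f) (hac : HajlaszTL.AbsContMap μX μY f)
    (r : ℝ≥0∞) (hr : 1 < r)
    (hJ : HajlaszTL.ReverseHolder r μX (HajlaszTL.volDeriv μX μY f))
    (s₁ s₂ : ℝ) (hs₁ : 0 < s₁) (hs₂ : 0 < s₂) (hs : n₁ / s₁ = n₂ / s₂)
    (q : ℝ≥0∞) (hq : 0 < q) :
    ∃ C : ℝ≥0,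
      (∀ u ∈ HajlaszTL.MSpace s₂ (n₂ / s₂) q μY,
        u ∘ f ∈ HajlaszTL.MSpace s₁ (n₁ / s₁) q μX ∧
        HajlaszTL.hajlaszTLNorm s₁ (n₁ / s₁) q μX (u ∘ f) ≤
          C * HajlaszTL.hajlaszTLNorm s₂ (n₂ / s₂) q μY u) ∧
      (∀ v ∈ HajlaszTL.MSpace s₁ (n₁ / s₁) q μX,
        v ∘ f.symm ∈ HajlaszTL.MSpace s₂ (n₂ / s₂) q μY ∧
        HajlaszTL.hajlaszTLNorm s₂ (n₂ / s₂) q μY (v ∘ f.symm) ≤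
          C * HajlaszTL.hajlaszTLNorm s₁ (n₁ / s₁) q μX v) := by
  have hp : 0 < n₁ / s₁ := div_pos hn₁ hs₁
  have hp₁ : s₁ * (n₁ / s₁) = n₁ := mul_div_cancel₀ _ hs₁.ne'
  have hp₂ : s₂ * (n₁ / s₁) = n₂ := hs ▸ mul_div_cancel₀ _ hs₂.ne'
  rw [← hs]
  rcases subsingleton_or_nontrivial X with _ | _
  · have : Subsingleton Y := f.symm.injective.subsingleton
    exact ⟨0, fun u _ => HajlaszTL.comp_mem_MSpace_of_subsingleton hp hq f u,
      fun v _ => HajlaszTL.comp_mem_MSpace_of_subsingleton hp hq f.symm v⟩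
  have : Nontrivial Y := f.injective.nontrivial
  obtain ⟨c₁, K₁, hX⟩ := hX.exists_ballBounds hn₁ hμX
  obtain ⟨c₂, K₂, hY⟩ := hY.exists_ballBounds hn₂ hμY
  obtain ⟨w, hd, hA⟩ := hJ.exists_isPullbackDensity_isAInfty hr hf.ratioControl hX hμY hac
  obtain ⟨C₁, h₁⟩ := hd.exists_hajlaszTLNorm_comp_le hA hf.ratioControl hX hY hp hp₁ hp₂ hq
  obtain ⟨C₂, h₂⟩ := hd.exists_hajlaszTLNorm_comp_symm_le hA hf.ratioControl hX hY hp hp₁ hp₂ hq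
  refine ⟨max C₁ C₂, fun u hu => ⟨(h₁ u hu).1, (h₁ u hu).2.trans ?_⟩,
    fun v hv => ⟨(h₂ v hv).1, (h₂ v hv).2.trans ?_⟩⟩
  · gcongr
    exact le_max_left _ _
  · gcongr
    exact le_max_right _ _

theorem corollary5p2 {X Y : Type*}
    [MetricSpace X] [MeasurableSpace X] [BorelSpace X]
    [MetricSpace Y] [MeasurableSpace Y] [BorelSpace Y]
    (μX : Measure X) (μY : Measure Y)
    (hμX : HajlaszTL.BallsFinitePos μX) (hμY : HajlaszTL.BallsFinitePos μY)
    (n₁ n₂ : ℝ) (hn₁ : 0 < n₁) (hn₂ : 0 < n₂)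
    (hX : HajlaszTL.AhlforsRegular n₁ μX) (hY : HajlaszTL.AhlforsRegular n₂ μY)
    (f : X ≃ₜ Y) (hf : HajlaszTL.Quasisymmetric f)
    (hac : HajlaszTL.AbsContMap μX μY f) (hac' : HajlaszTL.AbsContMap μY μX f.symm)
    (r : ℝ≥0∞) (hr : 1 < r)
    (hJ : HajlaszTL.ReverseHolder r μX (HajlaszTL.volDeriv μX μY f))
    (s₁ s₂ : ℝ) (hs₁ : s₁ ∈ Ioo 0 n₁) (hs₂ : s₂ ∈ Ioo 0 n₂) (hs : n₁ / s₁ = n₂ / s₂)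
    (q : ℝ≥0∞) (hq : 0 < q) :
    ∃ C : ℝ≥0,
      (∀ u ∈ HajlaszTL.MSpace s₂ (n₂ / s₂) q μY,
        u ∘ f ∈ HajlaszTL.MSpace s₁ (n₁ / s₁) q μX ∧
        HajlaszTL.hajlaszTLNorm s₁ (n₁ / s₁) q μX (u ∘ f) ≤
          C * HajlaszTL.hajlaszTLNorm s₂ (n₂ / s₂) q μY u) ∧
      (∀ v ∈ HajlaszTL.MSpace s₁ (n₁ / s₁) q μX,
        v ∘ f.symm ∈ HajlaszTL.MSpace s₂ (n₂ / s₂) q μY ∧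
        HajlaszTL.hajlaszTLNorm s₂ (n₂ / s₂) q μY (v ∘ f.symm) ≤
          C * HajlaszTL.hajlaszTLNorm s₁ (n₁ / s₁) q μX v) := by
  exact corollary5p2_general μX μY hμX hμY n₁ n₂ hn₁ hn₂ hX hY f hf hac r hr hJ s₁ s₂ hs₁.1 hs₂.1 hs
    q hq
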